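/- Let $SO(3)$ act on the unit sphere $S^2\subset\mathbb R^3$. Let $H\subset SO(3)$ and the subsets $X_0,X_1,X_2\subset S^2$ be one of the following. (a) *Dihedral case.* For some integer $n\ge 2$, $H=\mathbb D_{2n}$ is the group of order $2n$ generated by $$a=\begin{pmatrix}1&0&0\\0&\cos(2\pi/n)&-\sin(2\pi/n)\\0&\sin(2\pi/n)&\cos(2\pi/n)\end{pmatrix},\qquad b=\begin{pmatrix}-1&0&0\\0&1&0\\0&0&-1\end{pmatrix},$$ and $$X_0=\{(0,\cos\tfrac{\pi+2k\pi}{n},\sin\tfrac{\pi+2k\pi}{n}):1\le k\le n\},\quad X_1=\{(0,\cos\tfrac{2k\pi}{n},\sin\tfrac{2k\pi}{n}):1\le k\le n\},\quad X_2=\{(\pm1,0,0)\}.$$ (b) *Polyhedral case.* $H$ is the group of rotations in $SO(3)$ that preserve a regular tetrahedron, octahedron or icosahedron inscribed in $S^2$ (in arbitrary position); $X_0$ is its set of vertices, $X_1$ is the set of radial projections to $S^2$ of the midpoints of its edges, and $X_2$ is the set of radial projections to $S^2$ of the barycenters of its faces. Put $X=X_0\cup X_1\cup X_2$, and let $\mathrm{Fix}(H)$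 be the set of points of $S^2$ that are fixed by some nontrivial element of $H$. Then $X=\mathrm{Fix}(H)$, and there is a smooth Morse function $f:S^2\to\mathbb R$ such that 1. $f(h\cdot p)=f(p)$ for all $h\in H$ and $p\in S^2$; 2. the set of critical points of $f$ is exactly $X$; 3. for $i\in\{0,1,2\}$, every $p\in X_i$ has Morse index $i$; 4. for $i\in\{0,1,2\}$ and every $p\in X_i$ there are stereographic coordinates $\psi$ at $p$ with $f(\psi(x,y))=q_i(x,y)$ for all $(x,y)$ in a neighborhood of $(0,0)$, where $$q_0(x,y)=\frac{x^2+y^2}{2}-1,\qquad q_1(x,y)=\frac{y^2-x^2}{2},\qquad q_2(x,y)=1-\frac{x^2+y^2}{2}.$$ Here stereographic coordinates at $p$ are a map $\psi:\mathbb R^2\to S^2$ of the form $\psi(x,y)=A\cdot\frac{1}{1+x^2+y^2}(2x,2y,1-x^2-y^2)$ with $A\in SO(3)$ and $A\cdot(0,0,1)=p$. -/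

import Mathlib

open scoped Manifold ContDiff Topology Matrix RealInnerProductSpace

noncomputable section

namespace SphereMorse

/-! ### Critical points, Hessian, Morse index, Morse functions -/

section Morse

variable (n : ℕ) {M : Type*} [TopologicalSpace M] [ChartedSpace (EuclideanSpace ℝ (Fin n)) M]

/-- The critical set `{p | df_p = 0}` of a function on an `n`-manifold. -/
def critSet (f : M → ℝ) : Set M :=
  {p | mfderiv (𝓡 n) 𝓘(ℝ, ℝ) f p = 0}

/-- The matrix of second partial derivatives of `f` at `p`, in the preferred chart at `p`. At a
critical point of a smooth function this is a symmetric matrix, and its number of positive, zero and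
negative eigenvalues does not depend on the chart.  (For the unit sphere the preferred chart at `p`
is the stereographic projection from `-p`, scaled so that its derivative at `p` is an isometry, so
at a critical point this is the Riemannian Hessian in an orthonormal basis.) -/
def hessianMatrix (f : M → ℝ) (p : M) : Matrix (Fin n) (Fin n) ℝ :=
  Matrix.of fun i j =>
    fderiv ℝ
      (fun y => fderiv ℝ (f ∘ (extChartAt (𝓡 n) p).symm) y (EuclideanSpace.single j (1 : ℝ)))
      (extChartAt (𝓡 n) p p) (EuclideanSpace.single i (1 : ℝ))

/-- The Morse index at `p`: the number of negative eigenvalues of the Hessian, with multiplicity. -/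
def morseIndex (f : M → ℝ) (p : M) : ℕ :=
  Multiset.card ((hessianMatrix n f p).charpoly.roots.filter (· < 0))

/-- A Morse function: smooth, and at each critical point `0` is not an eigenvalue of the Hessian. -/
def IsMorse (f : M → ℝ) : Prop :=
  ContMDiff (𝓡 n) 𝓘(ℝ, ℝ) ∞ f ∧ ∀ p ∈ critSet n f, (hessianMatrix n f p).det ≠ 0

end Morse

/-! ### The sphere with the action of the rotation group -/

/-- Euclidean three-space. -/
abbrev E3 : Type := EuclideanSpace ℝ (Fin 3)

/-- The unit sphere in three-space. -/
abbrev S2 : Type := Metric.sphere (0 : E3) 1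

/-- The rotation group `SO(3)`. -/
abbrev SO3 : Type := Matrix.specialOrthogonalGroup (Fin 3) ℝ

theorem norm_rotate (A : SO3) (x : E3) : ‖WithLp.toLp 2 (A.1 *ᵥ x.ofLp)‖ = ‖x‖ := by
  have hA : A.1ᵀ * A.1 = 1 := by
    have h := (Matrix.mem_specialOrthogonalGroup_iff.1 A.2).1
    exact (Matrix.mem_orthogonalGroup_iff' (Fin 3) ℝ).1 h
  have key : (A.1 *ᵥ x.ofLp) ⬝ᵥ (A.1 *ᵥ x.ofLp) = x.ofLp ⬝ᵥ x.ofLp := by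
    rw [Matrix.dotProduct_mulVec, ← Matrix.mulVec_transpose, Matrix.mulVec_mulVec, hA,
      Matrix.one_mulVec]
  rw [EuclideanSpace.norm_eq, EuclideanSpace.norm_eq]
  congr 1
  simpa [dotProduct, pow_two] using key

/-- `SO(3)` acts on the unit sphere by `A • p = A p`. -/
instance : MulAction SO3 S2 where
  smul A p := ⟨WithLp.toLp 2 (A.1 *ᵥ p.1.ofLp), by
    rw [mem_sphere_zero_iff_norm, norm_rotate]
    exact mem_sphere_zero_iff_norm.1 p.2⟩
  one_smul p := Subtype.ext (by
    change WithLp.toLp 2 ((1 : Matrix (Fin 3) (Fin 3) ℝ) *ᵥ p.1.ofLp) = p.1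
    rw [Matrix.one_mulVec])
  mul_smul A B p := Subtype.ext (by
    change WithLp.toLp 2 ((A.1 * B.1) *ᵥ p.1.ofLp) = WithLp.toLp 2 (A.1 *ᵥ (B.1 *ᵥ p.1.ofLp))
    rw [Matrix.mulVec_mulVec])

/-- The points of the sphere that are fixed by some nontrivial element of `H`. -/
def fixedSet (H : Subgroup SO3) : Set S2 :=
  {p | ∃ h ∈ H, h ≠ 1 ∧ h • p = p}

/-! ### Stereographic coordinates -/

/-- The north pole `(0, 0, 1)`. -/
def northPole : S2 :=
  ⟨!₂[0, 0, 1], by simp [EuclideanSpace.norm_eq, Fin.sum_univ_three]⟩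

/-- `(x, y) ↦ (2x, 2y, 1 - x² - y²) / (1 + x² + y²)`. -/
def stereo (z : ℝ × ℝ) : S2 :=
  ⟨(1 + z.1 ^ 2 + z.2 ^ 2)⁻¹ • !₂[2 * z.1, 2 * z.2, 1 - z.1 ^ 2 - z.2 ^ 2], by
    have h : 0 < 1 + z.1 ^ 2 + z.2 ^ 2 := by positivity
    have h2 : ‖(!₂[2 * z.1, 2 * z.2, 1 - z.1 ^ 2 - z.2 ^ 2] : E3)‖ = 1 + z.1 ^ 2 + z.2 ^ 2 := by
      rw [EuclideanSpace.norm_eq, Real.sqrt_eq_iff_mul_self_eq_of_pos h]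
      simp [Fin.sum_univ_three]
      ring
    rw [mem_sphere_zero_iff_norm, norm_smul, h2, Real.norm_of_nonneg (by positivity),
      inv_mul_cancel₀ h.ne']⟩

/-- Stereographic coordinates at `p`: the map `stereo` followed by a rotation that takes the north
pole to `p`. -/
def IsStereographicAt (p : S2) (ψ : ℝ × ℝ → S2) : Prop :=
  ∃ A : SO3, A • northPole = p ∧ ψ = fun z => A • stereo z

/-- The local models `q₀`, `q₁`, `q₂`. -/
def localModel : Fin 3 → ℝ × ℝ → ℝ :=
  ![fun z => (z.1 ^ 2 + z.2 ^ 2) / 2 - 1,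
    fun z => (z.2 ^ 2 - z.1 ^ 2) / 2,
    fun z => 1 - (z.1 ^ 2 + z.2 ^ 2) / 2]

/-! ### The dihedral groups -/

/-- The rotation by `2π/n` about the first coordinate axis. -/
def dihedralA (n : ℕ) : SO3 :=
  ⟨!![1, 0, 0;
      0, Real.cos (2 * Real.pi / n), -Real.sin (2 * Real.pi / n);
      0, Real.sin (2 * Real.pi / n), Real.cos (2 * Real.pi / n)], by
    have h := Real.sin_sq_add_cos_sq (2 * Real.pi / n)
    rw [Matrix.mem_specialOrthogonalGroup_iff, Matrix.mem_orthogonalGroup_iff]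
    constructor
    · ext i j
      fin_cases i <;> fin_cases j <;>
        simp [Matrix.mul_apply, Fin.sum_univ_three] <;> nlinarith
    · simp [Matrix.det_fin_three]
      nlinarith⟩

/-- The rotation by `π` about the second coordinate axis. -/
def dihedralB : SO3 :=
  ⟨!![-1, 0, 0; 0, 1, 0; 0, 0, -1], by
    rw [Matrix.mem_specialOrthogonalGroup_iff, Matrix.mem_orthogonalGroup_iff]
    constructor
    · ext i j
      fin_cases i <;> fin_cases j <;> simp [Matrix.mul_apply, Fin.sum_univ_three]
    · simp [Matrix.det_fin_three]⟩

/-- The dihedral group of order `2n`. -/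
def dihedral (n : ℕ) : Subgroup SO3 :=
  Subgroup.closure {dihedralA n, dihedralB}

/-- The sets `X₀`, `X₁`, `X₂` for the dihedral group of order `2n`. -/
def dihedralPoints (n : ℕ) : Fin 3 → Set S2 :=
  ![{p | ∃ k : ℕ, 1 ≤ k ∧ k ≤ n ∧
      (p : E3) = !₂[0, Real.cos ((Real.pi + 2 * k * Real.pi) / n),
        Real.sin ((Real.pi + 2 * k * Real.pi) / n)]},
    {p | ∃ k : ℕ, 1 ≤ k ∧ k ≤ n ∧
      (p : E3) = !₂[0, Real.cos (2 * k * Real.pi / n), Real.sin (2 * k * Real.pi / n)]},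
    {p | (p : E3) = !₂[1, 0, 0] ∨ (p : E3) = !₂[-1, 0, 0]}]

/-! ### The polyhedral groups -/

/-- The radial projection from three-space minus the origin to the unit sphere. -/
def radial (x : E3) : E3 := ‖x‖⁻¹ • x

/-- The vertices of a regular tetrahedron inscribed in the sphere. -/
def tetrahedron : Set S2 :=
  {p | (p : E3) ∈ radial '' {!₂[1, 1, 1], !₂[1, -1, -1], !₂[-1, 1, -1], !₂[-1, -1, 1]}}

/-- The vertices of a regular octahedron inscribed in the sphere. -/
def octahedron : Set S2 :=
  {p | (p : E3) ∈ radial ''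
    {!₂[1, 0, 0], !₂[-1, 0, 0], !₂[0, 1, 0], !₂[0, -1, 0], !₂[0, 0, 1], !₂[0, 0, -1]}}

/-- The vertices of a regular icosahedron inscribed in the sphere: the normalized cyclic
permutations of `(0, ±1, ±φ)`, with `φ` the golden ratio. -/
def icosahedron : Set S2 :=
  {p | ∃ s t : ℝ, (s = 1 ∨ s = -1) ∧ (t = 1 ∨ t = -1) ∧
    (p : E3) ∈ radial '' {!₂[0, s, t * Real.goldenRatio], !₂[s, t * Real.goldenRatio, 0],
      !₂[t * Real.goldenRatio, 0, s]}}

/-- `V` is the set of vertices of a regular tetrahedron, octahedron or icosahedron inscribed in the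
unit sphere, in an arbitrary position. -/
def IsRegularPolyhedron (V : Set S2) : Prop :=
  ∃ g : SO3, ∃ W : Set S2, (W = tetrahedron ∨ W = octahedron ∨ W = icosahedron) ∧
    V = (fun p => g • p) '' W

open scoped Pointwise in
/-- The group of rotations that map the vertex set `V` onto itself. -/
def polyhedral (V : Set S2) : Subgroup SO3 := MulAction.stabilizer SO3 V

/-- `S` is the set of vertices of a proper face of the convex hull of `V`, i.e. the set of points
of `V` in some supporting plane. -/
def IsFace (V : Set S2) (S : Finset S2) : Prop :=
  ∃ (a : E3) (c : ℝ), a ≠ 0 ∧ (∀ v ∈ V, ⟪a, (v : E3)⟫ ≤ c) ∧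
    (S : Set S2) = {v ∈ V | ⟪a, (v : E3)⟫ = c}

/-- The barycenter of a finite set of points. -/
def barycenter (S : Finset S2) : E3 := (S.card : ℝ)⁻¹ • ∑ v ∈ S, (v : E3)

/-- The sets `X₀`, `X₁`, `X₂` for the polyhedral group of the polyhedron with vertices `V`: the
vertices, and the radial projections of the midpoints of the edges (the faces with two vertices)
and of the barycenters of the two-dimensional faces (those with at least three vertices). -/
def polyhedralPoints (V : Set S2) : Fin 3 → Set S2 :=
  ![V,
    {p | ∃ S : Finset S2, IsFace V S ∧ S.card = 2 ∧ (p : E3) = radial (barycenter S)},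
    {p | ∃ S : Finset S2, IsFace V S ∧ 3 ≤ S.card ∧ (p : E3) = radial (barycenter S)}]

end SphereMorse

end

noncomputable section

namespace SphereMorse

/-! ### Rotations of three-space -/

/-! It suffices to find one invariant "seed": a smooth `H`-invariant function `F` on three-space
whose critical points on the sphere all lie in `X`, whose Hessian on the sphere has index `i` at a
representative of each `X i`, and whose values there increase with `i` (`IsMorseSeed`). The seed is
then corrected near its critical points.

A seed also gives `X = Fix(H)`. If a nontrivial rotation in `H` fixes `p`, the differential of `F`
on the tangent plane at `p` is invariant under a nontrivial plane rotation, so it is zero and `p` is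
critical (`isTangentCritical_of_fixed`). Conversely each point of `X` is a translate of a
representative that is fixed by an explicit nontrivial element.

The correction (`IsMorseSeed.hasMorseModel`): compose `F` with an increasing `Θ` so that the three
critical values become -1, 0, 1. Near each critical point replace `G = Θ ∘ F` by `G + χ (m - G)`,
where `m` is the local model in stereographic coordinates and `χ` is a cutoff with `|s χ'(s)|`
uniformly small, `s` being half the squared distance to the point. In a frame where the Hessian is
diagonal, both `G` and `m` increase at rate at least a constant times `ρ²` along the tangential
gradient field of the model form, `ρ` being the distance to the axis through the point. The cutoff
contributes only a small multiple of `ρ²`, so no critical point appears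
(`exists_nhds_not_critical`). Two diagonalizing frames at the same point give the same model
(`ambientModel_eq_of_isMorseFrame`), hence the sum of the corrections over all points is still
`H`-invariant. Index and nondegeneracy are read off from the local models, since the preferred chart
differs from stereographic coordinates by an orthogonal map and a factor 2
(`hessianMatrix_of_localModel`).

The seeds: `x₀² + Re (x₁ + i x₂)ⁿ / n` in the dihedral case, and minus the sum of the `k`-th powers
of the linear forms given by the vertices in the polyhedral cases, with `k = 3, 4, 6` for the
tetrahedron, octahedron and icosahedron. For the tetrahedron this is `-24 x₀ x₁ x₂`, for the
octahedron `-2 ∑ xᵢ⁴`. Their critical equations are solved by hand, and symmetry carries each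
solution to a representative. That the sets of vertices, edge midpoints and face centres are single
orbits is proved from the definition of a face by supporting planes
(`IsRegularList.exists_move_eq`). -/

/-- The linear isometry of three-space given by a rotation matrix. -/
def rot (A : SO3) : E3 ≃ₗᵢ[ℝ] E3 where
  toFun x := WithLp.toLp 2 (A.1 *ᵥ x.ofLp)
  invFun x := WithLp.toLp 2 ((A⁻¹ : SO3).1 *ᵥ x.ofLp)
  map_add' x y := by simp [Matrix.mulVec_add]
  map_smul' c x := by simp [Matrix.mulVec_smul]
  left_inv x := by
    have h : (A⁻¹ : SO3).1 * A.1 = 1 := congrArg Subtype.val (inv_mul_cancel A)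
    simp [Matrix.mulVec_mulVec, h]
  right_inv x := by
    have h : A.1 * (A⁻¹ : SO3).1 = 1 := congrArg Subtype.val (mul_inv_cancel A)
    simp [Matrix.mulVec_mulVec, h]
  norm_map' x := norm_rotate A x

theorem rot_apply (A : SO3) (x : E3) : rot A x = WithLp.toLp 2 (A.1 *ᵥ x.ofLp) := rfl

theorem rot_apply_coord (A : SO3) (x : E3) (i : Fin 3) :
    rot A x i = A.1 i 0 * x 0 + A.1 i 1 * x 1 + A.1 i 2 * x 2 := by
  simp [rot_apply, Matrix.mulVec, dotProduct, Fin.sum_univ_three]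

theorem coe_smul_sphere (A : SO3) (p : S2) : ((A • p : S2) : E3) = rot A p := rfl

@[simp] theorem rot_one (x : E3) : rot 1 x = x := by
  ext i; simp [rot_apply]

theorem rot_mul (A B : SO3) (x : E3) : rot (A * B) x = rot A (rot B x) := by
  simp [rot_apply, Matrix.mulVec_mulVec]

@[simp] theorem rot_inv_rot (A : SO3) (x : E3) : rot A⁻¹ (rot A x) = x := by
  rw [← rot_mul, inv_mul_cancel, rot_one]

@[simp] theorem rot_rot_inv (A : SO3) (x : E3) : rot A (rot A⁻¹ x) = x := by
  rw [← rot_mul, mul_inv_cancel, rot_one]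

theorem inner_rot_left (A : SO3) (x y : E3) : ⟪rot A x, y⟫ = ⟪x, rot A⁻¹ y⟫ := by
  rw [← (rot A).inner_map_map x, rot_rot_inv]

theorem inner_eq_coord (x y : E3) : ⟪x, y⟫ = x 0 * y 0 + x 1 * y 1 + x 2 * y 2 := by
  simp [PiLp.inner_apply, Fin.sum_univ_three, mul_comm]

theorem norm_sq_coord (x : E3) : ‖x‖ ^ 2 = x 0 ^ 2 + x 1 ^ 2 + x 2 ^ 2 := by
  simp [EuclideanSpace.norm_sq_eq, Fin.sum_univ_three]

theorem sphere_coord (p : S2) : (p : E3) 0 ^ 2 + (p : E3) 1 ^ 2 + (p : E3) 2 ^ 2 = 1 := by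
  rw [← norm_sq_coord, mem_sphere_zero_iff_norm.1 p.2, one_pow]

theorem mem_sphere_of_coord {x : E3} (h : x 0 ^ 2 + x 1 ^ 2 + x 2 ^ 2 = 1) :
    x ∈ Metric.sphere (0 : E3) 1 := by
  rw [mem_sphere_zero_iff_norm, ← sq_eq_sq₀ (norm_nonneg _) zero_le_one, norm_sq_coord, h, one_pow]

/-- The three standard basis vectors. -/
abbrev stdE (i : Fin 3) : E3 := EuclideanSpace.single i 1

theorem coe_northPole : (northPole : E3) = stdE 2 := by
  ext i; fin_cases i <;> simp [northPole]

theorem rot_stdE (A : SO3) (i j : Fin 3) : rot A (stdE j) i = A.1 i j := by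
  rw [rot_apply_coord]
  fin_cases j <;> simp

theorem eq_of_rot_eq {A B : SO3} (h : ∀ x, rot A x = rot B x) : A = B := by
  ext i j
  rw [← rot_stdE, ← rot_stdE, h]

theorem orthogonal_columns (A : SO3) (i j : Fin 3) :
    A.1 0 i * A.1 0 j + A.1 1 i * A.1 1 j + A.1 2 i * A.1 2 j = if i = j then 1 else 0 := by
  have h := (rot A).inner_map_map (stdE i) (stdE j)
  rw [inner_eq_coord] at h
  simp only [rot_stdE] at h
  rw [h]
  simp [EuclideanSpace.inner_single_left]

/-- A rotation that fixes the north pole is a rotation of the plane of the first two coordinates. -/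
theorem stabilizer_northPole {A : SO3} (h : A • northPole = northPole) :
    ∃ c s : ℝ, c ^ 2 + s ^ 2 = 1 ∧
      ∀ x : E3, rot A x = !₂[c * x 0 - s * x 1, s * x 0 + c * x 1, x 2] := by
  have h2 : ∀ i, A.1 i 2 = stdE 2 i := fun i => by
    rw [← rot_stdE, ← coe_northPole, ← coe_smul_sphere, h]
  have h02 : A.1 0 2 = 0 := by simp [h2]
  have h12 : A.1 1 2 = 0 := by simp [h2]
  have h22 : A.1 2 2 = 1 := by simp [h2]
  have o02 := orthogonal_columns A 0 2
  have o12 := orthogonal_columns A 1 2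
  have o00 := orthogonal_columns A 0 0
  have o01 := orthogonal_columns A 0 1
  have o11 := orthogonal_columns A 1 1
  simp only [h02, h12, h22] at o02 o12
  have h20 : A.1 2 0 = 0 := by simpa using o02
  have h21 : A.1 2 1 = 0 := by simpa using o12
  simp [h20, h21] at o00 o01 o11
  have hd : A.1.det = 1 := (Matrix.mem_specialOrthogonalGroup_iff.1 A.2).2
  rw [Matrix.det_fin_three] at hd
  simp only [h02, h12, h22, h20, h21] at hd
  -- The remaining 2×2 block is orthogonal of determinant 1, so each entry equals its cofactor.
  have e1 : A.1 1 1 = A.1 0 0 := by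
    linear_combination (A.1 0 0) * hd - A.1 1 1 * o00 + A.1 1 0 * o01
  have e2 : A.1 0 1 = - A.1 1 0 := by
    linear_combination -(A.1 1 0) * hd - A.1 0 1 * o00 + A.1 0 0 * o01
  refine ⟨A.1 0 0, A.1 1 0, by linear_combination o00, fun x => ?_⟩
  ext i
  rw [rot_apply_coord]
  fin_cases i <;> simp [h02, h12, h22, h20, h21, e1, e2]
  ring

/-- The matrix is the rotation along the great circle from the north pole to `p`. It degenerates
only at the south pole, where a half turn serves instead. -/
theorem exists_rotation_northPole (p : S2) : ∃ A : SO3, A • northPole = p := by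
  have hp := sphere_coord p
  set a := (p : E3) 0
  set b := (p : E3) 1
  set c := (p : E3) 2
  by_cases hc : 1 + c = 0
  · have hc' : c = -1 := by linarith
    have ha : a = 0 := by nlinarith [sq_nonneg a, sq_nonneg b]
    have hb : b = 0 := by nlinarith [sq_nonneg a, sq_nonneg b]
    refine ⟨⟨!![1, 0, 0; 0, -1, 0; 0, 0, -1], ?_⟩, ?_⟩
    · rw [Matrix.mem_specialOrthogonalGroup_iff, Matrix.mem_orthogonalGroup_iff]
      constructor
      · ext i j
        fin_cases i <;> fin_cases j <;> simp [Matrix.mul_apply, Fin.sum_univ_three]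
      · simp [Matrix.det_fin_three]
    · ext i
      rw [coe_smul_sphere, coe_northPole, rot_stdE]
      fin_cases i <;> simp
      exacts [ha.symm, hb.symm, hc'.symm]
  · refine ⟨⟨!![1 - a ^ 2 / (1 + c), - a * b / (1 + c), a;
        - a * b / (1 + c), 1 - b ^ 2 / (1 + c), b; -a, -b, c], ?_⟩, ?_⟩
    · rw [Matrix.mem_specialOrthogonalGroup_iff, Matrix.mem_orthogonalGroup_iff]
      constructor
      · ext i j
        fin_cases i <;> fin_cases j <;> simp [Matrix.mul_apply, Fin.sum_univ_three] <;>
          field_simp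
        · linear_combination (a ^ 2) * hp
        · linear_combination (a * b) * hp
        · linear_combination a * hp
        · linear_combination (a * b) * hp
        · linear_combination (b ^ 2) * hp
        · linear_combination b * hp
        · linear_combination a * hp
        · linear_combination b * hp
        · linear_combination hp
      · simp [Matrix.det_fin_three]
        field_simp
        linear_combination (1 + c) * hp
    · ext i
      rw [coe_smul_sphere, coe_northPole, rot_stdE]
      fin_cases i <;> simp <;> rfl

/-! ### Critical points of restrictions to the sphere -/

/-- The derivative of `F` at `p` vanishes on the tangent plane of the sphere. -/
def IsTangentCritical (F : E3 → ℝ) (p : E3) : Prop :=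
  ∀ W : E3, ⟪p, W⟫ = 0 → fderiv ℝ F p W = 0

/-- Chain rule: the differential of the restriction is that of `F` after that of the inclusion,
whose range is the orthogonal complement of `p`. From here on manifold derivatives are replaced by
ordinary ones in three-space. -/
theorem mem_critSet_restrict {F : E3 → ℝ} {p : S2} (hF : DifferentiableAt ℝ F p) :
    p ∈ critSet 2 (fun q : S2 => F q) ↔ IsTangentCritical F p := by
  have : Fact (Module.finrank ℝ E3 = 2 + 1) := ⟨finrank_euclideanSpace_fin⟩
  have hc : MDifferentiableAt (𝓡 2) 𝓘(ℝ, E3) ((↑) : S2 → E3) p :=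
    (contMDiff_coe_sphere (m := 1) p).mdifferentiableAt one_ne_zero
  have h : mfderiv (𝓡 2) 𝓘(ℝ, ℝ) (fun q : S2 => F q) p =
      (fderiv ℝ F p).comp (mfderiv (𝓡 2) 𝓘(ℝ, E3) ((↑) : S2 → E3) p) := by
    rw [← mfderiv_eq_fderiv]
    exact mfderiv_comp p hF.mdifferentiableAt hc
  have hr := range_mvfderiv_subtypeVal (n := 2) p
  have key : ∀ W : E3, ⟪(p : E3), W⟫ = 0 ↔
      ∃ u, mfderiv (𝓡 2) 𝓘(ℝ, E3) ((↑) : S2 → E3) p u = W := fun W => by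
    rw [← Submodule.mem_orthogonal_singleton_iff_inner_right, ← hr]
    rfl
  change mfderiv (𝓡 2) 𝓘(ℝ, ℝ) (fun q : S2 => F q) p = 0 ↔ _
  rw [h]
  constructor
  · intro h0 W hW
    obtain ⟨u, rfl⟩ := (key W).1 hW
    exact DFunLike.congr_fun h0 u
  · intro h0
    refine ContinuousLinearMap.ext fun u => ?_
    exact h0 _ ((key _).2 ⟨u, rfl⟩)

theorem IsTangentCritical.congr {F G : E3 → ℝ} {p : E3} (h : F =ᶠ[𝓝 p] G) :
    IsTangentCritical F p ↔ IsTangentCritical G p := by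
  simp only [IsTangentCritical, h.fderiv_eq]

theorem fderiv_comp_rot {F : E3 → ℝ} (A : SO3) (x W : E3) :
    fderiv ℝ (fun y => F (rot A y)) x W = fderiv ℝ F (rot A x) (rot A W) := by
  have := (rot A).toContinuousLinearEquiv.comp_right_fderiv (f := F) (x := x)
  exact DFunLike.congr_fun this W

theorem isTangentCritical_comp_rot {F : E3 → ℝ} (A : SO3) (x : E3) :
    IsTangentCritical (fun y => F (rot A y)) x ↔ IsTangentCritical F (rot A x) := by
  simp only [IsTangentCritical, fderiv_comp_rot]
  constructor
  · intro h W hW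
    have := h (rot A⁻¹ W) (by rw [← inner_rot_left, hW])
    simpa using this
  · intro h W hW
    exact h _ (by rw [LinearIsometryEquiv.inner_map_map, hW])

/-- A point that is fixed by a nontrivial symmetry of `F` is critical. -/
theorem isTangentCritical_of_fixed {F : E3 → ℝ} {h : SO3} (hF : ∀ x, F (rot h x) = F x)
    (h1 : h ≠ 1) {p : S2} (hp : h • p = p) : IsTangentCritical F p := by
  obtain ⟨A, rfl⟩ := exists_rotation_northPole p
  set G : E3 → ℝ := fun y => F (rot A y) with hG
  set k := A⁻¹ * h * A with hk
  have hkN : k • northPole = northPole := by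
    rw [hk, mul_smul, mul_smul, hp, inv_smul_smul]
  have hkG : ∀ x, G (rot k x) = G x := fun x => by
    simp only [hG, hk, rot_mul, rot_rot_inv, hF]
  have hAk : h = A * k * A⁻¹ := by rw [hk]; group
  have hk1 : k ≠ 1 := fun e => h1 (by rw [hAk, e]; group)
  rw [coe_smul_sphere, ← isTangentCritical_comp_rot, coe_northPole]
  obtain ⟨c, s, hcs, hx⟩ := stabilizer_northPole hkN
  -- Invariance under `k`, which fixes the pole, makes the differential there invariant under `k`.
  -- On the tangent plane `k` is the rotation with cosine `c` and sine `s`.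
  have hd : ∀ W, fderiv ℝ G (stdE 2) (rot k W) = fderiv ℝ G (stdE 2) W := fun W => by
    have := fderiv_comp_rot (F := G) k (stdE 2) W
    simp only [hkG] at this
    rw [← coe_northPole, ← coe_smul_sphere, hkN] at this
    rw [← coe_northPole, ← this]
  have key : ∀ a b : ℝ, ∀ W : E3, W = !₂[a, b, 0] → fderiv ℝ G (stdE 2) W =
      a * fderiv ℝ G (stdE 2) (stdE 0) + b * fderiv ℝ G (stdE 2) (stdE 1) := by
    intro a b W hW
    have : W = a • stdE 0 + b • stdE 1 := by
      rw [hW]; ext i; fin_cases i <;> simp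
    rw [this]; simp
  have d0 := hd (stdE 0)
  have d1 := hd (stdE 1)
  rw [key c s _ (by rw [hx]; ext i; fin_cases i <;> simp)] at d0
  rw [key (-s) c _ (by rw [hx]; ext i; fin_cases i <;> simp)] at d1
  set u := fderiv ℝ G (stdE 2) (stdE 0)
  set v := fderiv ℝ G (stdE 2) (stdE 1)
  have hc : c ≠ 1 := by
    rintro rfl
    have hs : s = 0 := by nlinarith
    apply hk1
    apply eq_of_rot_eq
    intro x
    rw [hx, rot_one, hs]
    ext i; fin_cases i <;> simp
  -- A rotation other than the identity has no nonzero invariant covector: rotation minus identity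
  -- has determinant `2 * (1 - c)`.
  have hu : u = 0 := by
    have : (1 - c) * u = 0 := by
      linear_combination (-1 / 2) * ((1 - c) * d0 + s * d1 + u * hcs)
    exact (mul_eq_zero.1 this).resolve_left (sub_ne_zero.2 hc.symm)
  have hv : v = 0 := by
    have : (1 - c) * v = 0 := by
      linear_combination (-1 / 2) * ((1 - c) * d1 - s * d0 + v * hcs)
    exact (mul_eq_zero.1 this).resolve_left (sub_ne_zero.2 hc.symm)
  intro W hW
  rw [inner_eq_coord] at hW
  simp at hW
  rw [key (W 0) (W 1) W (by ext i; fin_cases i <;> simp [hW])]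
  change W 0 * u + W 1 * v = 0
  rw [hu, hv]; ring

/-! ### Slowly varying cutoffs and reparametrizations of the values -/

theorem smoothTransition_contDiff : ContDiff ℝ ∞ Real.smoothTransition :=
  Real.smoothTransition.contDiff

/-- The derivative is continuous and vanishes outside the compact interval from 0 to 1. -/
theorem exists_bound_deriv_smoothTransition :
    ∃ C : ℝ, 0 < C ∧ ∀ u, |deriv Real.smoothTransition u| ≤ C := by
  have hcont : Continuous (deriv Real.smoothTransition) :=
    smoothTransition_contDiff.continuous_deriv (by simp)
  obtain ⟨C, hC⟩ := (isCompact_Icc (a := (0 : ℝ)) (b := 1)).exists_bound_of_continuousOn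
    hcont.continuousOn
  refine ⟨max C 1, by positivity, fun u => ?_⟩
  by_cases hu : u ∈ Set.Icc (0 : ℝ) 1
  · exact (hC u hu).trans (le_max_left _ _)
  · have h0 : deriv Real.smoothTransition u = 0 := by
      rcases lt_or_ge u 0 with h | h
      · have : Real.smoothTransition =ᶠ[𝓝 u] fun _ => 0 := by
          filter_upwards [gt_mem_nhds h] with y hy
          exact Real.smoothTransition.zero_of_nonpos hy.le
        rw [this.deriv_eq, deriv_const]
      · have h1 : 1 < u := by
          by_contra h1
          exact hu ⟨h, not_lt.1 h1⟩
        have : Real.smoothTransition =ᶠ[𝓝 u] fun _ => 1 := by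
          filter_upwards [lt_mem_nhds h1] with y hy
          exact Real.smoothTransition.one_of_one_le hy.le
        rw [this.deriv_eq, deriv_const]
    rw [h0, abs_zero]
    positivity

/-- A smooth cutoff, equal to `1` near `0` and to `0` beyond `ε`, with small logarithmic slope. -/
structure IsSlowCutoff (ε η : ℝ) (χ : ℝ → ℝ) : Prop where
  contDiff : ContDiff ℝ ∞ χ
  nonneg : ∀ s, 0 ≤ χ s
  le_one : ∀ s, χ s ≤ 1
  eq_one : ∃ δ > 0, ∀ s < δ, χ s = 1
  eq_zero : ∀ s, ε ≤ s → χ s = 0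
  slope : ∀ s, |s * deriv χ s| ≤ η

/-- The cutoff is a transition function of `κ * (log ε - log s)`. Differentiating the logarithm
gives `s χ' = -κ σ'`, which is as small as desired with `κ`, at the price of an exponentially small
plateau. -/
theorem exists_isSlowCutoff {ε η : ℝ} (hε : 0 < ε) (hη : 0 < η) : ∃ χ, IsSlowCutoff ε η χ := by
  obtain ⟨C, hC, hbound⟩ := exists_bound_deriv_smoothTransition
  set κ := η / C with hκ
  have hκ0 : 0 < κ := div_pos hη hC
  set ℓ : ℝ → ℝ := fun s => κ * (Real.log ε - Real.log s) with hℓ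
  set δ := ε * Real.exp (-1 / κ) with hδ
  have hδ0 : 0 < δ := by positivity
  have hℓδ : ∀ s, 0 < s → s < δ → 1 ≤ ℓ s := by
    intro s hs hsδ
    have h1 : Real.log s ≤ Real.log ε + -1 / κ := by
      rw [← Real.log_exp (-1 / κ), ← Real.log_mul hε.ne' (Real.exp_pos _).ne']
      exact Real.log_le_log hs hsδ.le
    have h2 : 1 / κ ≤ Real.log ε - Real.log s := by
      have : -1 / κ = -(1 / κ) := by ring
      linarith
    calc 1 = κ * (1 / κ) := by field_simp
      _ ≤ _ := mul_le_mul_of_nonneg_left h2 hκ0.le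
  -- The value 1 is prescribed by hand because `Real.log` is meaningless for the construction at `s
  -- ≤ 0`. The two formulas agree on the overlap `0 < s < δ`, which gives smoothness.
  set χ : ℝ → ℝ := fun s => if s < δ / 2 then 1 else Real.smoothTransition (ℓ s) with hχ
  have h1 : ∀ s < δ, χ s = 1 := fun s hs => by
    simp only [hχ]
    split_ifs with h
    · rfl
    · exact Real.smoothTransition.one_of_one_le (hℓδ s (by linarith) hs)
  have h2 : ∀ s, 0 < s → χ s = Real.smoothTransition (ℓ s) := fun s hs => by
    by_cases h : s < δ
    · rw [h1 s h, Real.smoothTransition.one_of_one_le (hℓδ s hs h)]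
    · simp only [hχ]; rw [if_neg (by linarith)]
  have hge : ∀ s, 0 < s → χ =ᶠ[𝓝 s] fun s => Real.smoothTransition (ℓ s) := fun s hs => by
    filter_upwards [lt_mem_nhds hs] with t ht using h2 t ht
  have hle : ∀ s, s < δ → χ =ᶠ[𝓝 s] fun _ => 1 := fun s hs => by
    filter_upwards [gt_mem_nhds hs] with t ht using h1 t ht
  have hℓd : ∀ s, 0 < s → HasDerivAt ℓ (κ * (0 - s⁻¹)) s := fun s hs =>
    ((hasDerivAt_const s _).sub (Real.hasDerivAt_log hs.ne')).const_mul κ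
  refine ⟨χ, ⟨?_, ?_, ?_, ⟨δ, hδ0, h1⟩, ?_, ?_⟩⟩
  · rw [contDiff_iff_contDiffAt]
    intro s
    by_cases hs : s < δ
    · exact contDiffAt_const.congr_of_eventuallyEq (hle s hs)
    · have hs0 : 0 < s := by linarith
      refine ContDiffAt.congr_of_eventuallyEq ?_ (hge s hs0)
      refine smoothTransition_contDiff.contDiffAt.comp s ?_
      exact contDiffAt_const.mul (contDiffAt_const.sub (Real.contDiffAt_log.2 hs0.ne'))
  · intro s
    simp only [hχ]
    split_ifs
    exacts [zero_le_one, Real.smoothTransition.nonneg _]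
  · intro s
    simp only [hχ]
    split_ifs
    exacts [le_rfl, Real.smoothTransition.le_one _]
  · intro s hs
    rw [h2 s (by linarith)]
    apply Real.smoothTransition.zero_of_nonpos
    have := Real.log_le_log hε hs
    exact mul_nonpos_of_nonneg_of_nonpos hκ0.le (by linarith)
  · intro s
    by_cases hs : s < δ
    · rw [(hle s hs).deriv_eq, deriv_const, mul_zero, abs_zero]
      exact hη.le
    · have hs0 : 0 < s := by linarith
      have hd : HasDerivAt (fun s => Real.smoothTransition (ℓ s))
          (deriv Real.smoothTransition (ℓ s) * (κ * (0 - s⁻¹))) s :=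
        (smoothTransition_contDiff.differentiable (by simp) _).hasDerivAt.comp s (hℓd s hs0)
      rw [(hge s hs0).deriv_eq, hd.deriv]
      have : s * (deriv Real.smoothTransition (ℓ s) * (κ * (0 - s⁻¹))) =
          -(κ * deriv Real.smoothTransition (ℓ s)) := by field_simp; ring
      rw [this, abs_neg, abs_mul, abs_of_pos hκ0]
      calc κ * _ ≤ κ * C := mul_le_mul_of_nonneg_left (hbound _) hκ0.le
        _ = η := by rw [hκ]; field_simp

/-- A smooth function with positive derivative that takes three given values to `-1`, `0`, `1`. -/
theorem exists_reparametrization {c : Fin 3 → ℝ} (h01 : c 0 < c 1) (h12 : c 1 < c 2) :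
    ∃ Θ : ℝ → ℝ, ContDiff ℝ ∞ Θ ∧ (∀ t, 0 < deriv Θ t) ∧
      ∀ i : Fin 3, Θ (c i) = (i : ℝ) - 1 := by
  set L := c 2 - c 0 with hL
  have hL0 : 0 < L := by linarith
  -- The affine function of slope `1 / L` keeps the derivative positive. The coefficients `a` and
  -- `b` are what it lacks of a rise of 1 on each of the two intervals, and monotone steps supply
  -- the rest.
  set a := 1 - (c 2 - c 1) / L
  set b := 1 - (c 1 - c 0) / L
  have ha : 0 ≤ a := sub_nonneg.2 ((div_le_one hL0).2 (by linarith))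
  have hb : 0 ≤ b := sub_nonneg.2 ((div_le_one hL0).2 (by linarith))
  set u : ℝ → ℝ := fun t => Real.smoothTransition ((t - c 1) / (c 2 - c 1)) with hu
  set v : ℝ → ℝ := fun t => Real.smoothTransition ((t - c 0) / (c 1 - c 0)) with hv
  have hsm : ∀ x y : ℝ, x < y → ContDiff ℝ ∞ (fun t => Real.smoothTransition ((t - x) / (y - x))) :=
    fun x y _ => smoothTransition_contDiff.comp ((contDiff_id.sub contDiff_const).div_const _)
  have hmono : ∀ x y : ℝ, x < y → ∀ t,
      0 ≤ deriv (fun t => Real.smoothTransition ((t - x) / (y - x))) t := fun x y hxy t => by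
    refine Monotone.deriv_nonneg fun r s hrs => Real.smoothTransition.monotone ?_
    exact div_le_div_of_nonneg_right (by linarith) (by linarith)
  have hdu := fun t => ((hsm _ _ h12).differentiable (by simp) t).hasDerivAt
  have hdv := fun t => ((hsm _ _ h01).differentiable (by simp) t).hasDerivAt
  refine ⟨fun t => (t - c 1) / L + a * u t + b * (v t - 1), ?_, fun t => ?_, fun i => ?_⟩
  · exact (((contDiff_id.sub contDiff_const).div_const _).add
      (contDiff_const.mul (hsm _ _ h12))).add (contDiff_const.mul ((hsm _ _ h01).sub contDiff_const))
  · have hd := ((((hasDerivAt_id t).sub_const (c 1)).div_const L).add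
      ((hdu t).const_mul a)).add (((hdv t).sub_const 1).const_mul b)
    have e := hd.deriv
    refine lt_of_lt_of_eq ?_ e.symm
    have h1 := mul_nonneg ha (hmono _ _ h12 t)
    have h2 := mul_nonneg hb (hmono _ _ h01 t)
    have h3 : 0 < 1 / L := by positivity
    linarith
  · have e12 : c 2 - c 1 ≠ 0 := by linarith
    have e01 : c 1 - c 0 ≠ 0 := by linarith
    fin_cases i
    · have hu0 : u (c 0) = 0 := Real.smoothTransition.zero_of_nonpos
        (div_nonpos_of_nonpos_of_nonneg (by linarith) (by linarith))
      have hv0 : v (c 0) = 0 := Real.smoothTransition.zero_of_nonpos (by simp)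
      simp only [Fin.zero_eta, hu0, hv0, b]
      push_cast
      field_simp
      simp
      linarith
    · have hu0 : u (c 1) = 0 := Real.smoothTransition.zero_of_nonpos (by simp)
      have hv0 : v (c 1) = 1 := Real.smoothTransition.one_of_one_le (by rw [div_self e01])
      simp [hu0, hv0]
    · have hu0 : u (c 2) = 1 := Real.smoothTransition.one_of_one_le (by rw [div_self e12])
      have hv0 : v (c 2) = 1 := Real.smoothTransition.one_of_one_le
        (by rw [le_div_iff₀ (by linarith)]; linarith)
      simp [hu0, hv0, a]
      norm_num

/-! ### The second derivative -/

theorem fderiv_apply_of_hasDerivAt {f : E3 → ℝ} {x v : E3} {d : ℝ} (hf : DifferentiableAt ℝ f x)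
    (h : HasDerivAt (fun t : ℝ => f (x + t • v)) d 0) : fderiv ℝ f x v = d := by
  rw [← hf.lineDeriv_eq_fderiv, lineDeriv, h.deriv]

/-- The second derivative of `F` at `p`. -/
def hess (F : E3 → ℝ) (p u v : E3) : ℝ := fderiv ℝ (fun x => fderiv ℝ F x v) p u

theorem contDiff_fderiv_apply {F : E3 → ℝ} (hF : ContDiff ℝ ∞ F) (v : E3) :
    ContDiff ℝ ∞ (fun x => fderiv ℝ F x v) :=
  (hF.fderiv_right (m := ∞) (by simp)).clm_apply contDiff_const

theorem hess_eq {F : E3 → ℝ} (hF : ContDiff ℝ ∞ F) (p u v : E3) :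
    hess F p u v = fderiv ℝ (fderiv ℝ F) p u v := by
  have h : DifferentiableAt ℝ (fderiv ℝ F) p :=
    (hF.fderiv_right (m := ∞) (by simp)).differentiable (by simp) p
  rw [hess, fderiv_clm_apply h (differentiableAt_const v)]
  simp

theorem hess_symm {F : E3 → ℝ} (hF : ContDiff ℝ ∞ F) (p u v : E3) :
    hess F p u v = hess F p v u := by
  rw [hess_eq hF, hess_eq hF]
  exact (hF.contDiffAt.isSymmSndFDerivAt (by
    simp only [minSmoothness_of_isRCLikeNormedField]
    exact WithTop.coe_le_coe.2 (le_top : (2 : ℕ∞) ≤ ⊤))).eq u v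

theorem hess_comp_rot {F : E3 → ℝ} (A : SO3) (p u v : E3) :
    hess (fun y => F (rot A y)) p u v = hess F (rot A p) (rot A u) (rot A v) := by
  simp only [hess, fderiv_comp_rot]
  exact fderiv_comp_rot (F := fun x => fderiv ℝ F x (rot A v)) A p u

/-! ### Local models as functions on three-space -/

/-- The first sign of the local models. -/
def sgnX : Fin 3 → ℝ := ![1, -1, -1]

/-- The second sign of the local models. -/
def sgnY : Fin 3 → ℝ := ![1, 1, -1]

theorem sgnX_sq (i : Fin 3) : sgnX i ^ 2 = 1 := by fin_cases i <;> simp [sgnX]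

theorem sgnY_sq (i : Fin 3) : sgnY i ^ 2 = 1 := by fin_cases i <;> simp [sgnY]

/-- The quadratic form of the `i`-th local model. -/
def modelForm (i : Fin 3) (x : E3) : ℝ := sgnX i * x 0 ^ 2 + sgnY i * x 1 ^ 2

/-- The `i`-th local model at the north pole, in stereographic coordinates. -/
def ambientModel (i : Fin 3) (x : E3) : ℝ :=
  modelForm i x / (2 * (1 + x 2) ^ 2) + ((i : ℝ) - 1)

theorem localModel_eq (i : Fin 3) (z : ℝ × ℝ) :
    localModel i z = (sgnX i * z.1 ^ 2 + sgnY i * z.2 ^ 2) / 2 + ((i : ℝ) - 1) := by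
  fin_cases i <;> simp [localModel, sgnX, sgnY] <;> ring

/-- The inverse of `stereo` is `x ↦ (x 0, x 1) / (1 + x 2)`, which explains the denominator of
`ambientModel`. -/
theorem ambientModel_stereo (i : Fin 3) (z : ℝ × ℝ) :
    ambientModel i (stereo z) = localModel i z := by
  have h : (1 + z.1 ^ 2 + z.2 ^ 2) ≠ 0 := by positivity
  rw [localModel_eq, ambientModel, modelForm]
  simp only [stereo, PiLp.smul_apply, smul_eq_mul]
  simp
  field_simp
  ring

theorem abs_sgnX (i : Fin 3) : |sgnX i| = 1 := by fin_cases i <;> simp [sgnX]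

theorem abs_sgnY (i : Fin 3) : |sgnY i| = 1 := by fin_cases i <;> simp [sgnY]

theorem abs_modelForm_le (i : Fin 3) (x : E3) : |modelForm i x| ≤ x 0 ^ 2 + x 1 ^ 2 := by
  refine (abs_add_le _ _).trans_eq ?_
  rw [abs_mul, abs_mul, abs_sgnX, abs_sgnY, abs_sq, abs_sq, one_mul, one_mul]

/-- The tangential vector field along which the functions close to the local model increase. -/
def modelField (i : Fin 3) (x : E3) : E3 :=
  !₂[sgnX i * x 0, sgnY i * x 1, 0] - modelForm i x • x

/-- The field is the projection to the tangent plane of half the gradient of `modelForm`: the scalar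
product of that half gradient with `x` is `modelForm i x`. -/
theorem inner_modelField {i : Fin 3} {x : E3} (hx : x 0 ^ 2 + x 1 ^ 2 + x 2 ^ 2 = 1) :
    ⟪x, modelField i x⟫ = 0 := by
  rw [inner_eq_coord]
  simp [modelField]
  rw [modelForm]
  linear_combination (-(sgnX i * x 0 ^ 2 + sgnY i * x 1 ^ 2)) * hx

theorem differentiableAt_ambientModel {i : Fin 3} {x : E3} (hx : 1 + x 2 ≠ 0) {n : ℕ∞} :
    ContDiffAt ℝ n (ambientModel i) x := by
  unfold ambientModel modelForm
  refine ContDiffAt.add (ContDiffAt.div ?_ ?_ ?_) contDiffAt_const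
  · fun_prop
  · fun_prop
  · positivity

theorem fderiv_ambientModel {i : Fin 3} {x W : E3} (hx : 1 + x 2 ≠ 0) :
    fderiv ℝ (ambientModel i) x W =
      (sgnX i * x 0 * W 0 + sgnY i * x 1 * W 1) / (1 + x 2) ^ 2 -
        modelForm i x * W 2 / (1 + x 2) ^ 3 := by
  refine fderiv_apply_of_hasDerivAt
    ((differentiableAt_ambientModel (n := 1) hx).differentiableAt (by simp)) ?_
  have hc : ∀ j : Fin 3, HasDerivAt (fun t : ℝ => (x + t • W) j) (W j) 0 := fun j => by
    simpa using ((hasDerivAt_id (0 : ℝ)).mul_const (W j)).const_add (x j)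
  have hd : (2 * (1 + (x + (0 : ℝ) • W) 2) ^ 2) ≠ 0 := by simp [hx]
  have h := (((((hc 0).pow 2).const_mul (sgnX i)).add (((hc 1).pow 2).const_mul (sgnY i))).div
    ((((hc 2).const_add 1).pow 2).const_mul 2) hd).add_const ((i : ℝ) - 1)
  refine h.congr_deriv ?_
  simp [modelForm]
  field_simp

/-! ### Estimates near the north pole -/

theorem sq_dist_stdE {x : E3} (hx : x 0 ^ 2 + x 1 ^ 2 + x 2 ^ 2 = 1) :
    ‖x - stdE 2‖ ^ 2 = 2 * (1 - x 2) := by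
  rw [norm_sq_coord]
  simp
  linear_combination hx

theorem eventually_coord_two {a : ℝ} (ha : a < 1) : ∀ᶠ x : E3 in 𝓝 (stdE 2), a < x 2 := by
  have : Filter.Tendsto (fun x : E3 => x 2) (𝓝 (stdE 2)) (𝓝 1) := by
    have : Continuous (fun x : E3 => x 2) := by fun_prop
    simpa using this.tendsto (stdE 2)
  exact this.eventually_const_lt ha

/-- On the upper hemisphere `1 - x 2 ≤ 1 - x 2 ^ 2`. Hence the height below the pole is of second
order, which makes it negligible in first order expansions. -/
theorem one_sub_le {x : E3} (hx : x 0 ^ 2 + x 1 ^ 2 + x 2 ^ 2 = 1) (h2 : 0 < x 2) :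
    1 - x 2 ≤ x 0 ^ 2 + x 1 ^ 2 := by
  nlinarith [sq_nonneg (x 0), sq_nonneg (x 1)]

/-- First order expansion on the sphere at the north pole. -/
theorem eventually_abs_sub_le {D : E3 → ℝ} (hD : DifferentiableAt ℝ D (stdE 2))
    (h0 : D (stdE 2) = 0) {ε : ℝ} (hε : 0 < ε) :
    ∀ᶠ x : E3 in 𝓝 (stdE 2), x 0 ^ 2 + x 1 ^ 2 + x 2 ^ 2 = 1 →
      |D x - x 0 * fderiv ℝ D (stdE 2) (stdE 0) - x 1 * fderiv ℝ D (stdE 2) (stdE 1)| ≤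
        ε * √(x 0 ^ 2 + x 1 ^ 2) := by
  set L := fderiv ℝ D (stdE 2)
  have h1 := hD.hasFDerivAt.isLittleO.def (c := ε / 4) (by positivity)
  -- The added 1 only keeps the denominator `4 * a` nonzero.
  set a := |L (stdE 2)| + 1
  have ha : 0 < a := by positivity
  have h2 := eventually_coord_two (a := 1 - (ε / (4 * a)) ^ 2)
    (by have : 0 < ε / (4 * a) := by positivity
        nlinarith)
  filter_upwards [h1, h2, eventually_coord_two (a := 0) zero_lt_one] with x h1 h2 h3 hx
  set ρ := √(x 0 ^ 2 + x 1 ^ 2) with hρ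
  have hρ0 : 0 ≤ ρ := Real.sqrt_nonneg _
  have hρ2 : ρ ^ 2 = x 0 ^ 2 + x 1 ^ 2 := Real.sq_sqrt (by positivity)
  have hs := one_sub_le hx h3
  have hs0 : 0 ≤ 1 - x 2 := by nlinarith [sq_nonneg (x 0), sq_nonneg (x 1)]
  have hn : ‖x - stdE 2‖ ≤ 2 * ρ := by
    refine abs_le_of_sq_le_sq' ?_ (by positivity) |>.2
    rw [sq_dist_stdE hx]
    nlinarith
  have hlin : L (x - stdE 2) = x 0 * L (stdE 0) + x 1 * L (stdE 1) + (x 2 - 1) * L (stdE 2) := by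
    have : x - stdE 2 = x 0 • stdE 0 + x 1 • stdE 1 + (x 2 - 1) • stdE 2 := by
      ext i; fin_cases i <;> simp
    rw [this]; simp
  rw [h0, sub_zero, hlin, Real.norm_eq_abs] at h1
  -- Of the two factors of `(1 - x 2) ^ 2`, one is below `(ε / (4 * a)) ^ 2` by proximity to the
  -- pole and the other is at most `ρ ^ 2`.
  have h5 : |(x 2 - 1) * L (stdE 2)| ≤ ε / 4 * ρ := by
    have e1 : 1 - x 2 ≤ (ε / (4 * a)) * ρ := by
      have : (1 - x 2) ^ 2 ≤ ((ε / (4 * a)) * ρ) ^ 2 := by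
        rw [mul_pow, hρ2, sq (1 - x 2)]
        exact mul_le_mul (by linarith) hs hs0 (by positivity)
      exact abs_le_of_sq_le_sq' this (by positivity) |>.2
    rw [abs_mul, abs_sub_comm, abs_of_nonneg hs0]
    calc (1 - x 2) * |L (stdE 2)| ≤ ((ε / (4 * a)) * ρ) * a :=
          mul_le_mul e1 (by linarith) (abs_nonneg _) (by positivity)
      _ = ε / 4 * ρ := by field_simp
  have h6 : D x - x 0 * L (stdE 0) - x 1 * L (stdE 1) =
      (D x - (x 0 * L (stdE 0) + x 1 * L (stdE 1) + (x 2 - 1) * L (stdE 2))) +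
        (x 2 - 1) * L (stdE 2) := by ring
  rw [h6]
  refine (abs_add_le _ _).trans ?_
  have h7 : ε / 4 * ‖x - stdE 2‖ ≤ ε / 4 * (2 * ρ) :=
    mul_le_mul_of_nonneg_left hn (by positivity)
  nlinarith [mul_nonneg hε.le hρ0]

/-- `A` is a frame at its third column in which the Hessian on the sphere is diagonal, with the
signs of the `i`-th local model. -/
structure IsMorseFrame (i : Fin 3) (F : E3 → ℝ) (A : SO3) : Prop where
  critical : IsTangentCritical F (rot A (stdE 2))
  off_diag : hess F (rot A (stdE 2)) (rot A (stdE 0)) (rot A (stdE 1)) = 0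
  pos_fst : 0 < sgnX i * (hess F (rot A (stdE 2)) (rot A (stdE 0)) (rot A (stdE 0)) -
    fderiv ℝ F (rot A (stdE 2)) (rot A (stdE 2)))
  pos_snd : 0 < sgnY i * (hess F (rot A (stdE 2)) (rot A (stdE 1)) (rot A (stdE 1)) -
    fderiv ℝ F (rot A (stdE 2)) (rot A (stdE 2)))

theorem isMorseFrame_comp_rot {i : Fin 3} {F : E3 → ℝ} {A B : SO3} :
    IsMorseFrame i (fun y => F (rot B y)) A ↔ IsMorseFrame i F (B * A) := by
  constructor
  · rintro ⟨h1, h2, h3, h4⟩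
    rw [isTangentCritical_comp_rot] at h1
    simp only [hess_comp_rot, fderiv_comp_rot] at h2 h3 h4
    constructor <;> simpa only [rot_mul]
  · rintro ⟨h1, h2, h3, h4⟩
    simp only [rot_mul] at h1 h2 h3 h4
    constructor
    · rwa [isTangentCritical_comp_rot]
    all_goals simpa only [hess_comp_rot, fderiv_comp_rot]

/-- Expanding the two tangential derivatives to first order gives `α * x 0 ^ 2 + β * x 1 ^ 2` up to
errors of order `o(ρ²)`. The component of the field along `x` brings in the radial derivative, which
turns the ambient second derivatives into the Hessian of the sphere; this is why it is subtracted in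
`IsMorseFrame`. -/
theorem IsMorseFrame.eventually_le {i : Fin 3} {F : E3 → ℝ} (hF : ContDiff ℝ ∞ F)
    (h : IsMorseFrame i F 1) :
    ∃ κ > 0, ∀ᶠ x : E3 in 𝓝 (stdE 2), x 0 ^ 2 + x 1 ^ 2 + x 2 ^ 2 = 1 →
      κ * (x 0 ^ 2 + x 1 ^ 2) ≤ fderiv ℝ F x (modelField i x) := by
  obtain ⟨h1, h2, h3, h4⟩ := h
  simp only [rot_one] at h1 h2 h3 h4
  set ev := fderiv ℝ F (stdE 2) (stdE 2)
  set α := sgnX i * (hess F (stdE 2) (stdE 0) (stdE 0) - ev) with hα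
  set β := sgnY i * (hess F (stdE 2) (stdE 1) (stdE 1) - ev) with hβ
  -- Three error terms of size `ε * ρ ^ 2` are subtracted from at least `6 * ε * ρ ^ 2`, so more
  -- than `ε * ρ ^ 2` is left.
  set ε := min α β / 6 with hε
  have hε0 : 0 < ε := by have := lt_min h3 h4; positivity
  have hεα : 6 * ε ≤ α := by have := min_le_left α β; linarith
  have hεβ : 6 * ε ≤ β := by have := min_le_right α β; linarith
  have hD : ∀ j, DifferentiableAt ℝ (fun x => fderiv ℝ F x (stdE j)) (stdE 2) := fun j =>
    (contDiff_fderiv_apply hF _).differentiable (by simp) _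
  have e0 := eventually_abs_sub_le (hD 0) (h1 _ (by rw [inner_eq_coord]; simp)) hε0
  have e1 := eventually_abs_sub_le (hD 1) (h1 _ (by rw [inner_eq_coord]; simp)) hε0
  have e2 : ∀ᶠ x : E3 in 𝓝 (stdE 2), |fderiv ℝ F x x - ev| < ε := by
    have hc : Continuous (fun x => fderiv ℝ F x x) :=
      (hF.continuous_fderiv (by simp)).clm_apply continuous_id
    exact (Metric.tendsto_nhds.1 (hc.tendsto (stdE 2))) ε hε0
  refine ⟨ε, hε0, ?_⟩
  filter_upwards [e0, e1, e2] with x e0 e1 e2 hx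
  specialize e0 hx
  specialize e1 hx
  change |_ - x 0 * hess F _ _ _ - x 1 * hess F _ _ _| ≤ _ at e0 e1
  rw [h2] at e1
  rw [hess_symm hF _ (stdE 1), h2] at e0
  set ρ := √(x 0 ^ 2 + x 1 ^ 2) with hρ
  have hρ0 : 0 ≤ ρ := Real.sqrt_nonneg _
  have hρ2 : ρ ^ 2 = x 0 ^ 2 + x 1 ^ 2 := Real.sq_sqrt (by positivity)
  set r0 := fderiv ℝ F x (stdE 0) - x 0 * hess F (stdE 2) (stdE 0) (stdE 0) - x 1 * 0 with hr0
  set r1 := fderiv ℝ F x (stdE 1) - x 0 * 0 - x 1 * hess F (stdE 2) (stdE 1) (stdE 1) with hr1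
  have hW : modelField i x = (sgnX i * x 0) • stdE 0 + (sgnY i * x 1) • stdE 1 -
      modelForm i x • x := by
    ext j; fin_cases j <;> simp [modelField]
  have key : fderiv ℝ F x (modelField i x) = α * x 0 ^ 2 + β * x 1 ^ 2 + sgnX i * x 0 * r0 +
      sgnY i * x 1 * r1 - modelForm i x * (fderiv ℝ F x x - ev) := by
    rw [hW, map_sub, map_add, map_smul, map_smul, map_smul, hr0, hr1, hα, hβ, modelForm]
    simp only [smul_eq_mul]
    ring
  have b0 : |sgnX i * x 0 * r0| ≤ ε * ρ ^ 2 := by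
    rw [abs_mul, abs_mul, abs_sgnX, one_mul]
    have : |x 0| ≤ ρ := Real.abs_le_sqrt (by nlinarith [sq_nonneg (x 1)])
    calc |x 0| * |r0| ≤ ρ * (ε * ρ) := mul_le_mul this e0 (abs_nonneg _) hρ0
      _ = _ := by ring
  have b1 : |sgnY i * x 1 * r1| ≤ ε * ρ ^ 2 := by
    rw [abs_mul, abs_mul, abs_sgnY, one_mul]
    have : |x 1| ≤ ρ := Real.abs_le_sqrt (by nlinarith [sq_nonneg (x 0)])
    calc |x 1| * |r1| ≤ ρ * (ε * ρ) := mul_le_mul this e1 (abs_nonneg _) hρ0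
      _ = _ := by ring
  have b2 : |modelForm i x * (fderiv ℝ F x x - ev)| ≤ ρ ^ 2 * ε := by
    rw [abs_mul, hρ2]
    exact mul_le_mul (abs_modelForm_le i x) e2.le (abs_nonneg _) (by positivity)
  rw [key]
  have := (abs_le.1 b0).1
  have := (abs_le.1 b1).1
  have := (abs_le.1 b2).2
  have := mul_le_mul_of_nonneg_right hεα (sq_nonneg (x 0))
  have := mul_le_mul_of_nonneg_right hεβ (sq_nonneg (x 1))
  nlinarith

/-- A smooth function that is critical on the sphere at the north pole is constant there to first
order. -/
theorem IsTangentCritical.eventually_abs_sub_le {G : E3 → ℝ} (hG : ContDiff ℝ ∞ G)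
    (h : IsTangentCritical G (stdE 2)) :
    ∃ C > 0, ∀ᶠ x : E3 in 𝓝 (stdE 2), x 0 ^ 2 + x 1 ^ 2 + x 2 ^ 2 = 1 →
      |G x - G (stdE 2)| ≤ C * (x 0 ^ 2 + x 1 ^ 2) := by
  have hc : ContDiffAt ℝ 1 (fderiv ℝ G) (stdE 2) := by
    have := hG.fderiv_right (m := ∞) (by simp)
    exact (this.of_le (by exact_mod_cast le_top)).contDiffAt
  obtain ⟨K, t, ht, hK⟩ := hc.exists_lipschitzOnWith
  obtain ⟨r, hr, hrt⟩ := Metric.mem_nhds_iff.1 ht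
  set L := fderiv ℝ G (stdE 2)
  refine ⟨2 * K + |L (stdE 2)| + 1, by positivity, ?_⟩
  filter_upwards [Metric.ball_mem_nhds _ hr, eventually_coord_two (a := 0) zero_lt_one]
    with x hxr h3 hx
  have hs := one_sub_le hx h3
  have hs0 : 0 ≤ 1 - x 2 := by nlinarith [sq_nonneg (x 0), sq_nonneg (x 1)]
  have hseg : segment ℝ (stdE 2) x ⊆ Metric.ball (stdE 2) r :=
    (convex_ball _ _).segment_subset (Metric.mem_ball_self hr) hxr
  -- Mean value inequality for `G` minus its linear part: the derivative is Lipschitz, so the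
  -- remainder is quadratic in the distance.
  have hb := (convex_segment (𝕜 := ℝ) (stdE 2) x).norm_image_sub_le_of_norm_hasFDerivWithin_le'
    (f := G) (f' := fderiv ℝ G) (φ := L) (C := K * ‖x - stdE 2‖)
    (fun y _ => (hG.differentiable (by simp) y).hasFDerivAt.hasFDerivWithinAt)
    (fun y hy => by
      refine (hK.norm_sub_le (hrt (hseg hy)) (hrt (Metric.mem_ball_self hr))).trans ?_
      refine mul_le_mul_of_nonneg_left ?_ K.2
      obtain ⟨θ, ⟨h0, h1⟩, rfl⟩ := (segment_eq_image' ℝ (stdE 2) x) ▸ hy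
      simp only [add_sub_cancel_left, norm_smul, Real.norm_eq_abs, abs_of_nonneg h0]
      exact mul_le_of_le_one_left (norm_nonneg _) h1)
    (left_mem_segment ℝ _ _) (right_mem_segment ℝ _ _)
  -- Criticality kills the tangential part, and the vertical displacement is itself of second order.
  have hlin : L (x - stdE 2) = (x 2 - 1) * L (stdE 2) := by
    have : x - stdE 2 = (x 0 • stdE 0 + x 1 • stdE 1) + (x 2 - 1) • stdE 2 := by
      ext i; fin_cases i <;> simp
    rw [this, map_add, h (x 0 • stdE 0 + x 1 • stdE 1) (by rw [inner_eq_coord]; simp)]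
    simp [L]
  rw [hlin, Real.norm_eq_abs, mul_assoc, ← sq, sq_dist_stdE hx] at hb
  have h6 : G x - G (stdE 2) = (G x - G (stdE 2) - (x 2 - 1) * L (stdE 2)) +
      (x 2 - 1) * L (stdE 2) := by ring
  rw [h6]
  refine (abs_add_le _ _).trans ?_
  rw [abs_mul, abs_sub_comm (x 2), abs_of_nonneg hs0]
  have := mul_le_mul_of_nonneg_right hs (abs_nonneg (L (stdE 2)))
  have := mul_le_mul_of_nonneg_left hs K.2
  nlinarith [sq_nonneg (x 0), sq_nonneg (x 1)]

theorem fderiv_interpolation {i : Fin 3} {G : E3 → ℝ} (hG : ContDiff ℝ ∞ G) {χ : ℝ → ℝ}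
    (hχ : ContDiff ℝ ∞ χ) {x W : E3} (hx : 1 + x 2 ≠ 0) :
    fderiv ℝ (fun y => G y + χ (1 - y 2) * (ambientModel i y - G y)) x W =
      (1 - χ (1 - x 2)) * fderiv ℝ G x W + χ (1 - x 2) * fderiv ℝ (ambientModel i) x W
        - deriv χ (1 - x 2) * W 2 * (ambientModel i x - G x) := by
  have hdG : HasFDerivAt G (fderiv ℝ G x) x := (hG.differentiable (by simp) x).hasFDerivAt
  have hdm : HasFDerivAt (ambientModel i) (fderiv ℝ (ambientModel i) x) x :=
    ((differentiableAt_ambientModel (n := 1) hx).differentiableAt (by simp)).hasFDerivAt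
  have hdχ : HasFDerivAt (fun y : E3 => χ (1 - y 2))
      (deriv χ (1 - x 2) • (-(EuclideanSpace.proj (2 : Fin 3) : E3 →L[ℝ] ℝ))) x := by
    have h1 : HasFDerivAt (fun y : E3 => 1 - y 2)
        (-(EuclideanSpace.proj (2 : Fin 3) : E3 →L[ℝ] ℝ)) x :=
      (EuclideanSpace.proj (2 : Fin 3) : E3 →L[ℝ] ℝ).hasFDerivAt.const_sub 1
    exact (hχ.differentiable (by simp) _).hasDerivAt.comp_hasFDerivAt x h1
  have hd := hdG.add (hdχ.mul (hdm.sub hdG))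
  refine (DFunLike.congr_fun hd.fderiv W).trans ?_
  simp
  ring

/-- With `τ = modelForm i x` and `ρ² = x 0 ^ 2 + x 1 ^ 2`, the derivative along the field is `(ρ² -
τ²) / (1 + x 2) ^ 2` plus a nonnegative term. Here `|τ| ≤ ρ² ≤ 1 / 2` gives `τ² ≤ ρ² / 2`, and `(1 +
x 2) ^ 2 ≤ 4`, whence the factor 1/8. -/
theorem le_fderiv_ambientModel {i : Fin 3} {x : E3} (hx : x 0 ^ 2 + x 1 ^ 2 + x 2 ^ 2 = 1)
    (h3 : 3 / 4 ≤ x 2) :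
    1 / 8 * (x 0 ^ 2 + x 1 ^ 2) ≤ fderiv ℝ (ambientModel i) x (modelField i x) := by
  have hW0 : modelField i x 0 = sgnX i * x 0 - modelForm i x * x 0 := by simp [modelField]
  have hW1 : modelField i x 1 = sgnY i * x 1 - modelForm i x * x 1 := by simp [modelField]
  have hW2 : modelField i x 2 = - (modelForm i x * x 2) := by simp [modelField]
  rw [fderiv_ambientModel (by linarith), hW0, hW1, hW2]
  have hτ2 : modelForm i x ^ 2 ≤ (x 0 ^ 2 + x 1 ^ 2) / 2 := by
    have := abs_modelForm_le i x
    have h1 : x 0 ^ 2 + x 1 ^ 2 ≤ 1 / 2 := by nlinarith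
    rw [← sq_abs]
    nlinarith [abs_nonneg (modelForm i x)]
  have e : sgnX i * x 0 * (sgnX i * x 0 - modelForm i x * x 0) +
      sgnY i * x 1 * (sgnY i * x 1 - modelForm i x * x 1) =
      x 0 ^ 2 + x 1 ^ 2 - modelForm i x ^ 2 := by
    rw [modelForm]
    linear_combination x 0 ^ 2 * sgnX_sq i + x 1 ^ 2 * sgnY_sq i
  have e' : modelForm i x * (-(modelForm i x * x 2)) / (1 + x 2) ^ 3 =
      -(modelForm i x ^ 2 * x 2 / (1 + x 2) ^ 3) := by ring
  rw [e, e', sub_neg_eq_add]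
  have h0 : 0 ≤ x 2 := by linarith
  have p1 : 0 ≤ modelForm i x ^ 2 * x 2 / (1 + x 2) ^ 3 := by positivity
  have p2 : 1 / 8 * (x 0 ^ 2 + x 1 ^ 2) ≤
      (x 0 ^ 2 + x 1 ^ 2 - modelForm i x ^ 2) / (1 + x 2) ^ 2 := by
    rw [le_div_iff₀ (by positivity)]
    have hx1 : x 2 ≤ 1 := by nlinarith [sq_nonneg (x 0), sq_nonneg (x 1)]
    have : (1 + x 2) ^ 2 ≤ 4 := by nlinarith
    have := mul_le_mul_of_nonneg_left this (by positivity : 0 ≤ 1 / 8 * (x 0 ^ 2 + x 1 ^ 2))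
    linarith
  linarith

/-- Interpolation with the local model by a slow cutoff creates no critical points. -/
theorem exists_nhds_not_critical {i : Fin 3} {G : E3 → ℝ} (hG : ContDiff ℝ ∞ G)
    (hGN : G (stdE 2) = (i : ℝ) - 1) (hcrit : IsTangentCritical G (stdE 2)) {κ : ℝ} (hκ : 0 < κ)
    (hfield : ∀ᶠ x : E3 in 𝓝 (stdE 2), x 0 ^ 2 + x 1 ^ 2 + x 2 ^ 2 = 1 →
      κ * (x 0 ^ 2 + x 1 ^ 2) ≤ fderiv ℝ G x (modelField i x)) :
    ∃ η > 0, ∀ᶠ x : E3 in 𝓝 (stdE 2), x 0 ^ 2 + x 1 ^ 2 + x 2 ^ 2 = 1 → x 2 ≠ 1 →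
      ∀ ε η' χ, IsSlowCutoff ε η' χ → η' ≤ η →
        ¬ IsTangentCritical (fun y => G y + χ (1 - y 2) * (ambientModel i y - G y)) x := by
  obtain ⟨C, hC, hGC⟩ := hcrit.eventually_abs_sub_le hG
  set μ := min κ (1 / 8) with hμ
  have hμ0 : 0 < μ := lt_min hκ (by norm_num)
  -- The cutoff term is `χ' * W 2 * (m - G)` with `|W 2| ≤ ρ² ≤ 2 * (1 - x 2)`. The slope bound
  -- makes the first product at most `2 * η`, and `|m - G| ≤ (C + 1) * ρ²`, so the term is at most
  -- `μ / 2 * ρ²`, half of the lower bound for the other two.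
  refine ⟨μ / (4 * (C + 1)), by positivity, ?_⟩
  filter_upwards [hfield, hGC, eventually_coord_two (a := 3 / 4) (by norm_num)]
    with x hfield hGC h3 hx hx1 ε η' χ hχ hη' hcr
  specialize hfield hx
  specialize hGC hx
  have hx2 : 1 + x 2 ≠ 0 := by linarith
  have hs := one_sub_le hx (by linarith)
  set ρ2 := x 0 ^ 2 + x 1 ^ 2 with hρ2
  have hs0 : 0 < 1 - x 2 :=
    lt_of_le_of_ne (by nlinarith [sq_nonneg (x 0), sq_nonneg (x 1)])
      (fun e => hx1 (by linarith))
  have hρ0 : 0 < ρ2 := by linarith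
  set W := modelField i x with hW
  have hval : (1 - χ (1 - x 2)) * fderiv ℝ G x W + χ (1 - x 2) * fderiv ℝ (ambientModel i) x W
      - deriv χ (1 - x 2) * W 2 * (ambientModel i x - G x) = 0 := by
    rw [← fderiv_interpolation hG hχ.contDiff hx2]
    exact hcr W (inner_modelField hx)
  have hW0 : W 0 = sgnX i * x 0 - modelForm i x * x 0 := by simp [hW, modelField]
  have hW1 : W 1 = sgnY i * x 1 - modelForm i x * x 1 := by simp [hW, modelField]
  have hW2 : W 2 = - (modelForm i x * x 2) := by simp [hW, modelField]
  set τ := modelForm i x with hτ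
  have hτρ : |τ| ≤ ρ2 := abs_modelForm_le i x
  -- On the sphere `ρ2 = (1 - x 2) * (1 + x 2)`.
  have hρs : ρ2 ≤ 2 * (1 - x 2) := by nlinarith
  have hρh : ρ2 ≤ 1 / 2 := by linarith
  have hτ2 : τ ^ 2 ≤ ρ2 / 2 := by
    rw [← sq_abs]
    nlinarith [abs_nonneg τ]
  have hm : μ * ρ2 ≤ fderiv ℝ (ambientModel i) x W :=
    (mul_le_mul_of_nonneg_right (min_le_right _ _) hρ0.le).trans
      (le_fderiv_ambientModel hx (by linarith))
  have hg : μ * ρ2 ≤ fderiv ℝ G x W :=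
    (mul_le_mul_of_nonneg_right (min_le_left _ _) hρ0.le).trans hfield
  have hdiff : |ambientModel i x - G x| ≤ (C + 1) * ρ2 := by
    have e : ambientModel i x - G x = τ / (2 * (1 + x 2) ^ 2) - (G x - G (stdE 2)) := by
      rw [hGN, ambientModel]; ring
    rw [e]
    refine (abs_sub _ _).trans ?_
    have : |τ / (2 * (1 + x 2) ^ 2)| ≤ ρ2 := by
      rw [abs_div, abs_of_pos (a := 2 * (1 + x 2) ^ 2) (by positivity)]
      refine (div_le_self (abs_nonneg _) ?_).trans hτρ
      nlinarith
    linarith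
  have hcut : |deriv χ (1 - x 2) * W 2 * (ambientModel i x - G x)| ≤ μ / 2 * ρ2 := by
    have e1 : |W 2| ≤ 2 * (1 - x 2) := by
      rw [hW2, abs_neg, abs_mul, abs_of_nonneg (by linarith : 0 ≤ x 2)]
      exact (mul_le_of_le_one_right (abs_nonneg _) (by linarith)).trans (hτρ.trans hρs)
    have e2 : |deriv χ (1 - x 2) * W 2| ≤ 2 * (μ / (4 * (C + 1))) := by
      have := (hχ.slope (1 - x 2)).trans hη'
      rw [abs_mul, abs_of_pos hs0] at this
      rw [abs_mul]
      calc _ ≤ |deriv χ (1 - x 2)| * (2 * (1 - x 2)) :=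
            mul_le_mul_of_nonneg_left e1 (abs_nonneg _)
        _ ≤ _ := by linarith
    rw [abs_mul]
    calc _ ≤ 2 * (μ / (4 * (C + 1))) * ((C + 1) * ρ2) :=
          mul_le_mul e2 hdiff (abs_nonneg _) (by positivity)
      _ = _ := by field_simp; ring
  have h0 := hχ.nonneg (1 - x 2)
  have h1 := hχ.le_one (1 - x 2)
  have := (abs_le.1 hcut).2
  have := mul_le_mul_of_nonneg_left hg (sub_nonneg.2 h1)
  have := mul_le_mul_of_nonneg_left hm h0
  have : 0 < μ * ρ2 := by positivity
  linarith

/-! ### Uniqueness of Morse frames -/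

theorem hess_add_left {F : E3 → ℝ} (p u u' v : E3) :
    hess F p (u + u') v = hess F p u v + hess F p u' v := map_add _ _ _

theorem hess_smul_left {F : E3 → ℝ} (c : ℝ) (p u v : E3) :
    hess F p (c • u) v = c * hess F p u v := map_smul _ _ _

theorem hess_add_right {F : E3 → ℝ} (hF : ContDiff ℝ ∞ F) (p u v v' : E3) :
    hess F p u (v + v') = hess F p u v + hess F p u v' := by
  simp only [hess_symm hF p u, hess_add_left]

theorem hess_smul_right {F : E3 → ℝ} (hF : ContDiff ℝ ∞ F) (c : ℝ) (p u v : E3) :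
    hess F p u (c • v) = c * hess F p u v := by
  simp only [hess_symm hF p u, hess_smul_left]

/-- For `i` equal to 0 or 2 the form is plus or minus `x 0 ^ 2 + x 1 ^ 2` and every rotation about
the pole preserves it. For a saddle the two Hessian eigenvalues have opposite signs, so the
eigenlines are determined and cannot be exchanged: the rotation is plus or minus the identity on the
tangent plane. -/
theorem modelForm_rot_of_isMorseFrame {i : Fin 3} {F : E3 → ℝ} (hF : ContDiff ℝ ∞ F) {K : SO3}
    (hK : K • northPole = northPole) (h1 : IsMorseFrame i F 1) (h2 : IsMorseFrame i F K) (y : E3) :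
    modelForm i (rot K y) = modelForm i y := by
  obtain ⟨c, s, hcs, hx⟩ := stabilizer_northPole hK
  by_cases hi : i = 1
  · subst hi
    obtain ⟨-, o1, a1, b1⟩ := h1
    obtain ⟨-, o2, a2, b2⟩ := h2
    have e0 : rot K (stdE 0) = c • stdE 0 + s • stdE 1 := by
      rw [hx]; ext i; fin_cases i <;> simp
    have e1 : rot K (stdE 1) = (-s) • stdE 0 + c • stdE 1 := by
      rw [hx]; ext i; fin_cases i <;> simp
    have e2 : rot K (stdE 2) = stdE 2 := by
      rw [hx]; ext i; fin_cases i <;> simp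
    simp only [e0, e1, e2, hess_add_left, hess_smul_left, hess_add_right hF, hess_smul_right hF]
      at o2 a2 b2
    simp only [rot_one] at o1 a1 b1
    rw [hess_symm hF _ (stdE 1) (stdE 0), o1] at o2 a2 b2
    simp only [sgnX, sgnY, Matrix.cons_val_one, Matrix.cons_val_zero] at a1 b1 a2 b2
    set p := hess F (stdE 2) (stdE 0) (stdE 0)
    set q := hess F (stdE 2) (stdE 1) (stdE 1)
    set l := fderiv ℝ F (stdE 2) (stdE 2)
    have hs : s = 0 := by
      -- This is the off-diagonal entry in the rotated frame. The signs give `p < l < q`, and `c =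
      -- 0` would be a quarter turn, which swaps the two eigenvalues.
      have : c * s * (q - p) = 0 := by linear_combination o2
      rcases mul_eq_zero.1 this with h | h
      · rcases mul_eq_zero.1 h with h | h
        · subst h
          exfalso
          have : s ^ 2 = 1 := by linarith
          have : 0 < -1 * (s ^ 2 * q - l) := by linarith
          rw [‹s ^ 2 = 1›] at this
          linarith
        · exact h
      · linarith
    subst hs
    rw [modelForm, modelForm, hx]
    simp [sgnX, sgnY]
    linear_combination (y 1 ^ 2 - y 0 ^ 2) * hcs
  · have hsg : sgnX i = sgnY i := by
      fin_cases i
      · rfl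
      · exact absurd rfl hi
      · rfl
    rw [modelForm, modelForm, hx, hsg]
    simp
    linear_combination sgnY i * (y 0 ^ 2 + y 1 ^ 2) * hcs

theorem rot_inv_apply_two (A : SO3) (y : E3) : rot A⁻¹ y 2 = ⟪rot A (stdE 2), y⟫ := by
  rw [inner_rot_left, inner_eq_coord]
  simp

/-- Two frames at the same point differ by a rotation about it, which preserves both the height and
the model form. The modification at a point therefore does not depend on the chosen frame, and this
is what makes the glued function invariant. -/
theorem ambientModel_eq_of_isMorseFrame {i : Fin 3} {F : E3 → ℝ} (hF : ContDiff ℝ ∞ F) {A B : SO3}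
    (hAB : A • northPole = B • northPole) (hA : IsMorseFrame i F A) (hB : IsMorseFrame i F B)
    (y : E3) : ambientModel i (rot A⁻¹ y) = ambientModel i (rot B⁻¹ y) := by
  have hK : (A⁻¹ * B) • northPole = northPole := by rw [mul_smul, ← hAB, inv_smul_smul]
  have h2 : rot A⁻¹ y 2 = rot B⁻¹ y 2 := by
    rw [rot_inv_apply_two, rot_inv_apply_two, ← coe_northPole, ← coe_smul_sphere, hAB]
    rfl
  have hF' : ContDiff ℝ ∞ (fun z => F (rot A z)) := hF.comp (rot A).contDiff
  have hm := modelForm_rot_of_isMorseFrame (i := i) hF' hK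
    (isMorseFrame_comp_rot.2 (by rwa [mul_one]))
    (isMorseFrame_comp_rot.2 (by rwa [mul_inv_cancel_left])) (rot B⁻¹ y)
  rw [rot_mul, rot_rot_inv] at hm
  rw [ambientModel, ambientModel, h2, hm]

/-! ### The local modification at a critical point -/

/-- The cap parameter `1 - ⟪p, y⟫` is half the squared distance. -/
theorem sq_dist_sphere (p y : S2) : ‖(y : E3) - p‖ ^ 2 = 2 * (1 - ⟪(p : E3), (y : E3)⟫) := by
  rw [norm_sub_sq_real, mem_sphere_zero_iff_norm.1 p.2, mem_sphere_zero_iff_norm.1 y.2,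
    real_inner_comm]
  ring

theorem inner_self_sphere (p : S2) : ⟪(p : E3), (p : E3)⟫ = 1 := by
  rw [real_inner_self_eq_norm_sq, mem_sphere_zero_iff_norm.1 p.2, one_pow]

/-- Near the pole the derivative of `Θ` stays above half its positive value, so the bound survives
the reparametrization. -/
theorem IsMorseFrame.exists_field_bound {i : Fin 3} {F : E3 → ℝ} (hF : ContDiff ℝ ∞ F)
    (h : IsMorseFrame i F 1) {Θ : ℝ → ℝ} (hΘ : ContDiff ℝ ∞ Θ) (hpos : ∀ t, 0 < deriv Θ t) :
    ∃ κ > 0, ∀ᶠ x : E3 in 𝓝 (stdE 2), x 0 ^ 2 + x 1 ^ 2 + x 2 ^ 2 = 1 →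
      κ * (x 0 ^ 2 + x 1 ^ 2) ≤ fderiv ℝ (Θ ∘ F) x (modelField i x) := by
  obtain ⟨κ, hκ, hev⟩ := h.eventually_le hF
  set d := deriv Θ (F (stdE 2)) with hd
  have hd0 : 0 < d := hpos _
  have hc : Continuous (fun x => deriv Θ (F x)) :=
    (hΘ.continuous_deriv (by simp)).comp hF.continuous
  refine ⟨d / 2 * κ, by positivity, ?_⟩
  filter_upwards [hev, (hc.tendsto (stdE 2)).eventually_const_lt (half_lt_self hd0)] with x hx hdx hs
  have e : fderiv ℝ (Θ ∘ F) x (modelField i x) =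
      deriv Θ (F x) * fderiv ℝ F x (modelField i x) := by
    rw [fderiv_comp x (hΘ.differentiable (by simp) _) (hF.differentiable (by simp) x)]
    simp
    ring
  rw [e, mul_assoc]
  exact mul_le_mul hdx.le (hx hs) (by positivity) (hpos _).le

theorem isTangentCritical_comp {F : E3 → ℝ} (hF : ContDiff ℝ ∞ F) {Θ : ℝ → ℝ}
    (hΘ : ContDiff ℝ ∞ Θ) (hpos : ∀ t, 0 < deriv Θ t) (x : E3) :
    IsTangentCritical (Θ ∘ F) x ↔ IsTangentCritical F x := by
  have e : ∀ W, fderiv ℝ (Θ ∘ F) x W = deriv Θ (F x) * fderiv ℝ F x W := fun W => by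
    rw [fderiv_comp x (hΘ.differentiable (by simp) _) (hF.differentiable (by simp) x)]
    simp
    ring
  simp only [IsTangentCritical, e, mul_eq_zero, (hpos _).ne', false_or]

/-- The statement at the north pole, carried to `p` by the frame. Size and slope of the cutoff are
tied to the single parameter `r`, so that finitely many points can later share one `r`. -/
theorem IsMorseFrame.eventually_not_critical {i : Fin 3} {F : E3 → ℝ} (hF : ContDiff ℝ ∞ F)
    {A : SO3} (h : IsMorseFrame i F A) {Θ : ℝ → ℝ} (hΘ : ContDiff ℝ ∞ Θ)
    (hpos : ∀ t, 0 < deriv Θ t) {p : S2} (hp : A • northPole = p)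
    (hval : Θ (F p) = (i : ℝ) - 1) :
    ∀ᶠ r : ℝ in 𝓝[>] 0, ∀ χ, IsSlowCutoff (r / 2) r χ → ∀ y : S2, 1 - ⟪(p : E3), (y : E3)⟫ < r →
      y ≠ p → ¬ IsTangentCritical (fun y => (Θ ∘ F) y +
        χ (1 - ⟪(p : E3), y⟫) * (ambientModel i (rot A⁻¹ y) - (Θ ∘ F) y)) y := by
  have hpA : rot A (stdE 2) = p := by rw [← coe_northPole, ← coe_smul_sphere, hp]
  set F₁ : E3 → ℝ := fun y => F (rot A y) with hF₁
  have hF₁s : ContDiff ℝ ∞ F₁ := hF.comp (rot A).contDiff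
  have h₁ : IsMorseFrame i F₁ 1 := isMorseFrame_comp_rot.2 (by rwa [mul_one])
  obtain ⟨κ, hκ, hfield⟩ := h₁.exists_field_bound hF₁s hΘ hpos
  have hcrit : IsTangentCritical (Θ ∘ F₁) (stdE 2) := by
    rw [isTangentCritical_comp hF₁s hΘ hpos]
    simpa using h₁.critical
  obtain ⟨η, hη, hev⟩ := exists_nhds_not_critical (i := i) (hΘ.comp hF₁s)
    (by simpa [hF₁, hpA] using hval) hcrit hκ hfield
  obtain ⟨ρ, hρ, hball⟩ := Metric.eventually_nhds_iff.1 hev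
  have hr1 : ∀ᶠ r : ℝ in 𝓝[>] 0, r < η := nhdsWithin_le_nhds (gt_mem_nhds hη)
  have hr2 : ∀ᶠ r : ℝ in 𝓝[>] 0, r < ρ ^ 2 / 2 := nhdsWithin_le_nhds (gt_mem_nhds (by positivity))
  filter_upwards [hr1, hr2] with r hr1 hr2 χ hχ y hy hyp hcr
  have hx2 : ∀ z : E3, rot A⁻¹ z 2 = ⟪(p : E3), z⟫ := fun z => by
    rw [rot_inv_apply_two, hpA]
  have hsph : rot A⁻¹ y 0 ^ 2 + rot A⁻¹ y 1 ^ 2 + rot A⁻¹ y 2 ^ 2 = 1 :=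
    sphere_coord (A⁻¹ • y)
  refine hball (y := rot A⁻¹ y) ?_ hsph ?_ _ _ χ hχ hr1.le ?_
  · rw [dist_eq_norm]
    have e : rot A⁻¹ y - stdE 2 = rot A⁻¹ ((y : E3) - p) := by
      rw [map_sub, ← hpA, rot_inv_rot]
    rw [e, LinearIsometryEquiv.norm_map]
    refine (abs_lt_of_sq_lt_sq ?_ hρ.le).trans_le' (le_abs_self _)
    rw [sq_dist_sphere]
    linarith
  · rw [hx2]
    intro h1
    have := sq_dist_sphere p y
    rw [h1, sub_self, mul_zero, sq_eq_zero_iff, norm_eq_zero, sub_eq_zero] at this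
    exact hyp (Subtype.ext this)
  · have := (isTangentCritical_comp_rot (F := fun y => (Θ ∘ F) y +
        χ (1 - ⟪(p : E3), y⟫) * (ambientModel i (rot A⁻¹ y) - (Θ ∘ F) y)) A (rot A⁻¹ y)).2
        (by rwa [rot_rot_inv])
    have e : (fun y => (Θ ∘ F₁) y + χ (1 - y 2) * (ambientModel i y - (Θ ∘ F₁) y)) =
        fun z => (Θ ∘ F) (rot A z) + χ (1 - ⟪(p : E3), rot A z⟫) *
          (ambientModel i (rot A⁻¹ (rot A z)) - (Θ ∘ F) (rot A z)) := by
      funext z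
      rw [← hx2, rot_inv_rot]
      rfl
    rw [e]
    exact this

theorem eventually_disjoint_caps {p q : S2} (hpq : p ≠ q) :
    ∀ᶠ r : ℝ in 𝓝[>] 0, ∀ y : S2, ¬ (1 - ⟪(p : E3), (y : E3)⟫ < r ∧ 1 - ⟪(q : E3), (y : E3)⟫ < r) := by
  have hd : 0 < ‖(p : E3) - q‖ := norm_pos_iff.2 (sub_ne_zero.2 fun h => hpq (Subtype.ext h))
  -- A common point of both caps has squared distance below `2 * r` from each centre, and `‖p - q‖²`
  -- is at most twice the sum of these, hence below `8 * r`.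
  filter_upwards [nhdsWithin_le_nhds (gt_mem_nhds (show 0 < ‖(p : E3) - q‖ ^ 2 / 8 by positivity))]
    with r hr y ⟨h1, h2⟩
  have e1 := sq_dist_sphere p y
  have e2 := sq_dist_sphere q y
  have h3 : ‖(p : E3) - q‖ ≤ ‖(y : E3) - p‖ + ‖(y : E3) - q‖ := by
    rw [norm_sub_rev (y : E3) p]
    exact norm_sub_le_norm_sub_add_norm_sub _ _ _
  nlinarith [norm_nonneg ((y : E3) - p), norm_nonneg ((y : E3) - q),
    sq_nonneg (‖(y : E3) - p‖ - ‖(y : E3) - q‖)]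

/-! ### Gluing the local models -/

/-- A smooth function on three-space whose restriction to the sphere is invariant under `H`, has
critical set `⋃ i, X i`, the set of points with nontrivial stabilizer, and is given by the `i`-th
local model near the points of `X i`. -/
structure HasMorseModel (H : Subgroup SO3) (X : Fin 3 → Set S2) : Prop where
  iUnion_eq : (⋃ i, X i) = fixedSet H
  exists_model : ∃ F : E3 → ℝ, ContDiff ℝ ∞ F ∧ (∀ h ∈ H, ∀ x, F (rot h x) = F x) ∧
    (∀ p : S2, IsTangentCritical F p ↔ p ∈ ⋃ i, X i) ∧
    ∀ i, ∀ p ∈ X i, ∃ A : SO3, A • northPole = p ∧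
      ∀ᶠ z in 𝓝 (0 : ℝ × ℝ), F (A • stereo z : S2) = localModel i z

/-- An invariant function with the right critical points and Hessians at orbit representatives. -/
structure IsMorseSeed (H : Subgroup SO3) (X : Fin 3 → Set S2) (F : E3 → ℝ) (A : Fin 3 → SO3) :
    Prop where
  contDiff : ContDiff ℝ ∞ F
  invariant : ∀ h ∈ H, ∀ x, F (rot h x) = F x
  transitive : ∀ i, ∀ q ∈ X i, ∃ h ∈ H, h • A i • northPole = q
  finite : ∀ i, (X i).Finite
  mem_fixedSet : ∀ i, A i • northPole ∈ fixedSet H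
  frame : ∀ i, IsMorseFrame i F (A i)
  lt_one : F (A 0 • northPole : S2) < F (A 1 • northPole : S2)
  lt_two : F (A 1 • northPole : S2) < F (A 2 • northPole : S2)
  critical : ∀ q : S2, IsTangentCritical F q → q ∈ ⋃ i, X i

theorem smul_mem_fixedSet {H : Subgroup SO3} {h : SO3} (hh : h ∈ H) {p : S2}
    (hp : p ∈ fixedSet H) : h • p ∈ fixedSet H := by
  obtain ⟨g, hg, hg1, hgp⟩ := hp
  refine ⟨h * g * h⁻¹, H.mul_mem (H.mul_mem hh hg) (H.inv_mem hh), fun e => hg1 ?_, ?_⟩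
  · have : g = h⁻¹ * (h * g * h⁻¹) * h := by group
    rw [this, e]; group
  · rw [mul_smul, mul_smul, inv_smul_smul, hgp]

/-! ### Consequences of a seed for the group and the point sets -/

namespace IsMorseSeed

variable {H : Subgroup SO3} {X : Fin 3 → Set S2} {F : E3 → ℝ} {A : Fin 3 → SO3}

theorem value_eq (hF : IsMorseSeed H X F A) {i : Fin 3} {q : S2} (hq : q ∈ X i) :
    F q = F (A i • northPole : S2) := by
  obtain ⟨h, hh, rfl⟩ := hF.transitive i q hq
  exact hF.invariant h hh _

theorem value_injective (hF : IsMorseSeed H X F A) {i j : Fin 3}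
    (h : F (A i • northPole : S2) = F (A j • northPole : S2)) : i = j := by
  have h1 := hF.lt_one
  have h2 := hF.lt_two
  fin_cases i <;> fin_cases j <;> simp at h ⊢ <;> linarith

/-- The three sets are separated by the values of `F`, so their disjointness needs no separate
hypothesis. -/
theorem index_unique (hF : IsMorseSeed H X F A) {i j : Fin 3} {q : S2} (hi : q ∈ X i)
    (hj : q ∈ X j) : i = j :=
  hF.value_injective ((hF.value_eq hi).symm.trans (hF.value_eq hj))

/-- One inclusion transports stabilizers from the representatives. In the other, a point with a
nontrivial stabilizer is critical for the invariant function and so belongs to the list; no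
classification of the group elements is needed. -/
theorem iUnion_eq (hF : IsMorseSeed H X F A) : (⋃ i, X i) = fixedSet H := by
  ext q
  constructor
  · intro hq
    obtain ⟨i, hi⟩ := Set.mem_iUnion.1 hq
    obtain ⟨h, hh, rfl⟩ := hF.transitive i q hi
    exact smul_mem_fixedSet hh (hF.mem_fixedSet i)
  · rintro ⟨h, hh, h1, hq⟩
    exact hF.critical q (isTangentCritical_of_fixed (hF.invariant h hh) h1 hq)

theorem exists_frame (hF : IsMorseSeed H X F A) {i : Fin 3} {q : S2} (hq : q ∈ X i) :
    ∃ B : SO3, B • northPole = q ∧ IsMorseFrame i F B := by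
  obtain ⟨h, hh, rfl⟩ := hF.transitive i q hq
  refine ⟨h * A i, mul_smul _ _ _, ?_⟩
  rw [← isMorseFrame_comp_rot]
  simpa only [hF.invariant h hh] using hF.frame i

/-- Invariance of the sets is not part of a seed: the set of fixed points is invariant, and the
value of `F` then identifies the index. -/
theorem smul_mem (hF : IsMorseSeed H X F A) {i : Fin 3} {q : S2} (hq : q ∈ X i) {h : SO3}
    (hh : h ∈ H) : h • q ∈ X i := by
  have h1 : h • q ∈ ⋃ i, X i := by
    rw [hF.iUnion_eq]
    refine smul_mem_fixedSet hh ?_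
    rw [← hF.iUnion_eq]
    exact Set.mem_iUnion.2 ⟨i, hq⟩
  obtain ⟨j, hj⟩ := Set.mem_iUnion.1 h1
  have : i = j := hF.value_injective <| by
    rw [← hF.value_eq hq, ← hF.value_eq hj]
    exact (hF.invariant h hh q).symm
  rwa [this]

end IsMorseSeed

/-- The term that replaces `G` by the local model near `p`. -/
def capTerm (χ : ℝ → ℝ) (G : E3 → ℝ) (p : S2) (i : Fin 3) (B : SO3) (y : E3) : ℝ :=
  χ (1 - ⟪(p : E3), y⟫) * (ambientModel i (rot B⁻¹ y) - G y)

theorem capTerm_eventually_zero {χ : ℝ → ℝ} {ε η : ℝ} (hχ : IsSlowCutoff ε η χ) {G : E3 → ℝ}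
    {p : S2} {i : Fin 3} {B : SO3} {y : E3} (hy : ε < 1 - ⟪(p : E3), y⟫) :
    ∀ᶠ z in 𝓝 y, capTerm χ G p i B z = 0 := by
  have hc : Continuous (fun z : E3 => 1 - ⟪(p : E3), z⟫) := by fun_prop
  filter_upwards [(hc.tendsto y).eventually_const_lt hy] with z hz
  rw [capTerm, hχ.eq_zero _ hz.le, zero_mul]

/-- The model is singular only where `⟪p, y⟫ = -1`, and the cutoff vanishes near there because `ε <
2`. The term is thus smooth on all of three-space. -/
theorem contDiff_capTerm {χ : ℝ → ℝ} {ε η : ℝ} (hχ : IsSlowCutoff ε η χ) (hε : ε < 2) {G : E3 → ℝ}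
    (hG : ContDiff ℝ ∞ G) {p : S2} {i : Fin 3} {B : SO3} (hB : B • northPole = p) :
    ContDiff ℝ ∞ (capTerm χ G p i B) := by
  rw [contDiff_iff_contDiffAt]
  intro y
  by_cases hy : ε < 1 - ⟪(p : E3), y⟫
  · exact contDiffAt_const.congr_of_eventuallyEq (capTerm_eventually_zero hχ hy)
  · have h2 : 1 + rot B⁻¹ y 2 ≠ 0 := by
      rw [rot_inv_apply_two, ← coe_northPole, ← coe_smul_sphere, hB]
      linarith
    refine ContDiffAt.mul ?_ (ContDiffAt.sub ?_ hG.contDiffAt)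
    · exact (hχ.contDiff.comp (contDiff_const.sub (contDiff_const.inner ℝ contDiff_id))).contDiffAt
    · exact ContDiffAt.comp y (differentiableAt_ambientModel (n := ⊤) h2)
        (rot B⁻¹).contDiff.contDiffAt

/-- The model `z ↦ stereo z` near the origin stays in small caps. -/
theorem tendsto_smul_stereo (B : SO3) :
    Filter.Tendsto (fun z : ℝ × ℝ => ((B • stereo z : S2) : E3)) (𝓝 0)
      (𝓝 ((B • northPole : S2) : E3)) := by
  have hc : Continuous (fun z : ℝ × ℝ => (stereo z : E3)) := by
    unfold stereo
    have hd : Continuous (fun z : ℝ × ℝ => 1 + z.1 ^ 2 + z.2 ^ 2) := by fun_prop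
    refine Continuous.smul (hd.inv₀ fun z => by positivity) ?_
    refine (PiLp.continuous_toLp 2 _).comp (continuous_pi fun i => ?_)
    fin_cases i <;> simp <;> fun_prop
  have h0 : (stereo 0 : E3) = northPole := by
    ext i; fin_cases i <;> simp [stereo, northPole]
  have h := ((rot B).continuous.comp hc).tendsto 0
  simp only [Function.comp_apply, h0] at h
  exact h

/-- The function is `Θ ∘ F` plus one `capTerm` for each point of `X`, all with the same cutoff.
Disjoint caps make at most one term matter near a point of the sphere. -/
theorem IsMorseSeed.hasMorseModel {H : Subgroup SO3} {X : Fin 3 → Set S2} {F : E3 → ℝ}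
    {A : Fin 3 → SO3} (hF : IsMorseSeed H X F A) : HasMorseModel H X := by
  obtain ⟨Θ, hΘ, hpos, hval⟩ := exists_reparametrization
    (c := fun i => F (A i • northPole : S2)) hF.lt_one hF.lt_two
  have hfin : (⋃ i, X i).Finite := Set.finite_iUnion hF.finite
  have hchoice : ∀ q : S2, ∃ i : Fin 3, ∃ B : SO3, q ∈ (⋃ i, X i) →
      q ∈ X i ∧ B • northPole = q ∧ IsMorseFrame i F B := fun q => by
    by_cases hq : q ∈ ⋃ i, X i
    · obtain ⟨i, hi⟩ := Set.mem_iUnion.1 hq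
      obtain ⟨B, hB, hB'⟩ := hF.exists_frame hi
      exact ⟨i, B, fun _ => ⟨hi, hB, hB'⟩⟩
    · exact ⟨0, 1, fun h => absurd h hq⟩
  choose idx B hB using hchoice
  have hG : ContDiff ℝ ∞ (Θ ∘ F) := hΘ.comp hF.contDiff
  have hGinv : ∀ h ∈ H, ∀ x, (Θ ∘ F) (rot h x) = (Θ ∘ F) x := fun h hh x => by
    simp only [Function.comp_apply, hF.invariant h hh]
  have hsmall : ∀ᶠ r : ℝ in 𝓝[>] 0, r < 1 := nhdsWithin_le_nhds (gt_mem_nhds one_pos)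
  have hr0 : ∀ᶠ r : ℝ in 𝓝[>] 0, 0 < r := eventually_mem_nhdsWithin
  have hloc : ∀ᶠ r : ℝ in 𝓝[>] 0, ∀ q ∈ (⋃ i, X i), ∀ χ, IsSlowCutoff (r / 2) r χ → ∀ y : S2,
      1 - ⟪(q : E3), (y : E3)⟫ < r → y ≠ q → ¬ IsTangentCritical (fun y => (Θ ∘ F) y +
        χ (1 - ⟪(q : E3), y⟫) * (ambientModel (idx q) (rot (B q)⁻¹ y) - (Θ ∘ F) y)) y := by
    rw [Filter.eventually_all_finite hfin]
    intro q hq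
    obtain ⟨h1, h2, h3⟩ := hB q hq
    refine h3.eventually_not_critical hF.contDiff hΘ hpos h2 ?_
    rw [hF.value_eq h1, hval]
  have hsep : ∀ᶠ r : ℝ in 𝓝[>] 0, ∀ q ∈ (⋃ i, X i), ∀ q' ∈ (⋃ i, X i), q ≠ q' → ∀ y : S2,
      ¬ (1 - ⟪(q : E3), (y : E3)⟫ < r ∧ 1 - ⟪(q' : E3), (y : E3)⟫ < r) := by
    rw [Filter.eventually_all_finite hfin]
    intro q _
    rw [Filter.eventually_all_finite hfin]
    intro q' _
    by_cases hqq : q = q'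
    · exact Filter.Eventually.of_forall fun r h => absurd hqq h
    · filter_upwards [eventually_disjoint_caps hqq] with r hr _ using hr
  obtain ⟨r, hr1, hr0, hloc, hsep⟩ := (hsmall.and (hr0.and (hloc.and hsep))).exists
  -- The terms live in the caps `r / 2` while the caps `r` are disjoint. The margin makes the other
  -- terms vanish on a neighbourhood, so that derivatives can be compared.
  obtain ⟨χ, hχ⟩ := exists_isSlowCutoff (ε := r / 2) (η := r) (by positivity) hr0
  set T : S2 → E3 → ℝ := fun q => capTerm χ (Θ ∘ F) q (idx q) (B q) with hT
  set Φ : E3 → ℝ := fun y => (Θ ∘ F) y + ∑ q ∈ hfin.toFinset, T q y with hΦ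
  have hfar : ∀ q : S2, ∀ y : E3, r / 2 < 1 - ⟪(q : E3), y⟫ → ∀ᶠ z in 𝓝 y, T q z = 0 :=
    fun q y hy => capTerm_eventually_zero hχ hy
  have hnear : ∀ q ∈ (⋃ i, X i), ∀ y : S2, 1 - ⟪(q : E3), (y : E3)⟫ < r →
      Φ =ᶠ[𝓝 (y : E3)] fun z => (Θ ∘ F) z + T q z := by
    intro q hq y hy
    have h0 : ∀ᶠ z in 𝓝 (y : E3), ∀ q' ∈ hfin.toFinset, q' ≠ q → T q' z = 0 := by
      rw [Filter.eventually_all_finset]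
      intro q' hq'
      by_cases hqq : q' = q
      · exact Filter.Eventually.of_forall fun z h => absurd hqq h
      · have := hsep q hq q' (hfin.mem_toFinset.1 hq') (Ne.symm hqq) y
        have hge : r ≤ 1 - ⟪(q' : E3), (y : E3)⟫ := not_lt.1 fun h => this ⟨hy, h⟩
        filter_upwards [hfar q' y (by linarith)] with z hz _ using hz
    filter_upwards [h0] with z hz
    simp only [hΦ]
    rw [Finset.sum_eq_single q hz (fun h => absurd (hfin.mem_toFinset.2 hq) h)]
  have hinv : ∀ h ∈ H, ∀ x, Φ (rot h x) = Φ x := by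
    intro h hh x
    simp only [hΦ]
    rw [hGinv h hh]
    congr 1
    have hmem : ∀ g ∈ H, ∀ q ∈ hfin.toFinset, g • q ∈ hfin.toFinset := fun g hg q hq => by
      rw [hfin.mem_toFinset] at hq ⊢
      obtain ⟨i, hi⟩ := Set.mem_iUnion.1 hq
      exact Set.mem_iUnion.2 ⟨i, hF.smul_mem hi hg⟩
    symm
    -- The terms are permuted: the one at `q` corresponds to the one at `h • q`.
    refine Finset.sum_nbij' (fun q => h • q) (fun q => h⁻¹ • q) (hmem h hh)
      (hmem h⁻¹ (H.inv_mem hh)) (fun q _ => inv_smul_smul h q) (fun q _ => smul_inv_smul h q) ?_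
    intro q hq
    obtain ⟨h1, h2, h3⟩ := hB q (hfin.mem_toFinset.1 hq)
    obtain ⟨k1, k2, k3⟩ := hB (h • q) (hfin.mem_toFinset.1 (hmem h hh q hq))
    have hidx : idx (h • q) = idx q := hF.index_unique k1 (hF.smul_mem h1 hh)
    rw [hidx] at k3
    -- The chosen frame at `h • q` and the transported frame `h * B q` may differ, but both are
    -- Morse frames there and so define the same model.
    have hf : IsMorseFrame (idx q) F (h * B q) := by
      rw [← isMorseFrame_comp_rot]
      simpa only [hF.invariant h hh] using h3
    simp only [hT, capTerm]
    rw [hGinv h hh, hidx, coe_smul_sphere, LinearIsometryEquiv.inner_map_map,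
      ambientModel_eq_of_isMorseFrame hF.contDiff (A := B (h • q)) (B := h * B q)
        (by rw [mul_smul, h2, k2]) k3 hf, mul_inv_rev, rot_mul, rot_inv_rot]
  refine ⟨hF.iUnion_eq, Φ, ?_, hinv, fun p => ⟨fun hp => ?_, fun hp => ?_⟩, ?_⟩
  · refine hG.add (ContDiff.sum fun q hq => ?_)
    exact contDiff_capTerm hχ (by linarith) hG (hB q (hfin.mem_toFinset.1 hq)).2.1
  -- Within a cap only the centre can be critical. Outside all caps the function agrees locally with
  -- `Θ ∘ F`, whose critical points are those of `F`.
  · by_cases hex : ∃ q ∈ (⋃ i, X i), 1 - ⟪(q : E3), (p : E3)⟫ < r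
    · obtain ⟨q, hq, hqp⟩ := hex
      by_cases hpq : p = q
      · rwa [hpq]
      · rw [IsTangentCritical.congr (hnear q hq p hqp)] at hp
        exact absurd hp (hloc q hq χ hχ p hqp hpq)
    · push Not at hex
      have h0 : ∀ᶠ z in 𝓝 (p : E3), ∀ q ∈ hfin.toFinset, T q z = 0 := by
        rw [Filter.eventually_all_finset]
        intro q hq
        exact hfar q p (by linarith [hex q (hfin.mem_toFinset.1 hq)])
      have hΦG : Φ =ᶠ[𝓝 (p : E3)] Θ ∘ F := by
        filter_upwards [h0] with z hz
        simp only [hΦ]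
        rw [Finset.sum_eq_zero hz, add_zero]
      rw [IsTangentCritical.congr hΦG, isTangentCritical_comp hF.contDiff hΘ hpos] at hp
      exact hF.critical p hp
  · rw [hF.iUnion_eq] at hp
    obtain ⟨h, hh, h1, hhp⟩ := hp
    exact isTangentCritical_of_fixed (hinv h hh) h1 hhp
  · intro i p hp
    have hpU : p ∈ ⋃ i, X i := Set.mem_iUnion.2 ⟨i, hp⟩
    obtain ⟨h1, h2, h3⟩ := hB p hpU
    have hidx : idx p = i := hF.index_unique h1 hp
    refine ⟨B p, h2, ?_⟩
    obtain ⟨δ, hδ, hχ1⟩ := hχ.eq_one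
    have ht := tendsto_smul_stereo (B p)
    rw [h2] at ht
    have hself : 1 - ⟪(p : E3), (p : E3)⟫ = 0 := by rw [inner_self_sphere, sub_self]
    have hc : Continuous (fun z : E3 => 1 - ⟪(p : E3), z⟫) := by fun_prop
    have hδ' := (hc.tendsto (p : E3)).eventually_lt_const (u := δ) (by rw [hself]; exact hδ)
    filter_upwards [ht.eventually (hnear p hpU p (by rw [hself]; exact hr0)),
      ht.eventually hδ'] with z hz hzδ
    rw [hz]
    simp only [hT, capTerm]
    rw [hχ1 _ hzδ, coe_smul_sphere, rot_inv_rot, ambientModel_stereo, hidx]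
    ring

/-! ### The Hessian at a point with a local model -/

/-- Euclidean two-space. -/
abbrev E2 : Type := EuclideanSpace ℝ (Fin 2)

/-- The preferred chart is stereographic projection from `-p`, followed by an isometry from the
tangent plane to the Euclidean plane. That isometry is an arbitrary choice, so only its existence is
recorded, as `U`. -/
theorem coe_extChartAt_symm_apply (p : S2) : ∃ U : E2 →ₗᵢ[ℝ] E3, (∀ w, ⟪(p : E3), U w⟫ = 0) ∧
    ∀ w, (((extChartAt (𝓡 2) p).symm w : S2) : E3) =
      (‖w‖ ^ 2 + 4)⁻¹ • ((4 : ℝ) • U w + (4 - ‖w‖ ^ 2) • (p : E3)) := by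
  have : Fact (Module.finrank ℝ E3 = 2 + 1) := ⟨finrank_euclideanSpace_fin⟩
  set V : (ℝ ∙ ((-p : S2) : E3))ᗮ ≃ₗᵢ[ℝ] E2 :=
    (OrthonormalBasis.fromOrthogonalSpanSingleton 2 (ne_zero_of_mem_unit_sphere (-p))).repr
  refine ⟨(Submodule.subtypeₗᵢ _).comp V.symm.toLinearIsometry, fun w => ?_, fun w => ?_⟩
  · have h := Submodule.mem_orthogonal_singleton_iff_inner_right.1 (V.symm w).2
    have h' : ∀ v : E3, ⟪((-p : S2) : E3), v⟫ = 0 → ⟪(p : E3), v⟫ = 0 := fun v hv => by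
      rwa [coe_neg_sphere, inner_neg_left, neg_eq_zero] at hv
    exact h' _ h
  · have h := stereographic'_symm_apply (n := 2) (-p) w
    have e : (((extChartAt (𝓡 2) p).symm w : S2) : E3) = ((stereographic' 2 (-p)).symm w : S2) := by
      simp [chartAt, ChartedSpace.chartAt]
    have hn : ‖((V.symm w : (ℝ ∙ ((-p : S2) : E3))ᗮ) : E3)‖ = ‖w‖ := by
      rw [Submodule.norm_coe, V.symm.norm_map]
    rw [e, h]
    simp only [V] at hn
    simp only [hn]
    rw [smul_add]
    congr 1
    rw [coe_neg_sphere, smul_neg (_ - _), ← neg_smul, neg_sub]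

theorem extChartAt_self_eq_zero (p : S2) : extChartAt (𝓡 2) p p = (0 : E2) := by
  have : Fact (Module.finrank ℝ E3 = 2 + 1) := ⟨finrank_euclideanSpace_fin⟩
  obtain ⟨U, -, hU⟩ := coe_extChartAt_symm_apply p
  have h0 : (extChartAt (𝓡 2) p).symm (0 : E2) = p := by
    apply Subtype.ext
    rw [hU]
    simp [smul_smul]
  have ht : (0 : E2) ∈ (extChartAt (𝓡 2) p).target := by
    simp [chartAt, ChartedSpace.chartAt]
  have := (extChartAt (𝓡 2) p).right_inv ht
  rwa [h0] at this

theorem hess_sum_sq {E : Type*} [NormedAddCommGroup E] [NormedSpace ℝ E] (a b c : ℝ)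
    (l m : E →L[ℝ] ℝ) (x u v : E) :
    fderiv ℝ (fun y => fderiv ℝ (fun z => a * l z ^ 2 + b * m z ^ 2 + c) y v) x u =
      2 * a * (l u * l v) + 2 * b * (m u * m v) := by
  have h1 : ∀ y, fderiv ℝ (fun z => a * l z ^ 2 + b * m z ^ 2 + c) y v =
      (2 * a * l v) * l y + (2 * b * m v) * m y := fun y => by
    have h := (((l.hasFDerivAt (x := y)).pow 2).const_mul a).add
      (((m.hasFDerivAt (x := y)).pow 2).const_mul b)
    refine (DFunLike.congr_fun (h.add_const c).fderiv v).trans ?_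
    simp
    ring
  simp only [h1]
  have h := ((l.hasFDerivAt (x := x)).const_mul (2 * a * l v)).add
    ((m.hasFDerivAt (x := x)).const_mul (2 * b * m v))
  refine (DFunLike.congr_fun h.fderiv u).trans ?_
  simp
  ring

/-- The inverse chart at `w` is `A • stereo (l 0 w / 2, l 1 w / 2)` with `(l 0, l 1)` orthogonal. In
the chart the function is therefore an orthogonal change of the model with its quadratic part
divided by 4; the Hessian has eigenvalues `±1 / 4`. -/
theorem hessianMatrix_of_localModel {f : S2 → ℝ} {i : Fin 3} {A : SO3} {p : S2}
    (hp : A • northPole = p)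
    (hf : ∀ᶠ z in 𝓝 (0 : ℝ × ℝ), f (A • stereo z) = localModel i z) :
    ∃ L : Matrix (Fin 2) (Fin 2) ℝ, Lᵀ * L = 1 ∧
      hessianMatrix 2 f p = Lᵀ * (Matrix.diagonal ![sgnX i / 4, sgnY i / 4] * L) := by
  obtain ⟨U, hUp, hU⟩ := coe_extChartAt_symm_apply p
  set V : E2 →ₗᵢ[ℝ] E3 := (rot A⁻¹).toLinearIsometry.comp U with hV
  -- Tangent vectors at `p` become horizontal in the frame `A`, so the first two coordinates carry
  -- the whole scalar product.
  have hV2 : ∀ w, V w 2 = 0 := fun w => by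
    have := rot_inv_apply_two A (U w)
    rw [← coe_northPole, ← coe_smul_sphere, hp, hUp] at this
    exact this
  set l : Fin 3 → E2 →L[ℝ] ℝ := fun j =>
    (EuclideanSpace.proj j : E3 →L[ℝ] ℝ).comp V.toContinuousLinearMap with hl
  have hinner : ∀ u w, l 0 u * l 0 w + l 1 u * l 1 w = ⟪u, w⟫ := fun u w => by
    rw [← V.inner_map_map, inner_eq_coord, hV2 u]
    simp [hl]
  have hsymm : ∀ w : E2, (extChartAt (𝓡 2) p).symm w = A • stereo (l 0 w / 2, l 1 w / 2) := by
    intro w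
    have hn : l 0 w ^ 2 + l 1 w ^ 2 = ‖w‖ ^ 2 := by
      rw [← real_inner_self_eq_norm_sq, ← hinner]; ring
    rw [← inv_smul_eq_iff]
    apply Subtype.ext
    have hpN : rot A⁻¹ p = stdE 2 := by
      rw [← coe_northPole, ← hp, coe_smul_sphere, rot_inv_rot]
    have hVw : rot A⁻¹ (U w) = V w := rfl
    rw [coe_smul_sphere, hU, map_smul, map_add, map_smul, map_smul, hpN, hVw, ← hn]
    have h4 : l 0 w ^ 2 + l 1 w ^ 2 + 4 ≠ 0 := by positivity
    have h5 : 1 + (l 0 w / 2) ^ 2 + (l 1 w / 2) ^ 2 ≠ 0 := by positivity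
    have hl0 : V w 0 = l 0 w := rfl
    have hl1 : V w 1 = l 1 w := rfl
    ext j
    fin_cases j
    · simp [stereo, hl0]
      field_simp
      ring
    · simp [stereo, hl1]
      field_simp
      ring
    · simp [stereo, hV2]
      field_simp
      ring
  have hev : (f ∘ (extChartAt (𝓡 2) p).symm) =ᶠ[𝓝 (0 : E2)]
      fun w => sgnX i / 8 * l 0 w ^ 2 + sgnY i / 8 * l 1 w ^ 2 + ((i : ℝ) - 1) := by
    have hc : Filter.Tendsto (fun w : E2 => (l 0 w / 2, l 1 w / 2)) (𝓝 0) (𝓝 0) := by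
      have : Continuous (fun w : E2 => (l 0 w / 2, l 1 w / 2)) := by fun_prop
      simpa [← Prod.mk_zero_zero] using this.tendsto 0
    filter_upwards [hc.eventually hf] with w hw
    rw [Function.comp_apply, hsymm, hw, localModel_eq]
    ring
  refine ⟨Matrix.of fun j k => l (j.castSucc) (EuclideanSpace.single k 1), ?_, ?_⟩
  · ext j k
    rw [Matrix.mul_apply]
    simp only [Matrix.transpose_apply, Matrix.of_apply, Fin.sum_univ_two]
    refine (hinner _ _).trans ?_
    simp [EuclideanSpace.inner_single_left, Matrix.one_apply]
  · ext j k
    have h1 : ∀ v : E2, (fun y => fderiv ℝ (f ∘ (extChartAt (𝓡 2) p).symm) y v) =ᶠ[𝓝 0]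
        fun y => fderiv ℝ (fun w => sgnX i / 8 * l 0 w ^ 2 + sgnY i / 8 * l 1 w ^ 2 +
          ((i : ℝ) - 1)) y v := fun v => by
      filter_upwards [hev.eventuallyEq_nhds] with y hy
      rw [hy.fderiv_eq]
    simp only [hessianMatrix, Matrix.of_apply]
    rw [extChartAt_self_eq_zero, (h1 _).fderiv_eq, hess_sum_sq]
    simp only [Matrix.mul_apply, Matrix.transpose_apply, Matrix.of_apply, Fin.sum_univ_two,
      Matrix.diagonal_apply]
    simp
    ring

theorem charpoly_diagonal_fin_two (a b : ℝ) :
    (Matrix.diagonal ![a, b]).charpoly = (Polynomial.X - Polynomial.C a) *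
      (Polynomial.X - Polynomial.C b) := by
  rw [Matrix.charpoly, Matrix.det_fin_two]
  simp

/-- `L` is orthogonal, so the Hessian matrix has the characteristic polynomial of the diagonal
matrix of the two signs over 4. -/
theorem morseIndex_of_localModel {f : S2 → ℝ} {i : Fin 3} {A : SO3} {p : S2}
    (hp : A • northPole = p)
    (hf : ∀ᶠ z in 𝓝 (0 : ℝ × ℝ), f (A • stereo z) = localModel i z) :
    morseIndex 2 f p = (i : ℕ) := by
  obtain ⟨L, hL, hM⟩ := hessianMatrix_of_localModel hp hf
  have hL' : L * Lᵀ = 1 := mul_eq_one_comm.1 hL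
  rw [morseIndex, hM, Matrix.charpoly_mul_comm, Matrix.mul_assoc, hL', Matrix.mul_one,
    charpoly_diagonal_fin_two, Polynomial.roots_mul (mul_ne_zero (Polynomial.X_sub_C_ne_zero _)
      (Polynomial.X_sub_C_ne_zero _)), Polynomial.roots_X_sub_C, Polynomial.roots_X_sub_C]
  have h4 : ¬ ((1 : ℝ) / 4 < 0) := by norm_num
  have h4' : (-1 : ℝ) / 4 < 0 := by norm_num
  simp only [Multiset.filter_add, Multiset.filter_singleton]
  fin_cases i <;> simp [sgnX, sgnY, h4, h4', -one_div]

theorem det_hessianMatrix_ne_zero {f : S2 → ℝ} {i : Fin 3} {A : SO3} {p : S2}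
    (hp : A • northPole = p)
    (hf : ∀ᶠ z in 𝓝 (0 : ℝ × ℝ), f (A • stereo z) = localModel i z) :
    (hessianMatrix 2 f p).det ≠ 0 := by
  obtain ⟨L, hL, hM⟩ := hessianMatrix_of_localModel hp hf
  have hL' : L * Lᵀ = 1 := mul_eq_one_comm.1 hL
  rw [hM, Matrix.det_mul_comm, Matrix.mul_assoc, hL', Matrix.mul_one, Matrix.det_diagonal]
  fin_cases i <;> simp [sgnX, sgnY]

/-- The properties of the restriction to the sphere of a function as in `HasMorseModel`. -/
theorem HasMorseModel.conclusion {H : Subgroup SO3} {X : Fin 3 → Set S2}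
    (h : HasMorseModel H X) : (⋃ i, X i) = fixedSet H ∧ ∃ f : S2 → ℝ, IsMorse 2 f ∧
      (∀ h ∈ H, ∀ p : S2, f (h • p) = f p) ∧ critSet 2 f = (⋃ i, X i) ∧
      (∀ i : Fin 3, ∀ p ∈ X i, morseIndex 2 f p = (i : ℕ)) ∧
      (∀ i : Fin 3, ∀ p ∈ X i, ∃ ψ : ℝ × ℝ → S2, IsStereographicAt p ψ ∧
        ∀ᶠ z in 𝓝 (0 : ℝ × ℝ), f (ψ z) = localModel i z) := by
  have : Fact (Module.finrank ℝ E3 = 2 + 1) := ⟨finrank_euclideanSpace_fin⟩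
  obtain ⟨hX, F, hF, hinv, hcrit, hloc⟩ := h
  have hcs : critSet 2 (fun p : S2 => F p) = ⋃ i, X i := by
    ext p
    rw [mem_critSet_restrict (hF.differentiable (by simp) _), hcrit]
  refine ⟨hX, fun p => F p, ⟨?_, fun p hp => ?_⟩, fun h hh p => hinv h hh p, hcs,
    fun i p hp => ?_, fun i p hp => ?_⟩
  · exact hF.contMDiff.comp contMDiff_coe_sphere
  · rw [hcs] at hp
    obtain ⟨i, hi⟩ := Set.mem_iUnion.1 hp
    obtain ⟨A, hA, hA'⟩ := hloc i p hi
    exact det_hessianMatrix_ne_zero (f := fun p : S2 => F p) hA hA'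
  · obtain ⟨A, hA, hA'⟩ := hloc i p hp
    exact morseIndex_of_localModel (f := fun p : S2 => F p) hA hA'
  · obtain ⟨A, hA, hA'⟩ := hloc i p hp
    exact ⟨_, ⟨A, hA, rfl⟩, hA'⟩

/-- Moving a group and its point sets by a rotation. -/
theorem HasMorseModel.conj {H K : Subgroup SO3} {X Y : Fin 3 → Set S2} (h : HasMorseModel H X)
    (g : SO3) (hK : ∀ k, k ∈ K ↔ g⁻¹ * k * g ∈ H) (hY : ∀ i p, p ∈ Y i ↔ g⁻¹ • p ∈ X i) :
    HasMorseModel K Y := by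
  obtain ⟨hX, F, hF, hinv, hcrit, hloc⟩ := h
  have hU : ∀ p, p ∈ (⋃ i, Y i) ↔ g⁻¹ • p ∈ ⋃ i, X i := fun p => by
    simp only [Set.mem_iUnion, hY]
  refine ⟨?_, fun x => F (rot g⁻¹ x), hF.comp (rot g⁻¹).contDiff, fun k hk x => ?_, fun p => ?_,
    fun i p hp => ?_⟩
  · ext p
    rw [hU, hX]
    constructor
    · rintro ⟨h, hh, h1, hp⟩
      refine ⟨g * h * g⁻¹, (hK _).2 ?_, fun e => h1 ?_, ?_⟩
      · have : g⁻¹ * (g * h * g⁻¹) * g = h := by group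
        rwa [this]
      · have : h = g⁻¹ * (g * h * g⁻¹) * g := by group
        rw [this, e]; group
      · rw [mul_smul, mul_smul, hp, smul_inv_smul]
    · rintro ⟨k, hk, h1, hp⟩
      refine ⟨g⁻¹ * k * g, (hK _).1 hk, fun e => h1 ?_, ?_⟩
      · have : k = g * (g⁻¹ * k * g) * g⁻¹ := by group
        rw [this, e]; group
      · rw [mul_smul, mul_smul, smul_inv_smul, hp]
  · have := hinv _ ((hK k).1 hk) (rot g⁻¹ x)
    rw [rot_mul, rot_mul, rot_rot_inv] at this
    exact this
  · rw [isTangentCritical_comp_rot, hU, ← hcrit]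
    rfl
  · obtain ⟨A, hA, hA'⟩ := hloc i _ ((hY i p).1 hp)
    refine ⟨g * A, by rw [mul_smul, hA, smul_inv_smul], ?_⟩
    filter_upwards [hA'] with z hz
    rw [mul_smul, coe_smul_sphere g, rot_inv_rot, hz]

/-! ### The dihedral case -/

/-- The last two coordinates as a complex number. -/
def planar : E3 →L[ℝ] ℂ :=
  (EuclideanSpace.proj (1 : Fin 3) : E3 →L[ℝ] ℝ).smulRight 1 +
    (EuclideanSpace.proj (2 : Fin 3) : E3 →L[ℝ] ℝ).smulRight Complex.I

theorem planar_apply (x : E3) : planar x = x 1 + x 2 * Complex.I := by simp [planar]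

theorem planar_eq {x : E3} {a b : ℝ} (h1 : x 1 = a) (h2 : x 2 = b) : planar x = ⟨a, b⟩ := by
  rw [planar_apply, h1, h2]
  apply Complex.ext <;> simp

/-- `x₀² + Re ((x₁ + i x₂) ^ n) / n`. -/
def dihedralSeed (n : ℕ) (x : E3) : ℝ := x 0 ^ 2 + (planar x ^ n).re / n

theorem contDiff_dihedralSeed (n : ℕ) : ContDiff ℝ ∞ (dihedralSeed n) := by
  refine ContDiff.add (by fun_prop) (ContDiff.div_const ?_ _)
  exact Complex.reCLM.contDiff.comp (planar.contDiff.pow n)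

theorem hasDerivAt_re_planar (n : ℕ) (c : ℂ) (x W : E3) :
    HasDerivAt (fun t : ℝ => (planar (x + t • W) ^ n * c).re)
      ((n * planar x ^ (n - 1) * planar W * c).re) 0 := by
  have h1 : HasDerivAt (fun t : ℝ => planar (x + t • W)) (planar W) 0 := by
    simpa using (((hasDerivAt_id (0 : ℝ)).smul_const (planar W)).const_add (planar x))
  refine (Complex.reCLM.hasFDerivAt.comp_hasDerivAt (0 : ℝ)
    ((h1.pow n).mul_const c)).congr_deriv ?_
  rw [zero_smul, add_zero]
  rfl

theorem fderiv_dihedralSeed {n : ℕ} (hn : n ≠ 0) (x W : E3) :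
    fderiv ℝ (dihedralSeed n) x W = 2 * x 0 * W 0 + (planar x ^ (n - 1) * planar W).re := by
  refine fderiv_apply_of_hasDerivAt ((contDiff_dihedralSeed n).differentiable (by simp) x) ?_
  have h0 : HasDerivAt (fun t : ℝ => (x + t • W) 0) (W 0) 0 := by
    simpa using ((hasDerivAt_id (0 : ℝ)).mul_const (W 0)).const_add (x 0)
  have h := (h0.pow 2).add ((hasDerivAt_re_planar n 1 x W).div_const n)
  simp only [mul_one] at h
  refine h.congr_deriv ?_
  have hn' : (n : ℝ) ≠ 0 := by exact_mod_cast hn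
  have e : ((n : ℂ) * planar x ^ (n - 1) * planar W).re =
      n * (planar x ^ (n - 1) * planar W).re := by
    rw [mul_assoc, ← Complex.ofReal_natCast, Complex.re_ofReal_mul]
  rw [e]
  field_simp
  simp
  ring

theorem hess_dihedralSeed {n : ℕ} (hn : n ≠ 0) (p u v : E3) :
    hess (dihedralSeed n) p u v = 2 * u 0 * v 0 +
      ((n - 1 : ℕ) : ℝ) * (planar p ^ (n - 2) * planar u * planar v).re := by
  have hd := (contDiff_fderiv_apply (contDiff_dihedralSeed n) v).differentiable (by simp) p
  refine fderiv_apply_of_hasDerivAt hd ?_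
  simp only [fderiv_dihedralSeed hn]
  have h0 : HasDerivAt (fun t : ℝ => (p + t • u) 0) (u 0) 0 := by
    simpa using ((hasDerivAt_id (0 : ℝ)).mul_const (u 0)).const_add (p 0)
  refine (((h0.const_mul 2).mul_const (v 0)).add
    (hasDerivAt_re_planar (n - 1) (planar v) p u)).congr_deriv ?_
  rw [Nat.sub_sub, ← Complex.re_ofReal_mul, Complex.ofReal_natCast]
  congr 2
  ring

/-- The point at angle `θ` on the equator of the dihedral axis. -/
def equatorPoint (θ : ℝ) : S2 :=
  ⟨!₂[0, Real.cos θ, Real.sin θ], mem_sphere_of_coord (by simp)⟩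

theorem planar_equatorPoint (θ : ℝ) : planar (equatorPoint θ) = Complex.exp (θ * Complex.I) := by
  rw [planar_apply, Complex.exp_mul_I]
  simp [equatorPoint]

theorem dihedralA_smul_equatorPoint (n : ℕ) (θ : ℝ) :
    dihedralA n • equatorPoint θ = equatorPoint (2 * Real.pi / n + θ) := by
  ext i
  rw [coe_smul_sphere, rot_apply_coord]
  fin_cases i
  · simp [dihedralA, equatorPoint]
  · simp [dihedralA, equatorPoint, Real.cos_add]
    ring
  · simp [dihedralA, equatorPoint, Real.sin_add]

theorem dihedralA_pow_smul_equatorPoint (n k : ℕ) (θ : ℝ) :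
    dihedralA n ^ k • equatorPoint θ = equatorPoint (k * (2 * Real.pi / n) + θ) := by
  induction k with
  | zero => simp
  | succ k ih =>
    rw [pow_succ', mul_smul, ih, dihedralA_smul_equatorPoint]
    congr 1
    push_cast
    ring

theorem dihedralB_smul_equatorPoint (θ : ℝ) :
    dihedralB • equatorPoint θ = equatorPoint (-θ) := by
  ext i
  rw [coe_smul_sphere, rot_apply_coord]
  fin_cases i <;> simp [dihedralB, equatorPoint]

theorem dihedralA_mem (n : ℕ) : dihedralA n ∈ dihedral n :=
  Subgroup.subset_closure (by simp)

theorem dihedralB_mem (n : ℕ) : dihedralB ∈ dihedral n :=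
  Subgroup.subset_closure (by simp)

theorem planar_rot_dihedralA (n : ℕ) (x : E3) :
    planar (rot (dihedralA n) x) = Complex.exp (2 * Real.pi / n * Complex.I) * planar x := by
  have e : (2 * Real.pi / n * Complex.I : ℂ) = ((2 * Real.pi / n : ℝ) : ℂ) * Complex.I := by
    push_cast; ring
  rw [planar_apply, planar_apply, rot_apply_coord, rot_apply_coord, e, Complex.exp_mul_I]
  simp only [dihedralA, ← Complex.ofReal_cos, ← Complex.ofReal_sin]
  apply Complex.ext <;> simp <;> ring

theorem planar_rot_dihedralB (x : E3) : planar (rot dihedralB x) = starRingEnd ℂ (planar x) := by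
  rw [planar_apply, planar_apply, rot_apply_coord, rot_apply_coord]
  simp [dihedralB]

/-- On generators: the first multiplies `planar x` by an `n`-th root of unity, the second conjugates
it and changes the sign of `x 0`. -/
theorem dihedralSeed_rot {n : ℕ} (hn : n ≠ 0) {h : SO3} (hh : h ∈ dihedral n) :
    ∀ x, dihedralSeed n (rot h x) = dihedralSeed n x := by
  induction hh using Subgroup.closure_induction with
  | mem h hh =>
    rcases hh with rfl | rfl
    · intro x
      have h0 : rot (dihedralA n) x 0 = x 0 := by rw [rot_apply_coord]; simp [dihedralA]
      have h1 : Complex.exp (2 * Real.pi / n * Complex.I) ^ n = 1 := by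
        rw [← Complex.exp_nat_mul]
        have hn' : (n : ℂ) ≠ 0 := by exact_mod_cast hn
        rw [show (n : ℂ) * (2 * Real.pi / n * Complex.I) = 2 * Real.pi * Complex.I by field_simp,
          Complex.exp_two_pi_mul_I]
      rw [dihedralSeed, dihedralSeed, planar_rot_dihedralA, h0, mul_pow, h1, one_mul]
    · intro x
      have h0 : rot dihedralB x 0 = -x 0 := by rw [rot_apply_coord]; simp [dihedralB]
      rw [dihedralSeed, dihedralSeed, planar_rot_dihedralB, h0, neg_sq, ← map_pow,
        Complex.conj_re]
  | one => simp
  | mul a b _ _ ha hb => intro x; rw [rot_mul, ha, hb]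
  | inv a _ ha => intro x; rw [← ha, rot_rot_inv]

/-- Off the equator a critical point satisfies `Re wⁿ = 2 ‖w‖²`; against this bound, it must lie on
the axis. -/
theorem re_pow_le {w : ℂ} (hw : ‖w‖ ≤ 1) {n : ℕ} (hn : 2 ≤ n) : (w ^ n).re ≤ ‖w‖ ^ 2 := by
  refine (Complex.re_le_norm _).trans ?_
  rw [norm_pow]
  exact pow_le_pow_of_le_one (norm_nonneg _) hw hn

theorem exists_exp_eq_of_pow_eq_one {n : ℕ} (hn : n ≠ 0) {w : ℂ} (hw : w ^ n = 1) :
    ∃ k : ℕ, 1 ≤ k ∧ k ≤ n ∧ w = Complex.exp ((2 * k * Real.pi / n : ℝ) * Complex.I) := by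
  have : NeZero n := ⟨hn⟩
  have hn' : (n : ℂ) ≠ 0 := by exact_mod_cast hn
  obtain ⟨i, hi, rfl⟩ := (Complex.isPrimitiveRoot_exp n hn).eq_pow_of_pow_eq_one hw
  rw [← Complex.exp_nat_mul]
  rcases Nat.eq_zero_or_pos i with rfl | h0
  -- The range is from 1 to `n`, so the exponent 0 is represented by `n`.
  · refine ⟨n, Nat.one_le_iff_ne_zero.2 hn, le_rfl, ?_⟩
    push_cast
    rw [show (2 * (n : ℂ) * Real.pi / n * Complex.I) = 2 * Real.pi * Complex.I by field_simp,
      Complex.exp_two_pi_mul_I]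
    simp
  · refine ⟨i, h0, hi.le, ?_⟩
    congr 1
    push_cast
    ring

theorem eq_equatorPoint {q : S2} (h0 : (q : E3) 0 = 0) {θ : ℝ}
    (h : planar q = Complex.exp (θ * Complex.I)) : (q : E3) = !₂[0, Real.cos θ, Real.sin θ] := by
  rw [← planar_equatorPoint, planar_apply, planar_apply] at h
  have hr := congrArg Complex.re h
  have hi := congrArg Complex.im h
  ext i
  fin_cases i
  · simpa using h0
  · simpa [equatorPoint, Complex.cos_ofReal_re] using hr
  · simpa [equatorPoint, Complex.sin_ofReal_re] using hi

/-- Differentiation along the parallel gives `Im wⁿ = 0`, along the meridian `x₀ (Re wⁿ - 2 ‖w‖²) =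
0`. On the equator this leaves `wⁿ = 1` (saddles) or `wⁿ = -1` (minima), elsewhere `w = 0` (maxima).
-/
theorem dihedral_critical {n : ℕ} (hn : 2 ≤ n) {q : S2}
    (hq : IsTangentCritical (dihedralSeed n) q) : q ∈ ⋃ i, dihedralPoints n i := by
  have hn0 : n ≠ 0 := by omega
  have hnC : (n : ℂ) ≠ 0 := by exact_mod_cast hn0
  have hs := sphere_coord q
  set x : E3 := q.1 with hx
  set w := planar x with hw
  have hwn : ‖w‖ ^ 2 = x 1 ^ 2 + x 2 ^ 2 := by
    rw [hw, planar_eq rfl rfl, ← Complex.normSq_eq_norm_sq, Complex.normSq_mk]; ring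
  have hpow : w ^ (n - 1) * w = w ^ n := by
    rw [← pow_succ, Nat.sub_add_cancel (by omega)]
  have h1 := hq !₂[0, -x 2, x 1] (by rw [inner_eq_coord]; simp; ring)
  have h2 := hq !₂[-(x 1 ^ 2 + x 2 ^ 2), x 0 * x 1, x 0 * x 2]
    (by rw [inner_eq_coord]; simp; ring)
  rw [fderiv_dihedralSeed hn0] at h1 h2
  have e1 : planar !₂[0, -x 2, x 1] = w * Complex.I := by
    rw [hw, planar_apply, planar_apply]
    apply Complex.ext <;> simp
  have e2 : planar !₂[-(x 1 ^ 2 + x 2 ^ 2), x 0 * x 1, x 0 * x 2] = w * (x 0 : ℂ) := by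
    rw [hw, planar_apply, planar_apply]
    apply Complex.ext <;> simp <;> ring
  rw [e1, ← mul_assoc, hpow] at h1
  rw [e2, ← mul_assoc, hpow, Complex.re_mul_ofReal] at h2
  simp at h1 h2
  rw [Set.mem_iUnion]
  by_cases hx0 : x 0 = 0
  · have hw1 : ‖w‖ = 1 := by
      rw [← sq_eq_sq₀ (norm_nonneg _) zero_le_one, hwn]
      rw [hx0] at hs
      linarith
    have hwnn : ‖w ^ n‖ ^ 2 = 1 := by rw [norm_pow, hw1, one_pow, one_pow]
    rw [← Complex.normSq_eq_norm_sq, Complex.normSq_apply, h1] at hwnn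
    have hre : (w ^ n).re = 1 ∨ (w ^ n).re = -1 := by
      rw [← sq_eq_one_iff]
      linarith
    rcases hre with hre | hre
    · have hwn1 : w ^ n = 1 := Complex.ext (by simp [hre]) (by simp [h1])
      obtain ⟨k, hk1, hk2, hk⟩ := exists_exp_eq_of_pow_eq_one hn0 hwn1
      exact ⟨1, k, hk1, hk2, eq_equatorPoint hx0 hk⟩
    · have hwn1 : w ^ n = -1 := Complex.ext (by simp [hre]) (by simp [h1])
      -- Division by one solution of `wⁿ = -1` reduces to the roots of unity.
      set ξ := Complex.exp ((Real.pi / n : ℝ) * Complex.I) with hξ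
      have hξn : ξ ^ n = -1 := by
        rw [hξ, ← Complex.exp_nat_mul, ← Complex.exp_pi_mul_I]
        congr 1
        push_cast
        field_simp
      have hξ0 : ξ ≠ 0 := Complex.exp_ne_zero _
      obtain ⟨k, hk1, hk2, hk⟩ := exists_exp_eq_of_pow_eq_one hn0 (w := w / ξ)
        (by rw [div_pow, hwn1, hξn, div_self (by norm_num)])
      refine ⟨0, k, hk1, hk2, eq_equatorPoint hx0 ?_⟩
      change w = _
      rw [div_eq_iff hξ0, hξ, ← Complex.exp_add] at hk
      rw [hk]
      congr 1
      push_cast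
      ring
  · have h3 : (w ^ n).re = 2 * ‖w‖ ^ 2 := by
      rw [hwn]
      apply mul_right_cancel₀ hx0
      linarith
    have hle : ‖w‖ ≤ 1 := by
      rw [← sq_le_sq₀ (norm_nonneg _) zero_le_one, hwn]
      nlinarith [sq_nonneg (x 0)]
    have := re_pow_le hle hn
    have h0 : x 1 ^ 2 + x 2 ^ 2 = 0 := by nlinarith [sq_nonneg ‖w‖]
    have hx1 : x 1 = 0 := by nlinarith [sq_nonneg (x 1), sq_nonneg (x 2)]
    have hx2 : x 2 = 0 := by nlinarith [sq_nonneg (x 1), sq_nonneg (x 2)]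
    refine ⟨2, ?_⟩
    have hx00 : x 0 = 1 ∨ x 0 = -1 := by
      rw [← sq_eq_one_iff]
      linarith
    rcases hx00 with h | h
    · left; ext i; fin_cases i <;> simp <;> assumption
    · right; ext i; fin_cases i <;> simp <;> assumption

/-- The Morse frames for the dihedral seed. -/
def dihedralFrame (n : ℕ) : Fin 3 → SO3 :=
  ![⟨!![1, 0, 0; 0, Real.sin (Real.pi / n), Real.cos (Real.pi / n);
      0, -Real.cos (Real.pi / n), Real.sin (Real.pi / n)], by
    have h := Real.sin_sq_add_cos_sq (Real.pi / n)
    rw [Matrix.mem_specialOrthogonalGroup_iff, Matrix.mem_orthogonalGroup_iff]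
    constructor
    · ext i j
      fin_cases i <;> fin_cases j <;>
        simp [Matrix.mul_apply, Fin.sum_univ_three] <;> nlinarith
    · simp [Matrix.det_fin_three]
      nlinarith⟩,
    ⟨!![0, 1, 0; 0, 0, 1; 1, 0, 0], by
    rw [Matrix.mem_specialOrthogonalGroup_iff, Matrix.mem_orthogonalGroup_iff]
    constructor
    · ext i j
      fin_cases i <;> fin_cases j <;> simp [Matrix.mul_apply, Fin.sum_univ_three]
    · simp [Matrix.det_fin_three]⟩,
    ⟨!![0, 0, 1; 1, 0, 0; 0, 1, 0], by
    rw [Matrix.mem_specialOrthogonalGroup_iff, Matrix.mem_orthogonalGroup_iff]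
    constructor
    · ext i j
      fin_cases i <;> fin_cases j <;> simp [Matrix.mul_apply, Fin.sum_univ_three]
    · simp [Matrix.det_fin_three]⟩]

theorem dihedralFrame_smul_zero (n : ℕ) :
    dihedralFrame n 0 • northPole = equatorPoint (Real.pi / n) := by
  ext i
  rw [coe_smul_sphere, rot_apply_coord]
  fin_cases i <;> simp [dihedralFrame, equatorPoint, northPole]

theorem dihedralFrame_smul_one (n : ℕ) : dihedralFrame n 1 • northPole = equatorPoint 0 := by
  ext i
  rw [coe_smul_sphere, rot_apply_coord]
  fin_cases i <;> simp [dihedralFrame, equatorPoint, northPole]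

theorem coe_dihedralFrame_smul_two (n : ℕ) :
    ((dihedralFrame n 2 • northPole : S2) : E3) = !₂[1, 0, 0] := by
  ext i
  rw [coe_smul_sphere, rot_apply_coord]
  fin_cases i <;> simp [dihedralFrame, northPole]

theorem finite_of_coe_eq {n : ℕ} (v : ℕ → E3) :
    {p : S2 | ∃ k : ℕ, 1 ≤ k ∧ k ≤ n ∧ (p : E3) = v k}.Finite := by
  refine Set.Finite.subset (((Set.finite_Icc 1 n).image v).preimage
    (Subtype.val_injective.injOn)) ?_
  rintro p ⟨k, h1, h2, h3⟩
  exact ⟨k, ⟨h1, h2⟩, h3.symm⟩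

/-- The fixing elements are `a b` at angle `π / n`, `b` at angle 0 and `a` on the axis. -/
theorem mem_fixedSet_dihedralFrame {n : ℕ} (hn : 2 ≤ n) (i : Fin 3) :
    dihedralFrame n i • northPole ∈ fixedSet (dihedral n) := by
  have hb : dihedralB ≠ 1 := fun e => by
    have := congrArg (fun A : SO3 => A.1 0 0) e
    simp [dihedralB] at this
    norm_num at this
  fin_cases i
  · refine ⟨dihedralA n * dihedralB, mul_mem (dihedralA_mem n) (dihedralB_mem n), fun e => ?_, ?_⟩
    · have := congrArg (fun A : SO3 => A.1 0 0) e
      simp [dihedralA, dihedralB] at this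
      norm_num at this
    · change _ • dihedralFrame n 0 • northPole = dihedralFrame n 0 • northPole
      rw [dihedralFrame_smul_zero, mul_smul, dihedralB_smul_equatorPoint,
        dihedralA_smul_equatorPoint]
      congr 1
      ring
  · refine ⟨dihedralB, dihedralB_mem n, hb, ?_⟩
    change _ • dihedralFrame n 1 • northPole = dihedralFrame n 1 • northPole
    rw [dihedralFrame_smul_one, dihedralB_smul_equatorPoint, neg_zero]
  · refine ⟨dihedralA n, dihedralA_mem n, fun e => ?_, ?_⟩
    · have := congrArg (fun A : SO3 => A.1 1 1) e
      simp [dihedralA] at this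
      have hn' : (2 : ℝ) ≤ n := by exact_mod_cast hn
      have h1 : 0 < 2 * Real.pi / n := by have := Real.pi_pos; positivity
      -- Here `n ≥ 2` is essential: it makes `a` different from the identity.
      have h2 : 2 * Real.pi / n ≤ Real.pi := by
        rw [div_le_iff₀ (by linarith)]
        nlinarith [Real.pi_pos]
      have := Real.cos_lt_cos_of_nonneg_of_le_pi le_rfl h2 h1
      rw [Real.cos_zero] at this
      linarith
    · apply Subtype.ext
      change rot (dihedralA n) ((dihedralFrame n 2 • northPole : S2) : E3) =
        ((dihedralFrame n 2 • northPole : S2) : E3)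
      rw [coe_dihedralFrame_smul_two]
      ext i
      rw [rot_apply_coord]
      fin_cases i <;> simp [dihedralA]

theorem dihedral_transitive {n : ℕ} (i : Fin 3) {q : S2} (hq : q ∈ dihedralPoints n i) :
    ∃ h ∈ dihedral n, h • dihedralFrame n i • northPole = q := by
  fin_cases i
  · obtain ⟨k, -, -, hk⟩ := hq
    refine ⟨_, pow_mem (dihedralA_mem n) k, ?_⟩
    apply Subtype.ext
    change ((dihedralA n ^ k • dihedralFrame n 0 • northPole : S2) : E3) = _
    rw [hk, dihedralFrame_smul_zero, dihedralA_pow_smul_equatorPoint, equatorPoint]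
    rw [show (k * (2 * Real.pi / n) + Real.pi / n) = (Real.pi + 2 * k * Real.pi) / n by ring]
  · obtain ⟨k, -, -, hk⟩ := hq
    refine ⟨_, pow_mem (dihedralA_mem n) k, ?_⟩
    apply Subtype.ext
    change ((dihedralA n ^ k • dihedralFrame n 1 • northPole : S2) : E3) = _
    rw [hk, dihedralFrame_smul_one, dihedralA_pow_smul_equatorPoint, equatorPoint]
    rw [show (k * (2 * Real.pi / n) + 0) = 2 * k * Real.pi / n by ring]
  · rcases hq with hq | hq
    · refine ⟨1, one_mem _, ?_⟩
      apply Subtype.ext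
      change ((1 • dihedralFrame n 2 • northPole : S2) : E3) = _
      rw [one_smul, coe_dihedralFrame_smul_two, hq]
    · refine ⟨dihedralB, dihedralB_mem n, ?_⟩
      apply Subtype.ext
      change rot dihedralB ((dihedralFrame n 2 • northPole : S2) : E3) = _
      rw [coe_dihedralFrame_smul_two, hq]
      ext i
      rw [rot_apply_coord]
      fin_cases i <;> simp [dihedralB]

/-- The critical values are `-1 / n < 1 / n < 1`. The diagonal Hessian entries on the sphere are `3,
n` at the minima, `-n, 1` at the saddles, and `-2, -2` at the maxima (`-1, -3` if `n = 2`). -/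
theorem isMorseSeed_dihedral {n : ℕ} (hn : 2 ≤ n) :
    IsMorseSeed (dihedral n) (dihedralPoints n) (dihedralSeed n) (dihedralFrame n) := by
  have hn0 : n ≠ 0 := by omega
  have hn' : (2 : ℝ) ≤ n := by exact_mod_cast hn
  have hnC : (n : ℂ) ≠ 0 := by exact_mod_cast hn0
  have hn1 : (1 : ℝ) ≤ ((n - 1 : ℕ) : ℝ) := by
    exact_mod_cast (by omega : 1 ≤ n - 1)
  have hinv : ∀ h ∈ dihedral n, ∀ x, dihedralSeed n (rot h x) = dihedralSeed n x :=
    fun h hh => dihedralSeed_rot hn0 hh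
  have hcrit : ∀ i, IsTangentCritical (dihedralSeed n) (dihedralFrame n i • northPole : S2) :=
    fun i => by
      obtain ⟨h, hh, h1, hp⟩ := mem_fixedSet_dihedralFrame hn i
      exact isTangentCritical_of_fixed (hinv h hh) h1 hp
  simp only [coe_smul_sphere, coe_northPole] at hcrit
  have hsplit : ∀ w : ℂ, w ^ n = w ^ (n - 2) * w * w := fun w => by
    rw [mul_assoc, ← sq, ← pow_add, Nat.sub_add_cancel hn]
  have hsplit1 : ∀ w : ℂ, w ^ n = w ^ (n - 1) * w := fun w => by
    rw [← pow_succ, Nat.sub_add_cancel (by omega)]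
  have p0 : rot (dihedralFrame n 0) (stdE 2) = equatorPoint (Real.pi / n) := by
    rw [← dihedralFrame_smul_zero, coe_smul_sphere, coe_northPole]
  have p1 : rot (dihedralFrame n 1) (stdE 2) = equatorPoint 0 := by
    rw [← dihedralFrame_smul_one n, coe_smul_sphere, coe_northPole]
  have p2 : rot (dihedralFrame n 2) (stdE 2) = !₂[1, 0, 0] := by
    rw [← coe_dihedralFrame_smul_two n, coe_smul_sphere, coe_northPole]
  set w := planar (equatorPoint (Real.pi / n)) with hw
  have hwn : w ^ n = -1 := by
    rw [hw, planar_equatorPoint, ← Complex.exp_nat_mul, ← Complex.exp_pi_mul_I]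
    congr 1
    push_cast
    field_simp
  have h1n : planar (equatorPoint 0) = 1 := by rw [planar_equatorPoint]; simp
  have h2n : planar !₂[1, 0, 0] = 0 := by rw [planar_apply]; simp
  have q0 : (equatorPoint (Real.pi / n) : E3) 0 = 0 := by simp [equatorPoint]
  have q1 : (equatorPoint 0 : E3) 0 = 0 := by simp [equatorPoint]
  refine ⟨contDiff_dihedralSeed n, hinv, fun i q hq => dihedral_transitive i hq, fun i => ?_,
    mem_fixedSet_dihedralFrame hn, fun i => ⟨hcrit i, ?_, ?_, ?_⟩, ?_, ?_,
    fun q hq => dihedral_critical hn hq⟩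
  · fin_cases i
    · exact finite_of_coe_eq _
    · exact finite_of_coe_eq _
    · refine Set.Finite.subset ((Set.toFinite {!₂[1, 0, 0], !₂[-1, 0, 0]}).preimage
        (Subtype.val_injective.injOn)) ?_
      rintro p (h | h) <;> simp [h]
  · rw [hess_dihedralSeed hn0]
    fin_cases i
    · simp [rot_stdE, dihedralFrame, planar_apply]
    · simp [rot_stdE, dihedralFrame, planar_apply]
    · simp only [Fin.reduceFinMk, p2, h2n]
      rcases Nat.eq_zero_or_pos (n - 2) with h | h
      · simp [rot_stdE, dihedralFrame, planar_apply, h]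
      · simp [rot_stdE, dihedralFrame, planar_apply, zero_pow h.ne']
  · rw [hess_dihedralSeed hn0, fderiv_dihedralSeed hn0]
    fin_cases i
    · have e0 : planar (rot (dihedralFrame n 0) (stdE 0)) = 0 := by
        simp [rot_stdE, dihedralFrame, planar_apply]
      simp only [Fin.zero_eta, p0, e0, ← hw, ← hsplit1, hwn, q0]
      simp [rot_stdE, dihedralFrame, sgnX]
      norm_num
    · have e0 : planar (rot (dihedralFrame n 1) (stdE 0)) = Complex.I := by
        simp [rot_stdE, dihedralFrame, planar_apply]
      simp only [Fin.mk_one, p1, e0, h1n, q1]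
      simp [rot_stdE, dihedralFrame, sgnX]
      linarith
    · have e0 : planar (rot (dihedralFrame n 2) (stdE 0)) = 1 := by
        simp [rot_stdE, dihedralFrame, planar_apply]
      simp only [Fin.reduceFinMk, p2, e0, h2n]
      -- At the poles `planar` vanishes. For `n = 2` the power `0 ^ (n - 2)` is 1 and a second
      -- derivative `±1` survives, but the radial derivative 2 dominates it.
      rcases Nat.eq_zero_or_pos (n - 2) with h | h
      · have : n = 2 := by omega
        subst this
        simp [rot_stdE, dihedralFrame, sgnX]
      · simp [rot_stdE, dihedralFrame, sgnX, zero_pow h.ne']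
  · rw [hess_dihedralSeed hn0, fderiv_dihedralSeed hn0]
    fin_cases i
    · have e0 : planar (rot (dihedralFrame n 0) (stdE 1)) = -Complex.I * w := by
        rw [hw, planar_apply, planar_apply]
        apply Complex.ext <;> simp [rot_stdE, dihedralFrame, equatorPoint]
        ring
      have e1 : w ^ (n - 2) * (-Complex.I * w) * (-Complex.I * w) = 1 := by
        calc _ = Complex.I ^ 2 * (w ^ (n - 2) * w * w) := by ring
          _ = 1 := by rw [← hsplit, hwn, Complex.I_sq]; norm_num
      simp only [Fin.zero_eta, p0, e0, ← hw, ← hsplit1, hwn, q0, e1]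
      simp [rot_stdE, dihedralFrame, sgnY]
      linarith
    · have e0 : planar (rot (dihedralFrame n 1) (stdE 1)) = 0 := by
        simp [rot_stdE, dihedralFrame, planar_apply]
      simp only [Fin.mk_one, p1, e0, h1n, q1]
      simp [rot_stdE, dihedralFrame, sgnY]
    · have e0 : planar (rot (dihedralFrame n 2) (stdE 1)) = Complex.I := by
        simp [rot_stdE, dihedralFrame, planar_apply]
      simp only [Fin.reduceFinMk, p2, e0, h2n]
      rcases Nat.eq_zero_or_pos (n - 2) with h | h
      · have : n = 2 := by omega
        subst this
        simp [rot_stdE, dihedralFrame, sgnY]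
        norm_num
      · simp [rot_stdE, dihedralFrame, sgnY, zero_pow h.ne']
  · rw [dihedralFrame_smul_zero, dihedralFrame_smul_one, dihedralSeed, dihedralSeed, ← hw, hwn,
      h1n, q0, q1]
    have : 0 < (n : ℝ)⁻¹ := by positivity
    simp
    rw [neg_div, one_div]
    linarith
  · rw [dihedralFrame_smul_one, coe_dihedralFrame_smul_two, dihedralSeed, dihedralSeed, h1n, h2n,
      q1]
    have : (n : ℝ)⁻¹ < 1 := inv_lt_one_of_one_lt₀ (by linarith)
    simp [hn0]
    exact this

/-! ### Polyhedra: moving faces by rotations -/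

theorem radial_rot (g : SO3) (x : E3) : radial (rot g x) = rot g (radial x) := by
  rw [radial, radial, LinearIsometryEquiv.norm_map, map_smul]

theorem radial_smul {c : ℝ} (hc : 0 < c) (x : E3) : radial (c • x) = radial x := by
  rw [radial, radial, norm_smul, Real.norm_of_nonneg hc.le, smul_smul, mul_inv, mul_right_comm,
    inv_mul_cancel₀ hc.ne', one_mul]

/-- The image of a finite set of points under a rotation. -/
def moveFinset (g : SO3) (S : Finset S2) : Finset S2 := S.map (MulAction.toPerm g).toEmbedding

theorem mem_moveFinset {g : SO3} {S : Finset S2} {p : S2} :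
    p ∈ moveFinset g S ↔ g⁻¹ • p ∈ S := by
  simp only [moveFinset, Finset.mem_map_equiv]
  rfl

theorem card_moveFinset (g : SO3) (S : Finset S2) : (moveFinset g S).card = S.card :=
  Finset.card_map _

theorem barycenter_moveFinset (g : SO3) (S : Finset S2) :
    barycenter (moveFinset g S) = rot g (barycenter S) := by
  rw [barycenter, barycenter, card_moveFinset, map_smul, map_sum, moveFinset, Finset.sum_map]
  rfl

theorem IsFace.move {V W : Set S2} {g : SO3} (hW : ∀ p, p ∈ W ↔ g⁻¹ • p ∈ V) {S : Finset S2}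
    (h : IsFace V S) : IsFace W (moveFinset g S) := by
  obtain ⟨a, c, ha, hle, hS⟩ := h
  have hin : ∀ p : S2, ⟪rot g a, (p : E3)⟫ = ⟪a, ((g⁻¹ • p : S2) : E3)⟫ := fun p =>
    inner_rot_left g a p
  refine ⟨rot g a, c, fun h => ha ?_, fun v hv => ?_, ?_⟩
  · exact (rot g).map_eq_zero_iff.1 h
  · rw [hin]
    exact hle _ ((hW v).1 hv)
  · ext p
    rw [Finset.mem_coe, mem_moveFinset, Set.mem_ofPred_eq, hin, hW, ← Finset.mem_coe, hS]
    rfl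

theorem mem_polyhedralPoints_of_move {V W : Set S2} {g : SO3} (hW : ∀ p, p ∈ W ↔ g⁻¹ • p ∈ V)
    {i : Fin 3} {p : S2} (hp : p ∈ polyhedralPoints V i) : g • p ∈ polyhedralPoints W i := by
  have key : ∀ S : Finset S2, (p : E3) = radial (barycenter S) →
      ((g • p : S2) : E3) = radial (barycenter (moveFinset g S)) := fun S h => by
    rw [barycenter_moveFinset, radial_rot, ← h]
    rfl
  fin_cases i
  · refine (hW _).2 ?_
    rw [inv_smul_smul]
    exact hp
  · obtain ⟨S, h1, h2, h3⟩ := hp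
    exact ⟨_, h1.move hW, by rw [card_moveFinset, h2], key S h3⟩
  · obtain ⟨S, h1, h2, h3⟩ := hp
    exact ⟨_, h1.move hW, by rwa [card_moveFinset], key S h3⟩

/-- Rotating the vertices conjugates the group and moves faces to faces, so an arbitrary position
reduces to the standard one. -/
theorem HasMorseModel.move {W : Set S2} (h : HasMorseModel (polyhedral W) (polyhedralPoints W))
    (g : SO3) : HasMorseModel (polyhedral ((fun p => g • p) '' W))
      (polyhedralPoints ((fun p => g • p) '' W)) := by
  have hW : ∀ p, p ∈ (fun p => g • p) '' W ↔ g⁻¹ • p ∈ W := fun p => by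
    constructor
    · rintro ⟨q, hq, rfl⟩
      simpa using hq
    · intro hp
      exact ⟨_, hp, smul_inv_smul g p⟩
  have hW' : ∀ p, p ∈ W ↔ (g⁻¹)⁻¹ • p ∈ (fun p => g • p) '' W := fun p => by
    rw [hW, inv_inv, inv_smul_smul]
  refine h.conj g (fun k => ?_) fun i p => ⟨fun hp => ?_, fun hp => ?_⟩
  · open scoped Pointwise in
    have e : (fun p => g • p) '' W = g • W := rfl
    rw [polyhedral, polyhedral, e, MulAction.stabilizer_smul_eq_stabilizer_map_conj]
    constructor
    · rintro ⟨x, hx, rfl⟩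
      have : g⁻¹ * (g * x * g⁻¹) * g = x := by group
      change g⁻¹ * (g * x * g⁻¹) * g ∈ _
      rwa [this]
    · intro hk
      refine ⟨_, hk, ?_⟩
      simp [mul_assoc]
  · exact mem_polyhedralPoints_of_move hW' hp
  · have := mem_polyhedralPoints_of_move hW hp
    rwa [smul_inv_smul] at this

theorem mem_iff_of_mem_polyhedral {V : Set S2} {g : SO3} (hg : g ∈ polyhedral V) (p : S2) :
    p ∈ V ↔ g⁻¹ • p ∈ V := by
  open scoped Pointwise in
  have h : g • V = V := hg
  rw [← Set.mem_smul_set_iff_inv_smul_mem, h]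

/-! ### Radial projection to the sphere -/

/-- The radial projection of a nonzero vector, as a point of the sphere. -/
def sph (x : E3) : S2 :=
  if h : x ≠ 0 then ⟨radial x, by
    rw [mem_sphere_zero_iff_norm, radial, norm_smul, norm_inv, norm_norm,
      inv_mul_cancel₀ (norm_ne_zero_iff.2 h)]⟩ else northPole

theorem coe_sph {x : E3} (h : x ≠ 0) : (sph x : E3) = radial x := by rw [sph, dif_pos h]

theorem smul_sph {x : E3} (h : x ≠ 0) (g : SO3) : g • sph x = sph (rot g x) := by
  apply Subtype.ext
  rw [coe_smul_sphere, coe_sph h, coe_sph fun h' => h ((rot g).map_eq_zero_iff.1 h'), radial_rot]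

theorem eq_sph_of_smul {q : S2} {c : ℝ} (hc : 0 < c) {x : E3} (h : (q : E3) = c • x) :
    q = sph x := by
  have hq : ‖(q : E3)‖ = 1 := mem_sphere_zero_iff_norm.1 q.2
  have hx : x ≠ 0 := by
    rintro rfl
    rw [h, smul_zero, norm_zero] at hq
    exact zero_ne_one hq
  apply Subtype.ext
  rw [coe_sph hx, ← radial_smul hc, ← h, radial, hq, inv_one, one_smul]

/-- A positively oriented orthogonal triple, normalized, is a rotation matrix. -/
theorem exists_rotation_of_orthogonal (u : Fin 3 → E3) (hu : ∀ i j, i ≠ j → ⟪u i, u j⟫ = 0)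
    (hdet : 0 < (Matrix.of fun i j => u j i).det) :
    ∃ A : SO3, ∀ j, rot A (stdE j) = ‖u j‖⁻¹ • u j := by
  have hne : ∀ j, u j ≠ 0 := fun j h0 => by
    refine hdet.ne' (Matrix.det_eq_zero_of_column_eq_zero j fun i => ?_)
    simp [h0]
  set M : Matrix (Fin 3) (Fin 3) ℝ := Matrix.of fun i j => ‖u j‖⁻¹ * u j i with hM
  have hMM : Mᵀ * M = 1 := by
    ext i j
    have e : (Mᵀ * M) i j = ‖u i‖⁻¹ * ‖u j‖⁻¹ * ⟪u i, u j⟫ := by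
      rw [Matrix.mul_apply, inner_eq_coord]
      simp [hM, Fin.sum_univ_three]
      ring
    rw [e]
    by_cases hij : i = j
    · subst hij
      have : ‖u i‖ ≠ 0 := norm_ne_zero_iff.2 (hne i)
      rw [Matrix.one_apply_eq, real_inner_self_eq_norm_sq]
      field_simp
    · rw [hu i j hij, Matrix.one_apply_ne hij, mul_zero]
  have hMd : M.det = 1 := by
    -- Orthogonality leaves the sign of the determinant, which is that of the original triple
    -- because its columns were scaled by positive numbers.
    have h1 : M.det ^ 2 = 1 := by
      have := congrArg Matrix.det hMM
      rwa [Matrix.det_mul, Matrix.det_transpose, Matrix.det_one, ← sq] at this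
    have h2 : 0 < M.det := by
      have e : M = (Matrix.of fun i j => u j i) * Matrix.diagonal fun j => ‖u j‖⁻¹ := by
        ext i j
        rw [Matrix.mul_diagonal]
        simp [hM, mul_comm]
      rw [e, Matrix.det_mul, Matrix.det_diagonal]
      exact mul_pos hdet (Finset.prod_pos fun j _ => inv_pos.2 (norm_pos_iff.2 (hne j)))
    rcases sq_eq_one_iff.1 h1 with h | h
    · exact h
    · linarith
  refine ⟨⟨M, Matrix.mem_specialOrthogonalGroup_iff.2
    ⟨(Matrix.mem_orthogonalGroup_iff' (Fin 3) ℝ).2 hMM, hMd⟩⟩, fun j => ?_⟩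
  ext i
  rw [rot_stdE]
  rfl

/-! ### Power sums -/

section PowerSum

variable {ι : Type*} [Fintype ι]

/-- Minus the sum of the `k`-th powers of the linear forms given by `w`. -/
def powerSeed (w : ι → E3) (k : ℕ) (x : E3) : ℝ := -∑ i, ⟪w i, x⟫ ^ k

theorem contDiff_powerSeed (w : ι → E3) (k : ℕ) : ContDiff ℝ ∞ (powerSeed w k) := by
  unfold powerSeed
  exact (ContDiff.sum fun i _ => (contDiff_const.inner ℝ contDiff_id).pow k).neg

theorem hasDerivAt_inner_line (v x W : E3) :
    HasDerivAt (fun t : ℝ => ⟪v, x + t • W⟫) ⟪v, W⟫ 0 := by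
  simp only [inner_add_right, inner_smul_right]
  simpa using ((hasDerivAt_id (0 : ℝ)).mul_const ⟪v, W⟫).const_add ⟪v, x⟫

theorem fderiv_powerSeed (w : ι → E3) (k : ℕ) (x W : E3) :
    fderiv ℝ (powerSeed w k) x W = -(k * ∑ i, ⟪w i, x⟫ ^ (k - 1) * ⟪w i, W⟫) := by
  refine fderiv_apply_of_hasDerivAt ((contDiff_powerSeed w k).differentiable (by simp) x) ?_
  have h := HasDerivAt.fun_sum (u := Finset.univ)
    fun i (_ : i ∈ Finset.univ) => (hasDerivAt_inner_line (w i) x W).pow k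
  refine h.neg.congr_deriv ?_
  simp [Finset.mul_sum, mul_assoc]

theorem hess_powerSeed (w : ι → E3) (k : ℕ) (p u v : E3) :
    hess (powerSeed w k) p u v =
      -(k * ((k - 1 : ℕ) * ∑ i, ⟪w i, p⟫ ^ (k - 2) * ⟪w i, u⟫ * ⟪w i, v⟫)) := by
  have hd := (contDiff_fderiv_apply (contDiff_powerSeed w k) v).differentiable (by simp) p
  refine fderiv_apply_of_hasDerivAt hd ?_
  simp only [fderiv_powerSeed]
  have h := HasDerivAt.fun_sum (u := Finset.univ) fun i (_ : i ∈ Finset.univ) =>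
    ((hasDerivAt_inner_line (w i) p u).pow (k - 1)).mul_const ⟪w i, v⟫
  refine ((h.const_mul (k : ℝ)).neg).congr_deriv ?_
  simp [Finset.mul_sum, mul_assoc, Nat.sub_sub]

/-- A normalized orthogonal triple is a Morse frame of a power sum if the second derivatives have
the right signs. -/
theorem isMorseFrame_powerSeed {w : ι → E3} {k : ℕ} (hk : 2 ≤ k) {i : Fin 3} {u : Fin 3 → E3}
    (hu : ∀ j, u j ≠ 0) {A : SO3} (hA : ∀ j, rot A (stdE j) = ‖u j‖⁻¹ • u j)
    (hcrit : IsTangentCritical (powerSeed w k) (rot A (stdE 2)))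
    (hoff : ∑ i, ⟪w i, u 2⟫ ^ (k - 2) * ⟪w i, u 0⟫ * ⟪w i, u 1⟫ = 0)
    (hX : sgnX i * ((k - 1 : ℕ) * (∑ i, ⟪w i, u 2⟫ ^ (k - 2) * ⟪w i, u 0⟫ * ⟪w i, u 0⟫) *
      ⟪u 2, u 2⟫ - (∑ i, ⟪w i, u 2⟫ ^ k) * ⟪u 0, u 0⟫) < 0)
    (hY : sgnY i * ((k - 1 : ℕ) * (∑ i, ⟪w i, u 2⟫ ^ (k - 2) * ⟪w i, u 1⟫ * ⟪w i, u 1⟫) *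
      ⟪u 2, u 2⟫ - (∑ i, ⟪w i, u 2⟫ ^ k) * ⟪u 1, u 1⟫) < 0) :
    IsMorseFrame i (powerSeed w k) A := by
  have hn : ∀ j, 0 < ‖u j‖ := fun j => norm_pos_iff.2 (hu j)
  have hk0 : (0 : ℝ) < k := by exact_mod_cast (by omega : 0 < k)
  have hh : ∀ j l, hess (powerSeed w k) (rot A (stdE 2)) (rot A (stdE j)) (rot A (stdE l)) =
      -(k * (k - 1 : ℕ) * ‖u 2‖⁻¹ ^ (k - 2) * ‖u j‖⁻¹ * ‖u l‖⁻¹ *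
        ∑ i, ⟪w i, u 2⟫ ^ (k - 2) * ⟪w i, u j⟫ * ⟪w i, u l⟫) := fun j l => by
    rw [hess_powerSeed]
    simp only [hA, inner_smul_right, mul_pow, Finset.mul_sum]
    congr 1
    refine Finset.sum_congr rfl fun i _ => ?_
    ring
  have hf : fderiv ℝ (powerSeed w k) (rot A (stdE 2)) (rot A (stdE 2)) =
      -(k * ‖u 2‖⁻¹ ^ (k - 2) * ‖u 2‖⁻¹ ^ 2 * ∑ i, ⟪w i, u 2⟫ ^ k) := by
    rw [fderiv_powerSeed]
    simp only [hA, inner_smul_right, mul_pow, Finset.mul_sum]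
    congr 1
    refine Finset.sum_congr rfl fun i _ => ?_
    obtain ⟨m, rfl⟩ := Nat.exists_eq_add_of_le' hk
    simp only [Nat.add_sub_cancel, show m + 2 - 1 = m + 1 by omega]
    ring
  have key : ∀ (s : ℝ) (j : Fin 3), s * ((k - 1 : ℕ) *
      (∑ i, ⟪w i, u 2⟫ ^ (k - 2) * ⟪w i, u j⟫ * ⟪w i, u j⟫) * ⟪u 2, u 2⟫ -
      (∑ i, ⟪w i, u 2⟫ ^ k) * ⟪u j, u j⟫) < 0 →
      0 < s * (hess (powerSeed w k) (rot A (stdE 2)) (rot A (stdE j)) (rot A (stdE j)) -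
        fderiv ℝ (powerSeed w k) (rot A (stdE 2)) (rot A (stdE 2))) := fun s j h => by
    rw [hh, hf]
    rw [real_inner_self_eq_norm_sq, real_inner_self_eq_norm_sq] at h
    have h2 := hn 2
    have hj := hn j
    -- All norms are collected in this positive factor, so the sign conditions in the hypotheses
    -- involve only the unnormalized vectors and no square roots.
    have hpos : 0 < k * ‖u 2‖⁻¹ ^ (k - 2) * ‖u 2‖⁻¹ ^ 2 * ‖u j‖⁻¹ ^ 2 := by positivity
    refine lt_of_lt_of_eq (mul_pos hpos (neg_pos.2 h)) ?_
    field_simp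
    ring
  exact ⟨hcrit, by rw [hh, hoff, mul_zero, neg_zero], key _ 0 hX, key _ 1 hY⟩

end PowerSum

/-! ### Polyhedra given by a list of vertices -/

section Polyhedron

variable {ι : Type*}

/-- The half-space `⟪a, ·⟫ ≤ c` contains the `w i`. -/
structure IsSupport (w : ι → E3) (a : E3) (c : ℝ) : Prop where
  pos : 0 < c
  le : ∀ i, ⟪a, w i⟫ ≤ c

/-- If both lay in the supporting plane, then `2 * c ≤ μ * (2 * c) < 2 * c`. Geometrically, the
midpoint of the two vertices is a shrunken midpoint of two others, hence on no supporting plane. -/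
theorem IsSupport.not_both {w : ι → E3} {a : E3} {c : ℝ} (h : IsSupport w a c) {i j k l : ι}
    {μ : ℝ} (h0 : 0 ≤ μ) (h1 : μ < 1) (hw : w i + w j = μ • (w k + w l)) (hi : ⟪a, w i⟫ = c) :
    ⟪a, w j⟫ ≠ c := fun hj => by
  have e : ⟪a, w i⟫ + ⟪a, w j⟫ = μ * (⟪a, w k⟫ + ⟪a, w l⟫) := by
    rw [← inner_add_right, hw, inner_smul_right, inner_add_right]
  rw [hi, hj] at e
  have := mul_le_mul_of_nonneg_left (add_le_add (h.le k) (h.le l)) h0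
  nlinarith [h.pos]

theorem IsSupport.ne_zero {w : ι → E3} {a : E3} {c : ℝ} (hs : IsSupport w a c) {i : ι}
    (hi : ⟪a, w i⟫ = c) : a ≠ 0 := by
  rintro rfl
  rw [inner_zero_left] at hi
  exact hs.pos.ne hi

open scoped Classical in
/-- The standard edge. -/
def stdEdge (w : ι → E3) (i₀ i₁ : ι) : Finset S2 := {sph (w i₀), sph (w i₁)}

open scoped Classical in
/-- The standard face, given by three of its vertices. -/
def stdFace (w : ι → E3) (i₀ i₁ i₂ : ι) : Finset S2 := {sph (w i₀), sph (w i₁), sph (w i₂)}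

/-- Representatives of the three orbits. -/
structure IsRepresentatives (w : ι → E3) (i₀ i₁ i₂ : ι) (u : Fin 3 → E3) : Prop where
  ne_zero : ∀ i, u i ≠ 0
  zero : u 0 = w i₀
  one : ∃ μ : ℝ, 0 < μ ∧ w i₀ + w i₁ = μ • u 1
  two : ∃ μ : ℝ, 0 < μ ∧ w i₀ + w i₁ + w i₂ = μ • u 2

variable [Fintype ι]

/-- `V` consists of the normalizations of the distinct vectors `w i` of common norm, which span and
add up to zero. -/
structure IsVertexList (w : ι → E3) (V : Set S2) : Prop where
  ne_zero : ∀ i, w i ≠ 0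
  norm_eq : ∀ i j, ‖w i‖ = ‖w j‖
  injective : Function.Injective w
  sum_eq_zero : ∑ i, w i = 0
  span : ∀ a : E3, (∀ i, ⟪a, w i⟫ = 0) → a = 0
  mem_iff : ∀ p, p ∈ V ↔ ∃ i, p = sph (w i)

/-! ### Vertex lists: symmetries and supporting planes -/

namespace IsVertexList

variable {w : ι → E3} {V : Set S2}

theorem sph_injective (hV : IsVertexList w V) {i j : ι} (h : sph (w i) = sph (w j)) : i = j := by
  have h' := congrArg (fun p : S2 => (p : E3)) h
  simp only [coe_sph (hV.ne_zero _), radial, hV.norm_eq i j] at h'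
  exact hV.injective (smul_right_injective _
    (inv_ne_zero (norm_ne_zero_iff.2 (hV.ne_zero j))) h')

/-- The group is defined through normalized vertices, but the common norm lets it permute the
vectors `w i` themselves. -/
theorem exists_rot_eq (hV : IsVertexList w V) {h : SO3} (hh : h ∈ polyhedral V) (i : ι) :
    ∃ j, rot h (w i) = w j := by
  have h1 : h • sph (w i) ∈ V := by
    rw [mem_iff_of_mem_polyhedral hh, inv_smul_smul]
    exact (hV.mem_iff _).2 ⟨i, rfl⟩
  obtain ⟨j, hj⟩ := (hV.mem_iff _).1 h1
  refine ⟨j, ?_⟩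
  have h' := congrArg (fun p : S2 => (p : E3)) hj
  simp only [coe_smul_sphere, coe_sph (hV.ne_zero _), radial, hV.norm_eq i j, map_smul] at h'
  exact smul_right_injective _ (inv_ne_zero (norm_ne_zero_iff.2 (hV.ne_zero j))) h'

theorem finite (hV : IsVertexList w V) : V.Finite := by
  refine (Set.finite_range fun i => sph (w i)).subset fun p hp => ?_
  obtain ⟨i, rfl⟩ := (hV.mem_iff p).1 hp
  exact ⟨i, rfl⟩

/-- As `V` is finite, mapping it into itself suffices. -/
theorem mem_polyhedral (hV : IsVertexList w V) {g : SO3} (h : ∀ i, ∃ j, rot g (w i) = w j) :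
    g ∈ polyhedral V := by
  open scoped Pointwise in
  rw [polyhedral, MulAction.mem_stabilizer_set_iff_smul_set_subset hV.finite]
  rintro _ ⟨p, hp, rfl⟩
  obtain ⟨i, rfl⟩ := (hV.mem_iff p).1 hp
  obtain ⟨j, hj⟩ := h i
  refine (hV.mem_iff _).2 ⟨j, ?_⟩
  rw [← hj, ← smul_sph (hV.ne_zero i)]

theorem powerSeed_rot (hV : IsVertexList w V) (k : ℕ) {h : SO3} (hh : h ∈ polyhedral V) (x : E3) :
    powerSeed w k (rot h x) = powerSeed w k x := by
  choose σ hσ using fun i => hV.exists_rot_eq ((polyhedral V).inv_mem hh) i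
  have hinj : Function.Injective σ := fun i j hij => hV.injective <|
    (rot h⁻¹).injective (by rw [hσ, hσ, hij])
  have hbij : Function.Bijective σ := Finite.injective_iff_bijective.1 hinj
  rw [powerSeed, powerSeed]
  congr 1
  rw [← Function.Bijective.sum_comp hbij fun i => ⟪w i, x⟫ ^ k]
  refine Finset.sum_congr rfl fun i _ => ?_
  rw [← hσ, inner_rot_left, inv_inv]

/-- The bound `c` is positive because the vertices add up to zero: otherwise all products are
nonpositive with zero sum, hence zero, and `a = 0` since the vertices span. -/
theorem exists_support (hV : IsVertexList w V) [Nonempty ι] {S : Finset S2} (hS : IsFace V S) :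
    ∃ a c, IsSupport w a c ∧ ∀ p, p ∈ S ↔ ∃ i, p = sph (w i) ∧ ⟪a, w i⟫ = c := by
  obtain ⟨a, c, ha, hle, hSc⟩ := hS
  obtain ⟨i₀⟩ := ‹Nonempty ι›
  set r := ‖w i₀‖ with hr
  have hr0 : 0 < r := norm_pos_iff.2 (hV.ne_zero _)
  have hin : ∀ i, ⟪a, w i⟫ = r * ⟪a, (sph (w i) : E3)⟫ := fun i => by
    rw [coe_sph (hV.ne_zero i), radial, hV.norm_eq i i₀, inner_smul_right, ← mul_assoc,
      mul_inv_cancel₀ hr0.ne', one_mul]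
  have hle' : ∀ i, ⟪a, w i⟫ ≤ r * c := fun i => by
    rw [hin]
    exact mul_le_mul_of_nonneg_left (hle _ ((hV.mem_iff _).2 ⟨i, rfl⟩)) hr0.le
  have hsum : ∑ i, ⟪a, w i⟫ = 0 := by rw [← inner_sum, hV.sum_eq_zero, inner_zero_right]
  have hmem : ∀ p, p ∈ S ↔ ∃ i, p = sph (w i) ∧ ⟪a, w i⟫ = r * c := fun p => by
    rw [← Finset.mem_coe, hSc]
    constructor
    · rintro ⟨hp, hc⟩
      obtain ⟨i, rfl⟩ := (hV.mem_iff p).1 hp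
      exact ⟨i, rfl, by rw [hin, hc]⟩
    · rintro ⟨i, rfl, hi⟩
      rw [hin] at hi
      exact ⟨(hV.mem_iff _).2 ⟨i, rfl⟩, mul_left_cancel₀ hr0.ne' hi⟩
  refine ⟨a, r * c, ⟨?_, hle'⟩, hmem⟩
  by_contra hc
  refine ha (hV.span a fun i => ?_)
  have hnonpos : ∀ i, ⟪a, w i⟫ ≤ 0 := fun i => (hle' i).trans (not_lt.1 hc)
  exact (Finset.sum_eq_zero_iff_of_nonpos fun i _ => hnonpos i).1 hsum i (Finset.mem_univ i)

end IsVertexList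

/-- Combinatorial data of a regular polyhedron: a vertex `w i₀`, a rotation `R` that fixes it, and
its neighbours `w i₁`, `w i₂ = R w i₁` and `w i₃ = R⁻¹ w i₁`. -/
structure IsRegularList (w : ι → E3) (V : Set S2) (R : SO3) (i₀ i₁ i₂ i₃ : ι) : Prop extends
    IsVertexList w V where
  mem_R : R ∈ polyhedral V
  rot_zero : rot R (w i₀) = w i₀
  rot_one : rot R (w i₁) = w i₂
  rot_three : rot R (w i₃) = w i₁
  ne_zero_one : i₀ ≠ i₁
  ne_zero_two : i₀ ≠ i₂
  ne_one_two : i₁ ≠ i₂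
  transitive : ∀ i, ∃ h ∈ polyhedral V, rot h (w i₀) = w i
  neighbor : ∀ a c, IsSupport w a c → ⟪a, w i₀⟫ = c → ∀ i, ⟪a, w i⟫ = c →
    i = i₀ ∨ ∃ m : ℕ, rot (R ^ m) (w i₁) = w i
  common : ∀ a c, IsSupport w a c → ⟪a, w i₀⟫ = c → ⟪a, w i₁⟫ = c → ∀ i, ⟪a, w i⟫ = c →
    i = i₀ ∨ i = i₁ ∨ i = i₂ ∨ i = i₃
  not_both : ∀ a c, IsSupport w a c → ⟪a, w i₀⟫ = c → ⟪a, w i₁⟫ = c → ⟪a, w i₂⟫ = c →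
    ⟪a, w i₃⟫ ≠ c
  edge : ∃ a c, IsSupport w a c ∧ ∀ i, ⟪a, w i⟫ = c ↔ i = i₀ ∨ i = i₁
  face : ∃ a c, IsSupport w a c ∧ ∀ i, ⟪a, w i⟫ = c ↔ i = i₀ ∨ i = i₁ ∨ i = i₂

/-! ### Orbits of vertices, edges and two-dimensional faces -/

namespace IsRegularList

variable {w : ι → E3} {V : Set S2} {R : SO3} {i₀ i₁ i₂ i₃ : ι}

theorem face_move {h : SO3} (hh : h ∈ polyhedral V) {S : Finset S2} (hS : IsFace V S) :
    IsFace V (moveFinset h S) :=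
  hS.move (mem_iff_of_mem_polyhedral hh)

/-- A vertex of the face can be moved to the standard one, then, by a power of `R`, a second vertex
to the standard neighbour. By `common` and `not_both` at most one further vertex remains, on one
side of this edge. So every face with at least two vertices is a standard edge or triangle up to the
group; triangularity is a result here, not an assumption. -/
theorem exists_move_eq (hw : IsRegularList w V R i₀ i₁ i₂ i₃) {S : Finset S2} (hS : IsFace V S)
    (hc : 2 ≤ S.card) : ∃ h ∈ polyhedral V,
      moveFinset h S = stdEdge w i₀ i₁ ∨ moveFinset h S = stdFace w i₀ i₁ i₂ := by
  have : Nonempty ι := ⟨i₀⟩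
  have hV := hw.toIsVertexList
  have hfixR : R • sph (w i₀) = sph (w i₀) := by rw [smul_sph (hV.ne_zero _), hw.rot_zero]
  have hfix : ∀ m : ℕ, R ^ m • sph (w i₀) = sph (w i₀) := fun m => by
    induction m with
    | zero => rw [pow_zero, one_smul]
    | succ m ih => rw [pow_succ, mul_smul, hfixR, ih]
  have hR1 : R • sph (w i₁) = sph (w i₂) := by rw [smul_sph (hV.ne_zero _), hw.rot_one]
  have hR3 : R • sph (w i₃) = sph (w i₁) := by rw [smul_sph (hV.ne_zero _), hw.rot_three]
  have memT : ∀ {T : Finset S2} {a c}, (∀ p, p ∈ T ↔ ∃ i, p = sph (w i) ∧ ⟪a, w i⟫ = c) →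
      ∀ i, sph (w i) ∈ T ↔ ⟪a, w i⟫ = c := fun hT i => by
    rw [hT]
    constructor
    · rintro ⟨j, hj, hj'⟩
      rwa [hV.sph_injective hj]
    · intro h
      exact ⟨i, rfl, h⟩
  -- move a vertex of the face to the standard vertex
  have step1 : ∃ h ∈ polyhedral V, sph (w i₀) ∈ moveFinset h S := by
    obtain ⟨p, hp⟩ := Finset.card_pos.1 (by omega : 0 < S.card)
    obtain ⟨a, c, -, hmem⟩ := hV.exists_support hS
    obtain ⟨i, rfl, -⟩ := (hmem p).1 hp
    obtain ⟨h, hh, hi⟩ := hw.transitive i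
    refine ⟨h⁻¹, (polyhedral V).inv_mem hh, ?_⟩
    rwa [mem_moveFinset, inv_inv, smul_sph (hV.ne_zero _), hi]
  obtain ⟨h, hh, h0⟩ := step1
  have hmul : ∀ g g' : SO3, ∀ T, moveFinset g (moveFinset g' T) = moveFinset (g * g') T :=
    fun g g' T => by
      ext p
      rw [mem_moveFinset, mem_moveFinset, mem_moveFinset, mul_inv_rev, mul_smul]
  -- move a second vertex of the face to the standard neighbour
  have step2 : ∃ h ∈ polyhedral V, sph (w i₀) ∈ moveFinset h S ∧ sph (w i₁) ∈ moveFinset h S := by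
    have hcard : 1 < (moveFinset h S).card := by rw [card_moveFinset]; omega
    obtain ⟨p, hp, hp0⟩ := Finset.exists_mem_ne hcard (sph (w i₀))
    obtain ⟨a, c, hs, hmem⟩ := hV.exists_support (face_move hh hS)
    obtain ⟨i, rfl, hi⟩ := (hmem p).1 hp
    rcases hw.neighbor a c hs ((memT hmem _).1 h0) i hi with rfl | ⟨m, hm⟩
    · exact absurd rfl hp0
    · refine ⟨(R ^ m)⁻¹ * h, (polyhedral V).mul_mem
        ((polyhedral V).inv_mem ((polyhedral V).pow_mem hw.mem_R m)) hh, ?_, ?_⟩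
      · rwa [← hmul, mem_moveFinset, inv_inv, hfix]
      · rwa [← hmul, mem_moveFinset, inv_inv, smul_sph (hV.ne_zero _), hm]
  obtain ⟨h, hh, h0, h1⟩ := step2
  have hsub : ∀ g ∈ polyhedral V, sph (w i₀) ∈ moveFinset g S → sph (w i₁) ∈ moveFinset g S →
      (∀ p ∈ moveFinset g S, p = sph (w i₀) ∨ p = sph (w i₁) ∨ p = sph (w i₂) ∨ p = sph (w i₃)) ∧
      (sph (w i₂) ∈ moveFinset g S → sph (w i₃) ∉ moveFinset g S) := by
    intro g hg g0 g1
    obtain ⟨a, c, hs, hmem⟩ := hV.exists_support (face_move hg hS)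
    refine ⟨fun p hp => ?_, fun g2 g3 => ?_⟩
    · obtain ⟨i, rfl, hi⟩ := (hmem p).1 hp
      rcases hw.common a c hs ((memT hmem _).1 g0) ((memT hmem _).1 g1) i hi with
        rfl | rfl | rfl | rfl <;> simp
    · exact hw.not_both a c hs ((memT hmem _).1 g0) ((memT hmem _).1 g1) ((memT hmem _).1 g2)
        ((memT hmem _).1 g3)
  have hface : ∀ g ∈ polyhedral V, sph (w i₀) ∈ moveFinset g S → sph (w i₁) ∈ moveFinset g S →
      sph (w i₂) ∈ moveFinset g S → moveFinset g S = stdFace w i₀ i₁ i₂ := by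
    intro g hg g0 g1 g2
    obtain ⟨hs, hn⟩ := hsub g hg g0 g1
    ext p
    simp only [stdFace, Finset.mem_insert, Finset.mem_singleton]
    constructor
    · intro hp
      rcases hs p hp with rfl | rfl | rfl | rfl
      · simp
      · simp
      · simp
      · exact absurd hp (hn g2)
    · rintro (rfl | rfl | rfl) <;> assumption
  -- If the third vertex is on the other side, `R` turns the pair `w i₃`, `w i₁` into `w i₁`, `w i₂`
  -- and the triangle becomes the standard one.
  by_cases h3 : sph (w i₃) ∈ moveFinset h S
  · refine ⟨R * h, (polyhedral V).mul_mem hw.mem_R hh, Or.inr (hface _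
      ((polyhedral V).mul_mem hw.mem_R hh) ?_ ?_ ?_)⟩
    · rwa [← hmul, mem_moveFinset, ← hfixR, inv_smul_smul]
    · rwa [← hmul, mem_moveFinset, ← hR3, inv_smul_smul]
    · rwa [← hmul, mem_moveFinset, ← hR1, inv_smul_smul]
  · by_cases h2 : sph (w i₂) ∈ moveFinset h S
    · exact ⟨h, hh, Or.inr (hface h hh h0 h1 h2)⟩
    · refine ⟨h, hh, Or.inl ?_⟩
      ext p
      simp only [stdEdge, Finset.mem_insert, Finset.mem_singleton]
      constructor
      · intro hp
        rcases (hsub h hh h0 h1).1 p hp with rfl | rfl | rfl | rfl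
        · simp
        · simp
        · exact absurd hp h2
        · exact absurd hp h3
      · rintro (rfl | rfl) <;> assumption

theorem card_stdEdge (hw : IsRegularList w V R i₀ i₁ i₂ i₃) : (stdEdge w i₀ i₁).card = 2 :=
  Finset.card_pair fun h => hw.ne_zero_one (hw.sph_injective h)

theorem card_stdFace (hw : IsRegularList w V R i₀ i₁ i₂ i₃) : (stdFace w i₀ i₁ i₂).card = 3 :=
  Finset.card_eq_three.2 ⟨_, _, _, fun h => hw.ne_zero_one (hw.sph_injective h),
    fun h => hw.ne_zero_two (hw.sph_injective h), fun h => hw.ne_one_two (hw.sph_injective h), rfl⟩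

theorem radial_barycenter_stdEdge (hw : IsRegularList w V R i₀ i₁ i₂ i₃) :
    radial (barycenter (stdEdge w i₀ i₁)) = radial (w i₀ + w i₁) := by
  have hr : 0 < ‖w i₀‖ := norm_pos_iff.2 (hw.ne_zero _)
  have radial_eq : ∀ i, radial (w i) = ‖w i₀‖⁻¹ • w i := fun i => by rw [radial, hw.norm_eq i i₀]
  rw [barycenter, radial_smul (inv_pos.2 (by rw [hw.card_stdEdge]; norm_num)), stdEdge,
    Finset.sum_pair fun h => hw.ne_zero_one (hw.sph_injective h), coe_sph (hw.ne_zero _),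
    coe_sph (hw.ne_zero _), radial_eq i₀, radial_eq i₁, ← smul_add, radial_smul (inv_pos.2 hr)]

theorem radial_barycenter_stdFace (hw : IsRegularList w V R i₀ i₁ i₂ i₃) :
    radial (barycenter (stdFace w i₀ i₁ i₂)) = radial (w i₀ + w i₁ + w i₂) := by
  have hr : 0 < ‖w i₀‖ := norm_pos_iff.2 (hw.ne_zero _)
  have radial_eq : ∀ i, radial (w i) = ‖w i₀‖⁻¹ • w i := fun i => by rw [radial, hw.norm_eq i i₀]
  have h1 : sph (w i₀) ∉ stdEdge w i₁ i₂ := by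
    simp only [stdEdge, Finset.mem_insert, Finset.mem_singleton, not_or]
    exact ⟨fun h => hw.ne_zero_one (hw.sph_injective h),
      fun h => hw.ne_zero_two (hw.sph_injective h)⟩
  rw [barycenter, radial_smul (inv_pos.2 (by rw [hw.card_stdFace]; norm_num)), stdFace]
  rw [stdEdge] at h1
  rw [Finset.sum_insert h1, Finset.sum_pair fun h => hw.ne_one_two (hw.sph_injective h),
    coe_sph (hw.ne_zero _), coe_sph (hw.ne_zero _), coe_sph (hw.ne_zero _), radial_eq i₀,
    radial_eq i₁, radial_eq i₂, ← smul_add, ← smul_add, radial_smul (inv_pos.2 hr),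
    add_assoc]

theorem isFace_of_support (hw : IsRegularList w V R i₀ i₁ i₂ i₃) {S : Finset S2} {a : E3} {c : ℝ}
    (hs : IsSupport w a c) (hS : ∀ p, p ∈ S ↔ ∃ i, p = sph (w i) ∧ ⟪a, w i⟫ = c) (hne : a ≠ 0) :
    IsFace V S := by
  have hr : 0 < ‖w i₀‖ := norm_pos_iff.2 (hw.ne_zero _)
  have hin : ∀ i, ⟪a, (sph (w i) : E3)⟫ = ‖w i₀‖⁻¹ * ⟪a, w i⟫ := fun i => by
    rw [coe_sph (hw.ne_zero i), radial, hw.norm_eq i i₀, inner_smul_right]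
  refine ⟨a, ‖w i₀‖⁻¹ * c, hne, fun v hv => ?_, ?_⟩
  · obtain ⟨i, rfl⟩ := (hw.mem_iff v).1 hv
    rw [hin]
    exact mul_le_mul_of_nonneg_left (hs.le i) (inv_nonneg.2 hr.le)
  · ext p
    rw [Finset.mem_coe, hS]
    constructor
    · rintro ⟨i, rfl, hi⟩
      exact ⟨(hw.mem_iff _).2 ⟨i, rfl⟩, by rw [hin, hi]⟩
    · rintro ⟨hp, hc⟩
      obtain ⟨i, rfl⟩ := (hw.mem_iff p).1 hp
      rw [hin] at hc
      exact ⟨i, rfl, mul_left_cancel₀ (inv_ne_zero hr.ne') hc⟩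

theorem isFace_stdEdge (hw : IsRegularList w V R i₀ i₁ i₂ i₃) : IsFace V (stdEdge w i₀ i₁) := by
  obtain ⟨a, c, hs, h⟩ := hw.edge
  refine hw.isFace_of_support hs (fun p => ?_) (hs.ne_zero ((h i₀).2 (Or.inl rfl)))
  simp only [stdEdge, Finset.mem_insert, Finset.mem_singleton, h]
  constructor
  · rintro (rfl | rfl)
    exacts [⟨_, rfl, Or.inl rfl⟩, ⟨_, rfl, Or.inr rfl⟩]
  · rintro ⟨i, rfl, rfl | rfl⟩ <;> simp

theorem isFace_stdFace (hw : IsRegularList w V R i₀ i₁ i₂ i₃) :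
    IsFace V (stdFace w i₀ i₁ i₂) := by
  obtain ⟨a, c, hs, h⟩ := hw.face
  refine hw.isFace_of_support hs (fun p => ?_) (hs.ne_zero ((h i₀).2 (Or.inl rfl)))
  simp only [stdFace, Finset.mem_insert, Finset.mem_singleton, h]
  constructor
  · rintro (rfl | rfl | rfl)
    exacts [⟨_, rfl, Or.inl rfl⟩, ⟨_, rfl, Or.inr (Or.inl rfl)⟩, ⟨_, rfl, Or.inr (Or.inr rfl)⟩]
  · rintro ⟨i, rfl, rfl | rfl | rfl⟩ <;> simp

theorem mem_polyhedralPoints (hw : IsRegularList w V R i₀ i₁ i₂ i₃) {u : Fin 3 → E3}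
    (hu : IsRepresentatives w i₀ i₁ i₂ u) (i : Fin 3) : sph (u i) ∈ polyhedralPoints V i := by
  fin_cases i
  · exact (hw.mem_iff _).2 ⟨i₀, by rw [← hu.zero]; rfl⟩
  · obtain ⟨μ, hμ, h⟩ := hu.one
    refine ⟨_, hw.isFace_stdEdge, hw.card_stdEdge, ?_⟩
    rw [hw.radial_barycenter_stdEdge, h, radial_smul hμ]
    exact coe_sph (hu.ne_zero 1)
  · obtain ⟨μ, hμ, h⟩ := hu.two
    refine ⟨_, hw.isFace_stdFace, hw.card_stdFace.ge, ?_⟩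
    rw [hw.radial_barycenter_stdFace, h, radial_smul hμ]
    exact coe_sph (hu.ne_zero 2)

/-- Cardinality separates the two standard faces, 2 for the edge and 3 for the triangle, so each of
the three sets is one orbit. -/
theorem exists_smul_eq (hw : IsRegularList w V R i₀ i₁ i₂ i₃) {u : Fin 3 → E3}
    (hu : IsRepresentatives w i₀ i₁ i₂ u) (i : Fin 3) {q : S2} (hq : q ∈ polyhedralPoints V i) :
    ∃ h ∈ polyhedral V, h • sph (u i) = q := by
  have key : ∀ {S : Finset S2} {h : SO3} {T : Finset S2} {j : Fin 3}, h ∈ polyhedral V →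
      moveFinset h S = T → (q : E3) = radial (barycenter S) →
      radial (barycenter T) = radial (u j) → ∃ h ∈ polyhedral V, h • sph (u j) = q := by
    intro S h T j hh hT hqS hr
    refine ⟨h⁻¹, (polyhedral V).inv_mem hh, ?_⟩
    rw [inv_smul_eq_iff]
    apply Subtype.ext
    rw [coe_sph (hu.ne_zero j), coe_smul_sphere, hqS, ← radial_rot, ← barycenter_moveFinset, hT, hr]
  fin_cases i
  · obtain ⟨i, rfl⟩ := (hw.mem_iff q).1 hq
    obtain ⟨h, hh, hi⟩ := hw.transitive i
    refine ⟨h, hh, ?_⟩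
    change h • sph (u 0) = _
    rw [hu.zero, smul_sph (hw.ne_zero _), hi]
  · obtain ⟨S, hS, hc, hqS⟩ := hq
    obtain ⟨h, hh, hT | hT⟩ := hw.exists_move_eq hS hc.ge
    · obtain ⟨μ, hμ, h1⟩ := hu.one
      exact key hh hT hqS (by rw [hw.radial_barycenter_stdEdge, h1, radial_smul hμ]; rfl)
    · have := card_moveFinset h S
      rw [hT, hw.card_stdFace, hc] at this
      omega
  · obtain ⟨S, hS, hc, hqS⟩ := hq
    obtain ⟨h, hh, hT | hT⟩ := hw.exists_move_eq hS (by omega)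
    · have := card_moveFinset h S
      rw [hT, hw.card_stdEdge] at this
      omega
    · obtain ⟨μ, hμ, h1⟩ := hu.two
      exact key hh hT hqS (by rw [hw.radial_barycenter_stdFace, h1, radial_smul hμ]; rfl)

theorem finite_polyhedralPoints (hV : V.Finite) (i : Fin 3) : (polyhedralPoints V i).Finite := by
  have hfin : {S : Finset S2 | (S : Set S2) ⊆ V}.Finite :=
    Set.Finite.preimage Finset.coe_injective.injOn hV.finite_subsets
  have key : ∀ P : Finset S2 → Prop, {p : S2 | ∃ S : Finset S2, IsFace V S ∧ P S ∧
      (p : E3) = radial (barycenter S)}.Finite := fun P => by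
    refine Set.Finite.subset ((hfin.image fun S => radial (barycenter S)).preimage
      Subtype.val_injective.injOn) ?_
    rintro p ⟨S, ⟨a, c, -, -, hS⟩, -, hp⟩
    refine ⟨S, ?_, hp.symm⟩
    rw [Set.mem_ofPred_eq, hS]
    exact fun v hv => hv.1
  fin_cases i
  · exact hV
  · exact key _
  · exact key _

/-- The Morse seed of a regular polyhedron, from explicit frames and critical points. -/
theorem hasMorseModel (hw : IsRegularList w V R i₀ i₁ i₂ i₃) {k : ℕ} (hk : 2 ≤ k)
    {u : Fin 3 → Fin 3 → E3} (hu : IsRepresentatives w i₀ i₁ i₂ fun i => u i 2)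
    (horth : ∀ i j l, j ≠ l → ⟪u i j, u i l⟫ = 0)
    (hdet : ∀ i, 0 < (Matrix.of fun j l => u i l j).det)
    (hfix : ∀ i, ∃ h ∈ polyhedral V, h ≠ 1 ∧ rot h (u i 2) = u i 2)
    (hoff : ∀ i, ∑ j, ⟪w j, u i 2⟫ ^ (k - 2) * ⟪w j, u i 0⟫ * ⟪w j, u i 1⟫ = 0)
    (hX : ∀ i, sgnX i *
      ((k - 1 : ℕ) * (∑ j, ⟪w j, u i 2⟫ ^ (k - 2) * ⟪w j, u i 0⟫ * ⟪w j, u i 0⟫) *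
        ⟪u i 2, u i 2⟫ - (∑ j, ⟪w j, u i 2⟫ ^ k) * ⟪u i 0, u i 0⟫) < 0)
    (hY : ∀ i, sgnY i *
      ((k - 1 : ℕ) * (∑ j, ⟪w j, u i 2⟫ ^ (k - 2) * ⟪w j, u i 1⟫ * ⟪w j, u i 1⟫) *
        ⟪u i 2, u i 2⟫ - (∑ j, ⟪w j, u i 2⟫ ^ k) * ⟪u i 1, u i 1⟫) < 0)
    (hlt1 : powerSeed w k (sph (u 0 2)) < powerSeed w k (sph (u 1 2)))
    (hlt2 : powerSeed w k (sph (u 1 2)) < powerSeed w k (sph (u 2 2)))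
    (hcrit : ∀ q : S2, IsTangentCritical (powerSeed w k) q →
      ∃ i, ∃ h ∈ polyhedral V, q = sph (rot h (u i 2))) :
    HasMorseModel (polyhedral V) (polyhedralPoints V) := by
  choose A hA using fun i => exists_rotation_of_orthogonal (u i) (horth i) (hdet i)
  have hne : ∀ i j, u i j ≠ 0 := fun i j h0 => by
    refine (hdet i).ne' (Matrix.det_eq_zero_of_column_eq_zero j fun l => ?_)
    simp [h0]
  have hAN : ∀ i, A i • northPole = sph (u i 2) := fun i => by
    apply Subtype.ext
    rw [coe_smul_sphere, coe_northPole, hA, coe_sph (hne i 2)]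
    rfl
  have hfixed : ∀ i, sph (u i 2) ∈ fixedSet (polyhedral V) := fun i => by
    obtain ⟨h, hh, h1, h2⟩ := hfix i
    exact ⟨h, hh, h1, by rw [smul_sph (hne i 2), h2]⟩
  have hinv : ∀ h ∈ polyhedral V, ∀ x, powerSeed w k (rot h x) = powerSeed w k x :=
    fun h hh x => hw.powerSeed_rot k hh x
  refine IsMorseSeed.hasMorseModel (F := powerSeed w k) (A := A) ⟨contDiff_powerSeed w k, hinv,
    fun i q hq => ?_, fun i => finite_polyhedralPoints hw.finite i, fun i => ?_, fun i => ?_,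
    by rwa [hAN, hAN], by rwa [hAN, hAN], fun q hq => ?_⟩
  · rw [hAN]
    exact hw.exists_smul_eq hu i hq
  · rw [hAN]
    exact hfixed i
  · refine isMorseFrame_powerSeed hk (hne i) (hA i) ?_ (hoff i) (hX i) (hY i)
    obtain ⟨h, hh, h1, h2⟩ := hfixed i
    have := isTangentCritical_of_fixed (hinv h hh) h1 h2
    rwa [← hAN, coe_smul_sphere, coe_northPole] at this
  · obtain ⟨i, h, hh, rfl⟩ := hcrit q hq
    rw [← smul_sph (hne i 2)]
    exact Set.mem_iUnion.2 ⟨i, mem_polyhedralPoints_of_move (mem_iff_of_mem_polyhedral hh)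
      (hw.mem_polyhedralPoints hu i)⟩

end IsRegularList

end Polyhedron

/-! ### Symmetries common to the three polyhedra -/

theorem inner_vec (a b c : ℝ) (x : E3) : ⟪(!₂[a, b, c] : E3), x⟫ = a * x 0 + b * x 1 + c * x 2 := by
  rw [inner_eq_coord]
  simp

theorem inner_vec_vec (a b c a' b' c' : ℝ) :
    ⟪(!₂[a, b, c] : E3), !₂[a', b', c']⟫ = a * a' + b * b' + c * c' :=
  inner_vec a b c _

theorem norm_sq_vec (a b c : ℝ) : ‖(!₂[a, b, c] : E3)‖ ^ 2 = a ^ 2 + b ^ 2 + c ^ 2 := by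
  rw [norm_sq_coord]
  simp

theorem vec_eq_coord (x : E3) : x = !₂[x 0, x 1, x 2] := by
  ext i
  fin_cases i <;> rfl

theorem vec_ne_zero {a b c : ℝ} (h : a ≠ 0 ∨ b ≠ 0 ∨ c ≠ 0) : (!₂[a, b, c] : E3) ≠ 0 := by
  intro h0
  have e : ∀ i, (!₂[a, b, c] : E3) i = 0 := fun i => by rw [h0]; rfl
  have h1 : a = 0 := e 0
  have h2 : b = 0 := e 1
  have h3 : c = 0 := e 2
  tauto

theorem coe_sphere_ne_zero (q : S2) : (q : E3) ≠ 0 := fun h => by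
  have := mem_sphere_zero_iff_norm.1 q.2
  rw [h, norm_zero] at this
  exact zero_ne_one this

/-- The half turn about the first coordinate axis. -/
def halfTurnX : SO3 :=
  ⟨!![1, 0, 0; 0, -1, 0; 0, 0, -1], by
    rw [Matrix.mem_specialOrthogonalGroup_iff, Matrix.mem_orthogonalGroup_iff]
    constructor
    · ext i j
      fin_cases i <;> fin_cases j <;> simp [Matrix.mul_apply, Fin.sum_univ_three]
    · simp [Matrix.det_fin_three]⟩

/-- The half turn about the third coordinate axis. -/
def halfTurnZ : SO3 :=
  ⟨!![-1, 0, 0; 0, -1, 0; 0, 0, 1], by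
    rw [Matrix.mem_specialOrthogonalGroup_iff, Matrix.mem_orthogonalGroup_iff]
    constructor
    · ext i j
      fin_cases i <;> fin_cases j <;> simp [Matrix.mul_apply, Fin.sum_univ_three]
    · simp [Matrix.det_fin_three]⟩

/-- The cyclic permutation of the coordinates. -/
def cyclicTurn : SO3 :=
  ⟨!![0, 0, 1; 1, 0, 0; 0, 1, 0], by
    rw [Matrix.mem_specialOrthogonalGroup_iff, Matrix.mem_orthogonalGroup_iff]
    constructor
    · ext i j
      fin_cases i <;> fin_cases j <;> simp [Matrix.mul_apply, Fin.sum_univ_three]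
    · simp [Matrix.det_fin_three]⟩

theorem rot_halfTurnX (a b c : ℝ) : rot halfTurnX !₂[a, b, c] = !₂[a, -b, -c] := by
  ext i
  rw [rot_apply_coord]
  fin_cases i <;> simp [halfTurnX]

theorem rot_halfTurnZ (a b c : ℝ) : rot halfTurnZ !₂[a, b, c] = !₂[-a, -b, c] := by
  ext i
  rw [rot_apply_coord]
  fin_cases i <;> simp [halfTurnZ]

theorem rot_cyclicTurn (a b c : ℝ) : rot cyclicTurn !₂[a, b, c] = !₂[c, a, b] := by
  ext i
  rw [rot_apply_coord]
  fin_cases i <;> simp [cyclicTurn]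

theorem ne_one_of_rot_ne {h : SO3} {x : E3} (hx : rot h x ≠ x) : h ≠ 1 := by
  rintro rfl
  exact hx (rot_one x)

theorem halfTurnX_ne_one : halfTurnX ≠ 1 := by
  refine ne_one_of_rot_ne (x := !₂[0, 1, 0]) fun h => ?_
  rw [rot_halfTurnX] at h
  have : (-1 : ℝ) = 1 := congrArg (fun x : E3 => x 1) h
  norm_num at this

theorem halfTurnZ_ne_one : halfTurnZ ≠ 1 := by
  refine ne_one_of_rot_ne (x := !₂[0, 1, 0]) fun h => ?_
  rw [rot_halfTurnZ] at h
  have : (-1 : ℝ) = 1 := congrArg (fun x : E3 => x 1) h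
  norm_num at this

theorem cyclicTurn_ne_one : cyclicTurn ≠ 1 := by
  refine ne_one_of_rot_ne (x := !₂[1, 0, 0]) fun h => ?_
  rw [rot_cyclicTurn] at h
  have : (1 : ℝ) = 0 := congrArg (fun x : E3 => x 1) h
  norm_num at this

/-- A property that is invariant under the half turns about the axes can be checked for the absolute
values of the coordinates, up to one sign. -/
theorem of_abs_coord {Q : E3 → Prop} (hX : ∀ x, Q (rot halfTurnX x) → Q x)
    (hZ : ∀ x, Q (rot halfTurnZ x) → Q x) (x : E3)
    (h1 : 0 ≤ x 0 * x 1 * x 2 → Q !₂[|x 0|, |x 1|, |x 2|])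
    (h2 : x 0 * x 1 * x 2 < 0 → Q !₂[|x 0|, |x 1|, -|x 2|]) : Q x := by
  have hX' : ∀ a b c, Q !₂[a, -b, -c] → Q !₂[a, b, c] := fun a b c h =>
    hX _ (by rwa [rot_halfTurnX])
  have hZ' : ∀ a b c, Q !₂[-a, -b, c] → Q !₂[a, b, c] := fun a b c h =>
    hZ _ (by rwa [rot_halfTurnZ])
  have hY' : ∀ a b c, Q !₂[-a, b, -c] → Q !₂[a, b, c] := fun a b c h =>
    hX' _ _ _ (hZ' _ _ _ (by rwa [neg_neg]))
  rw [vec_eq_coord x]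
  generalize x 0 = a at *
  generalize x 1 = b at *
  generalize x 2 = c at *
  rcases lt_or_ge (a * b * c) 0 with h | h
  · have h2 := h2 h
    rcases abs_cases a with ⟨ha, ha'⟩ | ⟨ha, ha'⟩ <;>
      rcases abs_cases b with ⟨hb, hb'⟩ | ⟨hb, hb'⟩ <;>
      rcases abs_cases c with ⟨hc, hc'⟩ | ⟨hc, hc'⟩ <;> rw [ha, hb, hc] at h2
    · exact absurd h (not_lt.2 (by positivity))
    · simpa using h2
    · exact hX' _ _ _ h2
    · exact absurd h (not_lt.2 (mul_nonneg_of_nonpos_of_nonpos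
        (mul_nonpos_of_nonneg_of_nonpos ha' hb'.le) hc'.le))
    · exact hY' _ _ _ h2
    · exact absurd h (not_lt.2 (mul_nonneg_of_nonpos_of_nonpos
        (mul_nonpos_of_nonpos_of_nonneg ha'.le hb') hc'.le))
    · exact absurd h (not_lt.2 (mul_nonneg (mul_nonneg_of_nonpos_of_nonpos ha'.le hb'.le) hc'))
    · exact hZ' _ _ _ (by simpa using h2)
  · have h1 := h1 h
    rcases abs_cases a with ⟨ha, ha'⟩ | ⟨ha, ha'⟩ <;>
      rcases abs_cases b with ⟨hb, hb'⟩ | ⟨hb, hb'⟩ <;>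
      rcases abs_cases c with ⟨hc, hc'⟩ | ⟨hc, hc'⟩ <;> rw [ha, hb, hc] at h1
    · exact h1
    -- One negative coordinate and a nonnegative product force another coordinate to vanish; its
    -- sign is free, so it can be flipped together with the negative one.
    · have : a * b = 0 := by nlinarith [mul_nonneg ha' hb']
      rcases mul_eq_zero.1 this with rfl | rfl
      · exact hY' _ _ _ (by simpa using h1)
      · exact hX' _ _ _ (by simpa using h1)
    · have : a * c = 0 := by nlinarith [mul_nonneg ha' hc']
      rcases mul_eq_zero.1 this with rfl | rfl
      · exact hZ' _ _ _ (by simpa using h1)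
      · exact hX' _ _ _ (by simpa using h1)
    · exact hX' _ _ _ h1
    · have : b * c = 0 := by nlinarith [mul_nonneg hb' hc']
      rcases mul_eq_zero.1 this with rfl | rfl
      · exact hZ' _ _ _ (by simpa using h1)
      · exact hY' _ _ _ (by simpa using h1)
    · exact hY' _ _ _ h1
    · exact hZ' _ _ _ h1
    · exact absurd h (not_le.2 (mul_neg_of_pos_of_neg (mul_pos_of_neg_of_neg ha' hb') hc'))

/-- The ray of `x` is in the orbit of the ray of `p`. -/
def InOrbit (V : Set S2) (p x : E3) : Prop := ∃ h ∈ polyhedral V, ∃ c : ℝ, 0 < c ∧ x = c • rot h p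

theorem InOrbit.of_rot {V : Set S2} {p x : E3} {g : SO3} (hg : g ∈ polyhedral V)
    (h : InOrbit V p (rot g x)) : InOrbit V p x := by
  obtain ⟨h, hh, c, hc, he⟩ := h
  refine ⟨g⁻¹ * h, (polyhedral V).mul_mem ((polyhedral V).inv_mem hg) hh, c, hc, ?_⟩
  rw [rot_mul, ← map_smul, ← he, rot_inv_rot]

theorem inOrbit_smul {V : Set S2} {p x : E3} {c : ℝ} (hc : 0 < c) (h : x = c • p) :
    InOrbit V p x :=
  ⟨1, (polyhedral V).one_mem, c, hc, by rw [rot_one, h]⟩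

theorem InOrbit.eq_sph {V : Set S2} {p : E3} {q : S2} (h : InOrbit V p q) :
    ∃ h ∈ polyhedral V, q = sph (rot h p) := by
  obtain ⟨h, hh, c, hc, he⟩ := h
  exact ⟨h, hh, eq_sph_of_smul hc he⟩

section PowerSum

variable {ι : Type*} [Fintype ι]

/-- At a critical point the gradient of a power sum is radial. -/
theorem IsTangentCritical.coord_mul_eq {w : ι → E3} {k : ℕ} (hk : k ≠ 0) {x : E3}
    (h : IsTangentCritical (powerSeed w k) x) (i j : Fin 3) :
    x i * ∑ l, ⟪w l, x⟫ ^ (k - 1) * w l j = x j * ∑ l, ⟪w l, x⟫ ^ (k - 1) * w l i := by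
  have hk' : (k : ℝ) ≠ 0 := by exact_mod_cast hk
  have e : ∀ (v : E3) (i : Fin 3), ⟪v, stdE i⟫ = v i := fun v i => by
    simp [EuclideanSpace.inner_single_right]
  have h1 := h (x i • stdE j - x j • stdE i) (by
    rw [inner_sub_right, inner_smul_right, inner_smul_right, e, e]
    ring)
  rw [fderiv_powerSeed, neg_eq_zero, mul_eq_zero, or_iff_right hk'] at h1
  rw [← sub_eq_zero, ← h1, Finset.mul_sum, Finset.mul_sum, ← Finset.sum_sub_distrib]
  refine Finset.sum_congr rfl fun l _ => ?_
  rw [inner_sub_right, inner_smul_right, inner_smul_right, e, e]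
  ring

theorem powerSeed_sph (w : ι → E3) (k : ℕ) {x : E3} (hx : x ≠ 0) :
    powerSeed w k (sph x) = -((‖x‖ ^ k)⁻¹ * ∑ i, ⟪w i, x⟫ ^ k) := by
  rw [powerSeed, coe_sph hx, radial, Finset.mul_sum]
  simp only [inner_smul_right, mul_pow, inv_pow]

/-- For even exponents, power sums on the sphere can be compared without square roots. -/
theorem powerSeed_sph_lt {w : ι → E3} {m : ℕ} {x y : E3} (hx : x ≠ 0) (hy : y ≠ 0)
    (h : ⟪x, x⟫ ^ m * ∑ i, ⟪w i, y⟫ ^ (2 * m) < ⟪y, y⟫ ^ m * ∑ i, ⟪w i, x⟫ ^ (2 * m)) :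
    powerSeed w (2 * m) (sph x) < powerSeed w (2 * m) (sph y) := by
  have hx' : 0 < ‖x‖ ^ (2 * m) := pow_pos (norm_pos_iff.2 hx) _
  have hy' : 0 < ‖y‖ ^ (2 * m) := pow_pos (norm_pos_iff.2 hy) _
  rw [real_inner_self_eq_norm_sq, real_inner_self_eq_norm_sq, ← pow_mul, ← pow_mul] at h
  rw [powerSeed_sph _ _ hx, powerSeed_sph _ _ hy, neg_lt_neg_iff, inv_mul_eq_div, inv_mul_eq_div,
    div_lt_div_iff₀ hy' hx', mul_comm, mul_comm (Finset.sum _ _)]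
  exact h

end PowerSum

/-! ### The tetrahedron -/

/-- The vertices of the tetrahedron, up to normalization. -/
def tetraVec : Fin 4 → E3 := ![!₂[1, 1, 1], !₂[1, -1, -1], !₂[-1, 1, -1], !₂[-1, -1, 1]]

theorem isVertexList_tetra : IsVertexList tetraVec tetrahedron where
  ne_zero i := by
    fin_cases i <;> exact vec_ne_zero (Or.inl (by norm_num))
  norm_eq i j := by
    have h : ∀ i, ‖tetraVec i‖ ^ 2 = 3 := fun i => by
      fin_cases i <;> simp [tetraVec, norm_sq_vec] <;> norm_num
    exact (sq_eq_sq₀ (norm_nonneg _) (norm_nonneg _)).1 (by rw [h, h])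
  injective i j h := by
    have h0 := congrArg (fun x : E3 => x 0) h
    have h1 := congrArg (fun x : E3 => x 1) h
    fin_cases i <;> fin_cases j <;> 
      first | rfl | (norm_num [tetraVec] at h0; done) | (norm_num [tetraVec] at h1)
  sum_eq_zero := by
    ext i
    fin_cases i <;> simp [tetraVec, Fin.sum_univ_four]
  span a h := by
    have h0 := h 0
    have h1 := h 1
    have h2 := h 2
    simp only [inner_eq_coord, tetraVec] at h0 h1 h2
    simp at h0 h1 h2
    ext i
    fin_cases i <;> simp <;> linarith
  mem_iff p := by
    have e : ∀ i, p = sph (tetraVec i) ↔ radial (tetraVec i) = p := fun i => by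
      rw [← coe_sph, Subtype.ext_iff, eq_comm]
      fin_cases i <;> exact vec_ne_zero (Or.inl (by norm_num))
    simp only [e]
    simp [tetrahedron, tetraVec, Fin.exists_fin_succ]

theorem halfTurnX_mem_tetra : halfTurnX ∈ polyhedral tetrahedron :=
  isVertexList_tetra.mem_polyhedral fun i => by
    fin_cases i
    · exact ⟨1, by simp [tetraVec, rot_halfTurnX]⟩
    · exact ⟨0, by simp [tetraVec, rot_halfTurnX]⟩
    · exact ⟨3, by simp [tetraVec, rot_halfTurnX]⟩
    · exact ⟨2, by simp [tetraVec, rot_halfTurnX]⟩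

theorem halfTurnZ_mem_tetra : halfTurnZ ∈ polyhedral tetrahedron :=
  isVertexList_tetra.mem_polyhedral fun i => by
    fin_cases i
    · exact ⟨3, by simp [tetraVec, rot_halfTurnZ]⟩
    · exact ⟨2, by simp [tetraVec, rot_halfTurnZ]⟩
    · exact ⟨1, by simp [tetraVec, rot_halfTurnZ]⟩
    · exact ⟨0, by simp [tetraVec, rot_halfTurnZ]⟩

theorem cyclicTurn_mem_tetra : cyclicTurn ∈ polyhedral tetrahedron :=
  isVertexList_tetra.mem_polyhedral fun i => by
    fin_cases i
    · exact ⟨0, by simp [tetraVec, rot_cyclicTurn]⟩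
    · exact ⟨2, by simp [tetraVec, rot_cyclicTurn]⟩
    · exact ⟨3, by simp [tetraVec, rot_cyclicTurn]⟩
    · exact ⟨1, by simp [tetraVec, rot_cyclicTurn]⟩

theorem isRegularList_tetra : IsRegularList tetraVec tetrahedron cyclicTurn 0 1 2 3 where
  __ := isVertexList_tetra
  mem_R := cyclicTurn_mem_tetra
  rot_zero := by simp [tetraVec, rot_cyclicTurn]
  rot_one := by simp [tetraVec, rot_cyclicTurn]
  rot_three := by simp [tetraVec, rot_cyclicTurn]
  ne_zero_one := by decide
  ne_zero_two := by decide
  ne_one_two := by decide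
  transitive i := by
    fin_cases i
    · exact ⟨1, Subgroup.one_mem _, rot_one _⟩
    · exact ⟨_, halfTurnX_mem_tetra, by simp [tetraVec, rot_halfTurnX]⟩
    · exact ⟨_, Subgroup.mul_mem _ halfTurnX_mem_tetra halfTurnZ_mem_tetra,
        by simp [tetraVec, rot_mul, rot_halfTurnX, rot_halfTurnZ]⟩
    · exact ⟨_, halfTurnZ_mem_tetra, by simp [tetraVec, rot_halfTurnZ]⟩
  neighbor a c _ _ i _ := by
    fin_cases i
    · exact Or.inl rfl
    · exact Or.inr ⟨0, by simp⟩
    · exact Or.inr ⟨1, by simp [tetraVec, rot_cyclicTurn]⟩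
    · exact Or.inr ⟨2, by simp [tetraVec, pow_two, rot_mul, rot_cyclicTurn]⟩
  common a c _ _ _ i _ := by fin_cases i <;> simp
  -- All four vertices in a plane at positive height would contradict that they add up to zero.
  not_both a c hs h0 h1 h2 h3 := by
    have e : ∑ i, ⟪a, tetraVec i⟫ = 0 := by
      rw [← inner_sum, isVertexList_tetra.sum_eq_zero, inner_zero_right]
    rw [Fin.sum_univ_four, h0, h1, h2, h3] at e
    linarith [hs.pos]
  edge := by
    -- A normal vector of the supporting plane is a positive multiple of the sum of the vertices of
    -- the edge; likewise for the face below and for the other polyhedra.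
    refine ⟨!₂[1, 0, 0], 1, ⟨one_pos, fun i => ?_⟩, fun i => ?_⟩ <;>
      fin_cases i <;> simp [tetraVec, inner_vec_vec] <;> norm_num
  face := by
    refine ⟨!₂[1, 1, -1], 1, ⟨one_pos, fun i => ?_⟩, fun i => ?_⟩ <;>
      fin_cases i <;> simp [tetraVec, inner_vec_vec] <;> norm_num

/-- Frames at the three representatives for the tetrahedron. -/
def tetraFrame : Fin 3 → Fin 3 → E3 :=
  ![![!₂[1, -1, 0], !₂[1, 1, -2], !₂[1, 1, 1]],
    ![!₂[0, 1, 1], !₂[0, -1, 1], !₂[1, 0, 0]],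
    ![!₂[-1, 1, 0], !₂[1, 1, 2], !₂[1, 1, -1]]]

/-- The equations leave two cases: all coordinates have the same absolute value, or two of them
vanish. In the first case the sign of the product distinguishes vertices from face centres, in the
second the point is an edge midpoint. -/
theorem inOrbit_tetra {x : E3} (hx : x ≠ 0) (h1 : x 2 * (x 0 ^ 2 - x 1 ^ 2) = 0)
    (h2 : x 0 * (x 1 ^ 2 - x 2 ^ 2) = 0) (h3 : x 1 * (x 2 ^ 2 - x 0 ^ 2) = 0) :
    ∃ i, InOrbit tetrahedron (tetraFrame i 2) x := by
  have hQ : ∀ g ∈ polyhedral tetrahedron, ∀ x,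
      (∃ i, InOrbit tetrahedron (tetraFrame i 2) (rot g x)) →
      ∃ i, InOrbit tetrahedron (tetraFrame i 2) x := fun g hg x ⟨i, h⟩ => ⟨i, h.of_rot hg⟩
  have hne : ¬(x 0 = 0 ∧ x 1 = 0 ∧ x 2 = 0) := fun ⟨h0, h1, h2⟩ => hx <| by
    rw [vec_eq_coord x, h0, h1, h2]
    ext i; fin_cases i <;> rfl
  have key : (|x 0| = |x 1| ∧ |x 1| = |x 2|) ∨ x 0 * x 1 * x 2 = 0 := by
    by_cases h : x 0 * x 1 * x 2 = 0
    · exact Or.inr h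
    · have h0 : x 0 ≠ 0 := by rintro h'; simp [h'] at h
      have h2' : x 2 ≠ 0 := by rintro h'; simp [h'] at h
      exact Or.inl ⟨sq_eq_sq_iff_abs_eq_abs _ _ |>.1 (by
        linarith [(mul_eq_zero_iff_left h2').1 h1]), sq_eq_sq_iff_abs_eq_abs _ _ |>.1 (by
        linarith [(mul_eq_zero_iff_left h0).1 h2])⟩
  refine of_abs_coord (Q := fun x => ∃ i, InOrbit tetrahedron (tetraFrame i 2) x)
    (hQ _ halfTurnX_mem_tetra) (hQ _ halfTurnZ_mem_tetra) x (fun _ => ?_)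
    fun hneg => ?_
  · rcases key with ⟨e1, e2⟩ | h
    · have hpos : 0 < |x 0| := by
        rw [abs_pos]
        intro h0
        rw [h0, abs_zero] at e1
        exact hne ⟨h0, abs_eq_zero.1 e1.symm, abs_eq_zero.1 (by rw [← e2, ← e1])⟩
      rw [← e2, ← e1]
      refine ⟨0, inOrbit_smul hpos ?_⟩
      ext i; fin_cases i <;> simp [tetraFrame]
    · have key : ∀ a : ℝ, a ≠ 0 → InOrbit tetrahedron (tetraFrame 1 2) !₂[|a|, 0, 0] :=
        fun a ha => inOrbit_smul (abs_pos.2 ha) (by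
          ext i; fin_cases i <;> simp [tetraFrame])
      have hcases : (x 1 = 0 ∧ x 2 = 0) ∨ (x 0 = 0 ∧ x 2 = 0) ∨ (x 0 = 0 ∧ x 1 = 0) := by
        rcases mul_eq_zero.1 h with h | h
        · rcases mul_eq_zero.1 h with h | h <;> simp [h] at h1 h2 h3 ⊢ <;> tauto
        · simp [h] at h1 h2 h3 ⊢; tauto
      rcases hcases with ⟨e1, e2⟩ | ⟨e1, e2⟩ | ⟨e1, e2⟩
      · rw [e1, e2, abs_zero]
        exact ⟨1, key _ fun h => hne ⟨h, e1, e2⟩⟩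
      · rw [e1, e2, abs_zero]
        refine hQ _ cyclicTurn_mem_tetra _ (hQ _ cyclicTurn_mem_tetra _ ?_)
        rw [rot_cyclicTurn, rot_cyclicTurn]
        exact ⟨1, key _ fun h => hne ⟨e1, h, e2⟩⟩
      · rw [e1, e2, abs_zero]
        refine hQ _ cyclicTurn_mem_tetra _ ?_
        rw [rot_cyclicTurn]
        exact ⟨1, key _ fun h => hne ⟨e1, e2, h⟩⟩
  · rcases key with ⟨e1, e2⟩ | h
    · have hpos : 0 < |x 0| := by
        rw [abs_pos]
        intro h0
        rw [h0, zero_mul, zero_mul] at hneg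
        exact hneg.false
      rw [← e2, ← e1]
      refine ⟨2, inOrbit_smul hpos ?_⟩
      ext i; fin_cases i <;> simp [tetraFrame]
    · exact absurd h hneg.ne

/-- The exponent is odd because vertices and face centres are antipodal and must get different
values. -/
theorem hasMorseModel_tetra :
    HasMorseModel (polyhedral tetrahedron) (polyhedralPoints tetrahedron) := by
  have hne : ∀ i, tetraFrame i 2 ≠ 0 := fun i => by
    fin_cases i <;> exact vec_ne_zero (Or.inl (by norm_num))
  refine isRegularList_tetra.hasMorseModel (k := 3) (by norm_num) (u := tetraFrame) ?_ ?_ ?_ ?_ ?_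
    ?_ ?_ ?_ ?_ ?_
  · refine ⟨hne, rfl, ⟨2, two_pos, ?_⟩, ⟨1, one_pos, ?_⟩⟩
    · ext i; fin_cases i <;> simp [tetraVec, tetraFrame]; norm_num
    · ext i; fin_cases i <;> simp [tetraVec, tetraFrame]
  · intro i j l hjl
    fin_cases i <;> fin_cases j <;> fin_cases l <;>
      first | exact absurd rfl hjl | (simp [tetraFrame, inner_vec_vec]; try norm_num)
  · intro i
    fin_cases i <;> simp [Matrix.det_fin_three, tetraFrame] <;> norm_num
  · intro i
    fin_cases i
    · exact ⟨_, cyclicTurn_mem_tetra, cyclicTurn_ne_one, rot_cyclicTurn _ _ _⟩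
    · exact ⟨_, halfTurnX_mem_tetra, halfTurnX_ne_one, by simp [tetraFrame, rot_halfTurnX]⟩
    -- The conjugate of the cyclic turn by the half turn about the third axis has the face centre on
    -- its axis.
    · exact ⟨_, Subgroup.mul_mem _ (Subgroup.mul_mem _ halfTurnZ_mem_tetra cyclicTurn_mem_tetra)
        halfTurnZ_mem_tetra, ne_one_of_rot_ne (x := !₂[1, 0, 0]) fun h => by
          have := congrArg (fun x : E3 => x 0) h
          simp [rot_mul, rot_cyclicTurn, rot_halfTurnZ] at this,
        by simp [tetraFrame, rot_mul, rot_cyclicTurn, rot_halfTurnZ]⟩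
  · intro i
    fin_cases i <;> simp [tetraFrame, tetraVec, Fin.sum_univ_four, inner_vec_vec] <;> norm_num
  · intro i
    fin_cases i <;>
      simp [tetraFrame, tetraVec, Fin.sum_univ_four, inner_vec_vec, norm_sq_vec, sgnX] <;> norm_num
  · intro i
    fin_cases i <;>
      simp [tetraFrame, tetraVec, Fin.sum_univ_four, inner_vec_vec, norm_sq_vec, sgnY] <;> norm_num
  · rw [powerSeed_sph _ _ (hne 0), powerSeed_sph _ _ (hne 1)]
    have := pow_pos (norm_pos_iff.2 (hne 0)) 3
    rw [neg_lt_neg_iff]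
    -- The cubes cancel at the edge midpoint, so its value is 0 and only a sign is left to check.
    refine lt_of_eq_of_lt (b := 0) ?_ (mul_pos (inv_pos.2 this) ?_) <;>
    simp [tetraFrame, tetraVec, Fin.sum_univ_four, inner_vec_vec, norm_sq_vec] <;> norm_num
  · rw [powerSeed_sph _ _ (hne 1), powerSeed_sph _ _ (hne 2)]
    have := pow_pos (norm_pos_iff.2 (hne 2)) 3
    rw [neg_lt_neg_iff]
    refine lt_of_lt_of_eq (b := 0) (mul_neg_of_pos_of_neg (inv_pos.2 this) ?_) ?_ <;>
      simp [tetraFrame, tetraVec, Fin.sum_univ_four, inner_vec_vec] <;> norm_num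
  · intro q hq
    have e01 := hq.coord_mul_eq (by norm_num) 0 1
    have e12 := hq.coord_mul_eq (by norm_num) 1 2
    have e20 := hq.coord_mul_eq (by norm_num) 2 0
    simp only [inner_eq_coord] at e01 e12 e20
    simp [tetraVec, Fin.sum_univ_four] at e01 e12 e20
    obtain ⟨i, hi⟩ := inOrbit_tetra (coe_sphere_ne_zero q)
      (by linear_combination e01 / 8) (by linear_combination e12 / 8)
      (by linear_combination e20 / 8)
    obtain ⟨h, hh, e⟩ := hi.eq_sph
    exact ⟨i, h, hh, e⟩

/-! ### The octahedron -/

/-- The vertices of the octahedron. -/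
def octaVec : Fin 6 → E3 :=
  ![!₂[1, 0, 0], !₂[-1, 0, 0], !₂[0, 1, 0], !₂[0, -1, 0], !₂[0, 0, 1], !₂[0, 0, -1]]

/-- The quarter turn about the third coordinate axis. -/
def quarterTurnZ : SO3 :=
  ⟨!![0, -1, 0; 1, 0, 0; 0, 0, 1], by
    rw [Matrix.mem_specialOrthogonalGroup_iff, Matrix.mem_orthogonalGroup_iff]
    constructor
    · ext i j
      fin_cases i <;> fin_cases j <;> simp [Matrix.mul_apply, Fin.sum_univ_three]
    · simp [Matrix.det_fin_three]⟩

theorem rot_quarterTurnZ (a b c : ℝ) : rot quarterTurnZ !₂[a, b, c] = !₂[-b, a, c] := by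
  ext i
  rw [rot_apply_coord]
  fin_cases i <;> simp [quarterTurnZ]

theorem octaVec_ne_zero (i : Fin 6) : octaVec i ≠ 0 := by
  fin_cases i <;> exact vec_ne_zero (by norm_num)

theorem isVertexList_octa : IsVertexList octaVec octahedron where
  ne_zero := octaVec_ne_zero
  norm_eq i j := by
    have h : ∀ i, ‖octaVec i‖ ^ 2 = 1 := fun i => by
      fin_cases i <;> simp [octaVec, norm_sq_vec]
    exact (sq_eq_sq₀ (norm_nonneg _) (norm_nonneg _)).1 (by rw [h, h])
  injective i j h := by
    -- This functional takes the distinct values `±1`, `±2`, `±3`.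
    have h' : ⟪(!₂[1, 2, 3] : E3), octaVec i⟫ = ⟪(!₂[1, 2, 3] : E3), octaVec j⟫ := by rw [h]
    fin_cases i <;> fin_cases j <;>
      first | rfl | (simp [octaVec, inner_vec_vec] at h'; try norm_num at h')
  sum_eq_zero := by
    ext i
    fin_cases i <;> simp [octaVec, Fin.sum_univ_succ]
  span a h := by
    have h0 := h 0
    have h1 := h 2
    have h2 := h 4
    simp only [inner_eq_coord, octaVec] at h0 h1 h2
    simp at h0 h1 h2
    ext i
    fin_cases i <;> simp <;> linarith
  mem_iff p := by
    have e : ∀ i, p = sph (octaVec i) ↔ radial (octaVec i) = p := fun i => by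
      rw [← coe_sph (octaVec_ne_zero i), Subtype.ext_iff, eq_comm]
    simp only [e]
    simp [octahedron, octaVec, Fin.exists_fin_succ]

theorem halfTurnX_mem_octa : halfTurnX ∈ polyhedral octahedron :=
  isVertexList_octa.mem_polyhedral fun i => by
    fin_cases i
    · exact ⟨0, by simp [octaVec, rot_halfTurnX]⟩
    · exact ⟨1, by simp [octaVec, rot_halfTurnX]⟩
    · exact ⟨3, by simp [octaVec, rot_halfTurnX]⟩
    · exact ⟨2, by simp [octaVec, rot_halfTurnX]⟩
    · exact ⟨5, by simp [octaVec, rot_halfTurnX]⟩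
    · exact ⟨4, by simp [octaVec, rot_halfTurnX]⟩

theorem quarterTurnZ_mem_octa : quarterTurnZ ∈ polyhedral octahedron :=
  isVertexList_octa.mem_polyhedral fun i => by
    fin_cases i
    · exact ⟨2, by simp [octaVec, rot_quarterTurnZ]⟩
    · exact ⟨3, by simp [octaVec, rot_quarterTurnZ]⟩
    · exact ⟨1, by simp [octaVec, rot_quarterTurnZ]⟩
    · exact ⟨0, by simp [octaVec, rot_quarterTurnZ]⟩
    · exact ⟨4, by simp [octaVec, rot_quarterTurnZ]⟩
    · exact ⟨5, by simp [octaVec, rot_quarterTurnZ]⟩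

theorem halfTurnZ_mem_octa : halfTurnZ ∈ polyhedral octahedron :=
  isVertexList_octa.mem_polyhedral fun i => by
    fin_cases i
    · exact ⟨1, by simp [octaVec, rot_halfTurnZ]⟩
    · exact ⟨0, by simp [octaVec, rot_halfTurnZ]⟩
    · exact ⟨3, by simp [octaVec, rot_halfTurnZ]⟩
    · exact ⟨2, by simp [octaVec, rot_halfTurnZ]⟩
    · exact ⟨4, by simp [octaVec, rot_halfTurnZ]⟩
    · exact ⟨5, by simp [octaVec, rot_halfTurnZ]⟩

theorem cyclicTurn_mem_octa : cyclicTurn ∈ polyhedral octahedron :=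
  isVertexList_octa.mem_polyhedral fun i => by
    fin_cases i
    · exact ⟨2, by simp [octaVec, rot_cyclicTurn]⟩
    · exact ⟨3, by simp [octaVec, rot_cyclicTurn]⟩
    · exact ⟨4, by simp [octaVec, rot_cyclicTurn]⟩
    · exact ⟨5, by simp [octaVec, rot_cyclicTurn]⟩
    · exact ⟨0, by simp [octaVec, rot_cyclicTurn]⟩
    · exact ⟨1, by simp [octaVec, rot_cyclicTurn]⟩

/-- The case `μ = 0` of `IsSupport.not_both`: the midpoint of opposite vertices is the centre. -/
theorem octa_antipodal {a : E3} {c : ℝ} (hs : IsSupport octaVec a c) {i j : Fin 6}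
    (hij : octaVec i + octaVec j = 0) (hi : ⟪a, octaVec i⟫ = c) : ⟪a, octaVec j⟫ ≠ c :=
  hs.not_both (k := i) (l := i) le_rfl one_pos (by rw [hij, zero_smul]) hi

theorem octa_add_zero_one : octaVec 0 + octaVec 1 = 0 := by
  ext i; fin_cases i <;> simp [octaVec]

theorem octa_add_two_three : octaVec 2 + octaVec 3 = 0 := by
  ext i; fin_cases i <;> simp [octaVec]

theorem octa_add_four_five : octaVec 4 + octaVec 5 = 0 := by
  ext i; fin_cases i <;> simp [octaVec]

theorem isRegularList_octa : IsRegularList octaVec octahedron quarterTurnZ 4 0 2 3 where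
  __ := isVertexList_octa
  mem_R := quarterTurnZ_mem_octa
  rot_zero := by simp [octaVec, rot_quarterTurnZ]
  rot_one := by simp [octaVec, rot_quarterTurnZ]
  rot_three := by simp [octaVec, rot_quarterTurnZ]
  ne_zero_one := by decide
  ne_zero_two := by decide
  ne_one_two := by decide
  transitive i := by
    have hc := cyclicTurn_mem_octa
    fin_cases i
    · exact ⟨_, hc, by simp [octaVec, rot_cyclicTurn]⟩
    · exact ⟨_, Subgroup.mul_mem _ halfTurnZ_mem_octa hc,
        by simp [octaVec, rot_mul, rot_cyclicTurn, rot_halfTurnZ]⟩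
    · exact ⟨_, Subgroup.mul_mem _ hc hc, by simp [octaVec, rot_mul, rot_cyclicTurn]⟩
    · exact ⟨_, Subgroup.mul_mem _ halfTurnX_mem_octa (Subgroup.mul_mem _ hc hc),
        by simp [octaVec, rot_mul, rot_cyclicTurn, rot_halfTurnX]⟩
    · exact ⟨1, Subgroup.one_mem _, rot_one _⟩
    · exact ⟨_, halfTurnX_mem_octa, by simp [octaVec, rot_halfTurnX]⟩
  neighbor a c hs h0 i hi := by
    fin_cases i
    · exact Or.inr ⟨0, by simp⟩
    · exact Or.inr ⟨2, by simp [octaVec, pow_two, rot_mul, rot_quarterTurnZ]⟩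
    · exact Or.inr ⟨1, by simp [octaVec, rot_quarterTurnZ]⟩
    · exact Or.inr ⟨3, by simp [octaVec, pow_succ, rot_mul, rot_quarterTurnZ]⟩
    · exact Or.inl rfl
    · exact absurd hi (octa_antipodal hs octa_add_four_five h0)
  common a c hs h0 h1 i hi := by
    fin_cases i
    · simp
    · exact absurd hi (octa_antipodal hs octa_add_zero_one h1)
    · simp
    · simp
    · simp
    · exact absurd hi (octa_antipodal hs octa_add_four_five h0)
  not_both a c hs h0 h1 h2 := octa_antipodal hs octa_add_two_three h2
  edge := by
    refine ⟨!₂[1, 0, 1], 1, ⟨one_pos, fun i => ?_⟩, fun i => ?_⟩ <;>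
      fin_cases i <;> simp [octaVec, inner_vec_vec] <;> norm_num
  face := by
    refine ⟨!₂[1, 1, 1], 1, ⟨one_pos, fun i => ?_⟩, fun i => ?_⟩ <;>
      fin_cases i <;> simp [octaVec, inner_vec_vec] <;> norm_num

/-- Frames at the three representatives for the octahedron. -/
def octaFrame : Fin 3 → Fin 3 → E3 :=
  ![![!₂[1, 0, 0], !₂[0, 1, 0], !₂[0, 0, 1]],
    ![!₂[1, 0, -1], !₂[0, 1, 0], !₂[1, 0, 1]],
    ![!₂[1, -1, 0], !₂[1, 1, -2], !₂[1, 1, 1]]]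

/-- Any two nonzero coordinates have the same absolute value. One, two or three of them being
nonzero means a vertex, an edge midpoint or a face centre. -/
theorem inOrbit_octa {x : E3} (hx : x ≠ 0) (h1 : x 0 * x 1 * (x 0 ^ 2 - x 1 ^ 2) = 0)
    (h2 : x 1 * x 2 * (x 1 ^ 2 - x 2 ^ 2) = 0) (h3 : x 2 * x 0 * (x 2 ^ 2 - x 0 ^ 2) = 0) :
    ∃ i, InOrbit octahedron (octaFrame i 2) x := by
  let Q : E3 → Prop := fun x => ∃ i, InOrbit octahedron (octaFrame i 2) x
  change Q x
  have hQ : ∀ g ∈ polyhedral octahedron, ∀ x, Q (rot g x) → Q x :=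
    fun g hg x ⟨i, h⟩ => ⟨i, h.of_rot hg⟩
  have hQc : ∀ a b c, Q !₂[c, a, b] → Q !₂[a, b, c] := fun a b c h =>
    hQ _ cyclicTurn_mem_octa _ (by rwa [rot_cyclicTurn])
  have h001 : ∀ a : ℝ, a ≠ 0 → Q !₂[0, 0, |a|] := fun a ha => ⟨0, inOrbit_smul (abs_pos.2 ha) (by
    ext i; fin_cases i <;> simp [octaFrame])⟩
  have h101 : ∀ a : ℝ, a ≠ 0 → Q !₂[|a|, 0, |a|] := fun a ha => ⟨1, inOrbit_smul (abs_pos.2 ha) (by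
    ext i; fin_cases i <;> simp [octaFrame])⟩
  have h111 : ∀ a : ℝ, a ≠ 0 → Q !₂[|a|, |a|, |a|] := fun a ha =>
    ⟨2, inOrbit_smul (abs_pos.2 ha) (by
      ext i; fin_cases i <;> simp [octaFrame])⟩
  have hne : ¬(x 0 = 0 ∧ x 1 = 0 ∧ x 2 = 0) := fun ⟨h0, h1, h2⟩ => hx <| by
    rw [vec_eq_coord x, h0, h1, h2]
    ext i; fin_cases i <;> rfl
  have heq : ∀ {a b : ℝ}, a * b * (a ^ 2 - b ^ 2) = 0 → a ≠ 0 → b ≠ 0 → |b| = |a| :=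
    fun h ha hb => ((sq_eq_sq_iff_abs_eq_abs _ _).1
      (sub_eq_zero.1 ((mul_eq_zero_iff_left (mul_ne_zero ha hb)).1 h))).symm
  have hpos : ∀ a b c : ℝ, ¬(a = 0 ∧ b = 0 ∧ c = 0) → a * b * (a ^ 2 - b ^ 2) = 0 →
      b * c * (b ^ 2 - c ^ 2) = 0 → c * a * (c ^ 2 - a ^ 2) = 0 → Q !₂[|a|, |b|, |c|] := by
    intro a b c hne h1 h2 h3
    rcases eq_or_ne a 0 with rfl | ha <;> rcases eq_or_ne b 0 with rfl | hb <;>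
      rcases eq_or_ne c 0 with rfl | hc
    · exact absurd ⟨rfl, rfl, rfl⟩ hne
    · rw [abs_zero]
      exact h001 c hc
    · rw [abs_zero]
      exact hQc _ _ _ (h001 b hb)
    · rw [abs_zero, heq h2 hb hc]
      exact hQc _ _ _ (h101 b hb)
    · rw [abs_zero]
      exact hQc _ _ _ (hQc _ _ _ (h001 a ha))
    · rw [abs_zero, heq h3 hc ha]
      exact h101 c hc
    · rw [abs_zero, heq h1 ha hb]
      exact hQc _ _ _ (hQc _ _ _ (h101 a ha))
    · rw [heq h2 hb hc, heq h1 ha hb]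
      exact h111 a ha
  refine of_abs_coord (hQ _ halfTurnX_mem_octa) (hQ _ halfTurnZ_mem_octa) x
    (fun _ => hpos _ _ _ hne h1 h2 h3) fun _ => ?_
  -- For a negative product, a quarter turn and two half turns remove the sign and exchange the
  -- first two coordinates.
  refine hQ _ quarterTurnZ_mem_octa _ (hQ _ halfTurnX_mem_octa _ (hQ _ halfTurnZ_mem_octa _ ?_))
  rw [rot_quarterTurnZ, rot_halfTurnX, rot_halfTurnZ, neg_neg, neg_neg, neg_neg]
  exact hpos _ _ _ (fun ⟨h0, h1, h2⟩ => hne ⟨h1, h0, h2⟩) (by linear_combination -h1)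
    (by linear_combination -h3) (by linear_combination -h2)

theorem hasMorseModel_octa :
    HasMorseModel (polyhedral octahedron) (polyhedralPoints octahedron) := by
  have hne : ∀ i, octaFrame i 2 ≠ 0 := fun i => by
    fin_cases i <;> exact vec_ne_zero (by norm_num)
  -- Degree 2 would be constant on the sphere. The form `2 * 2` fits `powerSeed_sph_lt`.
  refine isRegularList_octa.hasMorseModel (k := 2 * 2) (by norm_num) (u := octaFrame) ?_ ?_ ?_ ?_ ?_
    ?_ ?_ ?_ ?_ ?_
  · refine ⟨hne, rfl, ⟨1, one_pos, ?_⟩, ⟨1, one_pos, ?_⟩⟩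
    · ext i; fin_cases i <;> simp [octaVec, octaFrame]
    · ext i; fin_cases i <;> simp [octaVec, octaFrame]
  · intro i j l hjl
    fin_cases i <;> fin_cases j <;> fin_cases l <;>
      first | exact absurd rfl hjl | (simp [octaFrame, inner_vec_vec]; try norm_num)
  · intro i
    fin_cases i <;> simp [Matrix.det_fin_three, octaFrame] <;> norm_num
  · intro i
    fin_cases i
    · exact ⟨_, halfTurnZ_mem_octa, halfTurnZ_ne_one, by simp [octaFrame, rot_halfTurnZ]⟩
    · refine ⟨_, Subgroup.mul_mem _ cyclicTurn_mem_octa quarterTurnZ_mem_octa,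
        ne_one_of_rot_ne (x := !₂[0, 1, 0]) fun h => ?_,
        by simp [octaFrame, rot_mul, rot_cyclicTurn, rot_quarterTurnZ]⟩
      have := congrArg (fun x : E3 => x 1) h
      norm_num [rot_mul, rot_cyclicTurn, rot_quarterTurnZ] at this
    · exact ⟨_, cyclicTurn_mem_octa, cyclicTurn_ne_one, rot_cyclicTurn _ _ _⟩
  · intro i
    fin_cases i <;> simp [octaFrame, octaVec, Fin.sum_univ_succ, inner_vec_vec]
  · intro i
    fin_cases i <;>
      simp [octaFrame, octaVec, Fin.sum_univ_succ, inner_vec_vec, norm_sq_vec, sgnX] <;>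
      norm_num
  · intro i
    fin_cases i <;>
      simp [octaFrame, octaVec, Fin.sum_univ_succ, inner_vec_vec, norm_sq_vec, sgnY] <;>
      norm_num
  · refine powerSeed_sph_lt (hne 0) (hne 1) ?_
    simp [octaFrame, octaVec, Fin.sum_univ_succ, inner_vec_vec, norm_sq_vec]
    norm_num
  · refine powerSeed_sph_lt (hne 1) (hne 2) ?_
    simp [octaFrame, octaVec, Fin.sum_univ_succ, inner_vec_vec, norm_sq_vec]
    norm_num
  · intro q hq
    have e01 := hq.coord_mul_eq (by norm_num) 0 1
    have e12 := hq.coord_mul_eq (by norm_num) 1 2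
    have e20 := hq.coord_mul_eq (by norm_num) 2 0
    simp only [inner_eq_coord] at e01 e12 e20
    simp [octaVec, Fin.sum_univ_succ] at e01 e12 e20
    obtain ⟨i, hi⟩ := inOrbit_octa (coe_sphere_ne_zero q) (by linear_combination -e01 / 2)
      (by linear_combination -e12 / 2) (by linear_combination -e20 / 2)
    obtain ⟨h, hh, e⟩ := hi.eq_sph
    exact ⟨i, h, hh, e⟩

/-! ### The icosahedron -/

open scoped goldenRatio

/-- The vertices of the icosahedron up to normalization, for `t` the golden ratio: a vertex, the
ring of its five neighbours, and their antipodes. -/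
def icosaVec (t : ℝ) : Fin 12 → E3 :=
  ![!₂[0, 1, t], !₂[0, -1, t], !₂[t, 0, 1], !₂[1, t, 0], !₂[-1, t, 0], !₂[-t, 0, 1],
    !₂[0, -1, -t], !₂[0, 1, -t], !₂[-t, 0, -1], !₂[-1, -t, 0], !₂[1, -t, 0], !₂[t, 0, -1]]

theorem goldenRatio_bounds : 1.6 < φ ∧ φ < 1.62 := by
  have h := Real.goldenRatio_sq
  have h0 := Real.goldenRatio_pos
  constructor <;> nlinarith

theorem goldenRatio_pow (n : ℕ) : φ ^ (n + 2) = φ ^ (n + 1) + φ ^ n := by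
  rw [pow_add, Real.goldenRatio_sq]
  ring

/-- The rotation by `2π/5` about a vertex of the icosahedron. -/
def fifthTurn : SO3 :=
  ⟨!![(φ - 1) / 2, -φ / 2, 1 / 2; φ / 2, 1 / 2, (φ - 1) / 2; -1 / 2, (φ - 1) / 2, φ / 2], by
    have h := Real.goldenRatio_sq
    have h3 := goldenRatio_pow 1
    rw [Matrix.mem_specialOrthogonalGroup_iff, Matrix.mem_orthogonalGroup_iff]
    constructor
    · ext i j
      fin_cases i <;> fin_cases j <;> simp [Matrix.mul_apply, Fin.sum_univ_three] <;> linarith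
    · simp [Matrix.det_fin_three]
      linarith⟩

theorem rot_fifthTurn (a b c : ℝ) : rot fifthTurn !₂[a, b, c] =
    !₂[((φ - 1) * a - φ * b + c) / 2, (φ * a + b + (φ - 1) * c) / 2,
      (-a + (φ - 1) * b + φ * c) / 2] := by
  ext i
  rw [rot_apply_coord]
  fin_cases i <;> simp [fifthTurn] <;> ring

theorem icosaVec_ne_zero (i : Fin 12) : icosaVec φ i ≠ 0 := by
  have h := Real.goldenRatio_ne_zero
  fin_cases i <;> exact vec_ne_zero (by simp)

/-- The functional `(1, 7, 50)` separates the vertices; `σ` lists them in increasing order of its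
values. -/
theorem icosaVec_injective : Function.Injective (icosaVec φ) := by
  obtain ⟨hl, hu⟩ := goldenRatio_bounds
  let σ : Fin 12 → Fin 12 := ![6, 7, 8, 11, 9, 10, 4, 3, 5, 2, 1, 0]
  have hσ : Function.Surjective σ := by decide
  have hmono : StrictMono fun k => ⟪(!₂[1, 7, 50] : E3), icosaVec φ (σ k)⟫ := by
    generalize φ = t at *
    rw [Fin.strictMono_iff_lt_succ]
    intro k
    fin_cases k <;> simp [icosaVec, inner_vec_vec, σ] <;> linarith
  intro i j h
  obtain ⟨k, rfl⟩ := hσ i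
  obtain ⟨l, rfl⟩ := hσ j
  rw [hmono.injective (a₁ := k) (a₂ := l) (by simp only [h])]

theorem isVertexList_icosa : IsVertexList (icosaVec φ) icosahedron where
  ne_zero := icosaVec_ne_zero
  norm_eq i j := by
    have h : ∀ i, ‖icosaVec φ i‖ ^ 2 = φ + 2 := fun i => by
      have := Real.goldenRatio_sq
      fin_cases i <;> simp [icosaVec, norm_sq_vec] <;> linarith
    exact (sq_eq_sq₀ (norm_nonneg _) (norm_nonneg _)).1 (by rw [h, h])
  injective := icosaVec_injective
  sum_eq_zero := by
    ext i
    fin_cases i <;> (simp [icosaVec, Fin.sum_univ_succ]; try ring)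
  span a h := by
    have hpos := Real.goldenRatio_pos
    have h0 := h 0
    have h1 := h 1
    have h2 := h 2
    have h3 := h 3
    simp only [inner_eq_coord, icosaVec] at h0 h1 h2 h3
    simp at h0 h1 h2 h3
    have e2 : a 2 = 0 := (mul_eq_zero_iff_right hpos.ne').1 (by linarith : a 2 * φ = 0)
    have e1 : a 1 = 0 := by rw [e2] at h0; linarith
    have e0 : a 0 = 0 := by rw [e1] at h3; linarith
    ext i
    fin_cases i
    · exact e0
    · exact e1
    · exact e2
  mem_iff p := by
    have e : ∀ i, p = sph (icosaVec φ i) ↔ radial (icosaVec φ i) = p := fun i => by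
      rw [← coe_sph (icosaVec_ne_zero i), Subtype.ext_iff, eq_comm]
    simp only [e]
    simp [icosahedron, icosaVec, Fin.exists_fin_succ, or_and_right, exists_or]
    tauto

theorem halfTurnX_mem_icosa : halfTurnX ∈ polyhedral icosahedron :=
  isVertexList_icosa.mem_polyhedral fun i =>
    ⟨![6, 7, 11, 10, 9, 8, 0, 1, 5, 4, 3, 2] i, by
      fin_cases i <;> simp [icosaVec, rot_halfTurnX]⟩

theorem halfTurnZ_mem_icosa : halfTurnZ ∈ polyhedral icosahedron :=
  isVertexList_icosa.mem_polyhedral fun i =>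
    ⟨![1, 0, 5, 9, 10, 2, 7, 6, 11, 3, 4, 8] i, by
      fin_cases i <;> simp [icosaVec, rot_halfTurnZ]⟩

theorem cyclicTurn_mem_icosa : cyclicTurn ∈ polyhedral icosahedron :=
  isVertexList_icosa.mem_polyhedral fun i =>
    ⟨![2, 11, 3, 0, 1, 10, 8, 5, 9, 6, 7, 4] i, by
      fin_cases i <;> simp [icosaVec, rot_cyclicTurn]⟩

/-- The turn fixes the vertex 0 and its antipode 6 and cycles the two rings of five. -/
theorem rot_fifthTurn_icosaVec (i : Fin 12) : rot fifthTurn (icosaVec φ i) =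
    icosaVec φ (![0, 2, 3, 4, 5, 1, 6, 8, 9, 10, 11, 7] i) := by
  have h := Real.goldenRatio_sq
  have hR := rot_fifthTurn
  generalize φ = t at *
  ext k
  fin_cases i <;> fin_cases k <;> simp [icosaVec, hR] <;> linarith

theorem fifthTurn_mem_icosa : fifthTurn ∈ polyhedral icosahedron :=
  isVertexList_icosa.mem_polyhedral fun i => ⟨_, rot_fifthTurn_icosaVec i⟩

/-- Two vertices at distance two span a planar rhombus with their two common neighbours `k` and `l`,
and the sum of the pair is `t - 1 = 1 / φ` times the sum of `w k` and `w l`. -/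
theorem icosa_not_both {a : E3} {c : ℝ} (hs : IsSupport (icosaVec φ) a c) {i j : Fin 12}
    (k l : Fin 12)
    (hw : ∀ t : ℝ, t ^ 2 = t + 1 → ∀ m, (icosaVec t i + icosaVec t j) m =
      (t - 1) * (icosaVec t k + icosaVec t l) m)
    (hi : ⟪a, icosaVec φ i⟫ = c) : ⟪a, icosaVec φ j⟫ ≠ c := by
  obtain ⟨hl, hu⟩ := goldenRatio_bounds
  refine hs.not_both (k := k) (l := l) (μ := φ - 1) (by linarith) (by linarith) ?_ hi
  ext m
  exact hw φ Real.goldenRatio_sq m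

theorem icosa_antipodal {a : E3} {c : ℝ} (hs : IsSupport (icosaVec φ) a c) {i j : Fin 12}
    (hw : ∀ t : ℝ, ∀ m, (icosaVec t i + icosaVec t j) m = 0)
    (hi : ⟪a, icosaVec φ i⟫ = c) : ⟪a, icosaVec φ j⟫ ≠ c := by
  refine hs.not_both (k := i) (l := i) le_rfl one_pos ?_ hi
  rw [zero_smul]
  ext m
  exact hw φ m

/-- The vertices from 6 on are the antipode and the far ring. The indices given below are the common
neighbours with vertex 0. -/
theorem icosa_not_adjacent {a : E3} {c : ℝ} (hs : IsSupport (icosaVec φ) a c)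
    (h0 : ⟪a, icosaVec φ 0⟫ = c) {i : Fin 12} (hi : 6 ≤ i) : ⟪a, icosaVec φ i⟫ ≠ c := by
  fin_cases i
  iterate 6 exact absurd hi (by decide)
  · exact icosa_antipodal hs (fun t m => by fin_cases m <;> simp [icosaVec]) h0
  · exact icosa_not_both hs 3 4
      (fun t ht m => by fin_cases m <;> simp [icosaVec] <;> linarith) h0
  · exact icosa_not_both hs 4 5
      (fun t ht m => by fin_cases m <;> simp [icosaVec] <;> linarith) h0
  · exact icosa_not_both hs 5 1
      (fun t ht m => by fin_cases m <;> simp [icosaVec] <;> linarith) h0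
  · exact icosa_not_both hs 1 2
      (fun t ht m => by fin_cases m <;> simp [icosaVec] <;> linarith) h0
  · exact icosa_not_both hs 2 3
      (fun t ht m => by fin_cases m <;> simp [icosaVec] <;> linarith) h0

theorem isRegularList_icosa : IsRegularList (icosaVec φ) icosahedron fifthTurn 0 1 2 5 where
  __ := isVertexList_icosa
  mem_R := fifthTurn_mem_icosa
  rot_zero := rot_fifthTurn_icosaVec 0
  rot_one := rot_fifthTurn_icosaVec 1
  rot_three := rot_fifthTurn_icosaVec 5
  ne_zero_one := by decide
  ne_zero_two := by decide
  ne_one_two := by decide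
  transitive i := by
    have hX := halfTurnX_mem_icosa
    have hZ := halfTurnZ_mem_icosa
    have hP := cyclicTurn_mem_icosa
    have hR := fifthTurn_mem_icosa
    have hm : ∀ {g h}, g ∈ polyhedral icosahedron → h ∈ polyhedral icosahedron →
      g * h ∈ polyhedral icosahedron := Subgroup.mul_mem _
    have r2 : rot fifthTurn (icosaVec φ 2) = icosaVec φ 3 := rot_fifthTurn_icosaVec 2
    have r3 : rot fifthTurn (icosaVec φ 3) = icosaVec φ 4 := rot_fifthTurn_icosaVec 3
    have r8 : rot fifthTurn (icosaVec φ 8) = icosaVec φ 9 := rot_fifthTurn_icosaVec 8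
    have p0 : rot cyclicTurn (icosaVec φ 0) = icosaVec φ 2 := rot_cyclicTurn _ _ _
    have p6 : rot cyclicTurn (icosaVec φ 6) = icosaVec φ 8 := rot_cyclicTurn _ _ _
    have x0 : rot halfTurnX (icosaVec φ 0) = icosaVec φ 6 := by simp [icosaVec, rot_halfTurnX]
    fin_cases i
    · exact ⟨1, Subgroup.one_mem _, rot_one _⟩
    · exact ⟨_, hZ, by simp [icosaVec, rot_halfTurnZ]⟩
    · exact ⟨_, hP, p0⟩
    · exact ⟨_, hm hR hP, by rw [rot_mul, p0, r2]; rfl⟩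
    · exact ⟨_, hm hR (hm hR hP), by rw [rot_mul, rot_mul, p0, r2, r3]; rfl⟩
    · exact ⟨_, hm hZ hP, by simp [icosaVec, rot_mul, rot_halfTurnZ, rot_cyclicTurn]⟩
    · exact ⟨_, hX, x0⟩
    · exact ⟨_, hm hZ hX, by simp [icosaVec, rot_mul, rot_halfTurnZ, rot_halfTurnX]⟩
    · exact ⟨_, hm hP hX, by rw [rot_mul, x0, p6]; rfl⟩
    · exact ⟨_, hm hR (hm hP hX), by rw [rot_mul, rot_mul, x0, p6, r8]; rfl⟩
    · exact ⟨_, hm hP (hm hZ hP), by simp [icosaVec, rot_mul, rot_halfTurnZ, rot_cyclicTurn]⟩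
    · exact ⟨_, hm hP hZ, by simp [icosaVec, rot_mul, rot_halfTurnZ, rot_cyclicTurn]⟩
  neighbor a c hs h0 i hi := by
    have r1 : rot fifthTurn (icosaVec φ 1) = icosaVec φ 2 := rot_fifthTurn_icosaVec 1
    have r2 : rot fifthTurn (icosaVec φ 2) = icosaVec φ 3 := rot_fifthTurn_icosaVec 2
    have r3 : rot fifthTurn (icosaVec φ 3) = icosaVec φ 4 := rot_fifthTurn_icosaVec 3
    have r4 : rot fifthTurn (icosaVec φ 4) = icosaVec φ 5 := rot_fifthTurn_icosaVec 4
    rcases lt_or_ge i 6 with hlt | hge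
    · fin_cases i
      · exact Or.inl rfl
      · exact Or.inr ⟨0, by simp⟩
      · exact Or.inr ⟨1, by rw [pow_one, r1]; rfl⟩
      · exact Or.inr ⟨2, by rw [pow_two, rot_mul, r1, r2]; rfl⟩
      · exact Or.inr ⟨3, by rw [pow_succ, pow_two, rot_mul, rot_mul, r1, r2, r3]; rfl⟩
      · refine Or.inr ⟨4, ?_⟩
        rw [pow_succ, pow_succ, pow_two, rot_mul, rot_mul, rot_mul, r1, r2, r3, r4]
        rfl
      all_goals exact absurd hlt (by decide)
    · exact absurd hi (icosa_not_adjacent hs h0 hge)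
  common a c hs h0 h1 i hi := by
    rcases lt_or_ge i 6 with hlt | hge
    · have h3 : ⟪a, icosaVec φ 3⟫ ≠ c := icosa_not_both hs 0 2
        (fun t ht m => by fin_cases m <;> simp [icosaVec] <;> linarith) h1
      have h4 : ⟪a, icosaVec φ 4⟫ ≠ c := icosa_not_both hs 0 5
        (fun t ht m => by fin_cases m <;> simp [icosaVec] <;> linarith) h1
      fin_cases i
      · simp
      · simp
      · simp
      · exact absurd hi h3
      · exact absurd hi h4
      · simp
      all_goals exact absurd hlt (by decide)
    · exact absurd hi (icosa_not_adjacent hs h0 hge)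
  not_both a c hs _ _ h2 := icosa_not_both hs 0 1
    (fun t ht m => by fin_cases m <;> simp [icosaVec] <;> linarith) h2
  edge := by
    obtain ⟨hl, hu⟩ := goldenRatio_bounds
    have ht := Real.goldenRatio_sq
    refine ⟨!₂[0, 0, 1], φ, ?_⟩
    generalize φ = t at *
    have key : ∀ i, ⟪(!₂[0, 0, 1] : E3), icosaVec t i⟫ ≤ t ∧
        (⟪(!₂[0, 0, 1] : E3), icosaVec t i⟫ = t ↔ i = 0 ∨ i = 1) := fun i => by
      fin_cases i <;> simp [icosaVec, inner_vec_vec] <;>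
        constructor <;> linarith
    exact ⟨⟨by linarith, fun i => (key i).1⟩, fun i => (key i).2⟩
  face := by
    obtain ⟨hl, hu⟩ := goldenRatio_bounds
    have ht := Real.goldenRatio_sq
    -- The sum of the three vertices is `φ` times this vector, by `φ² = φ + 1`.
    refine ⟨!₂[1, 0, φ + 1], 2 * φ + 1, ?_⟩
    generalize φ = t at *
    have key : ∀ i, ⟪(!₂[1, 0, t + 1] : E3), icosaVec t i⟫ ≤ 2 * t + 1 ∧
        (⟪(!₂[1, 0, t + 1] : E3), icosaVec t i⟫ = 2 * t + 1 ↔ i = 0 ∨ i = 1 ∨ i = 2) := fun i => by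
      fin_cases i <;> simp [icosaVec, inner_vec_vec] <;>
        constructor <;> linarith
    exact ⟨⟨by linarith, fun i => (key i).1⟩, fun i => (key i).2⟩

/-- Frames at the three representatives for the icosahedron. -/
def icosaFrame (t : ℝ) : Fin 3 → Fin 3 → E3 :=
  ![![!₂[1, 0, 0], !₂[0, t, -1], !₂[0, 1, t]],
    ![!₂[0, 1, 0], !₂[-1, 0, 0], !₂[0, 0, 1]],
    ![!₂[0, 1, 0], !₂[-t - 1, 0, 1], !₂[1, 0, t + 1]]]

/-- The quadratic form in the squares of the coordinates whose cyclic permutations vanish at the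
critical points, off the coordinate planes. -/
def icosaConic (t X Y Z : ℝ) : ℝ :=
  (t + 1) * X ^ 2 - (8 * t + 6) * X * Y + (3 * t + 2) * Y ^ 2 + (14 * t + 8) * X * Z -
    (6 * t + 2) * Y * Z - (4 * t + 3) * Z ^ 2

/-- The pencil of conics contains the line through two of the base points together with the line
through the other two. -/
theorem mul_eq_zero_of_icosaConic {t X Y Z : ℝ} (ht : t ^ 2 = t + 1)
    (h1 : icosaConic t X Y Z = 0) (h2 : icosaConic t Y Z X = 0) :
    (Y - (t + 1) * Z) * ((t + 2) * X - (t + 1) * Y - Z) = 0 := by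
  rw [icosaConic] at h1 h2
  grind

/-- Two degenerate members of the pencil, each a pair of lines, already determine the four common
points. They are the squared coordinates of `(1, 1, 1)` and of the cyclic permutations of `(t, 1, t
+ 1)`, as `(t + 1) ^ 2 = 3 * t + 2`. -/
theorem icosaConic_base_points {t X Y Z : ℝ} (ht : t ^ 2 = t + 1) (ht0 : 0 < t)
    (h1 : icosaConic t X Y Z = 0) (h2 : icosaConic t Y Z X = 0) (h3 : icosaConic t Z X Y = 0) :
    (X = Y ∧ Z = Y) ∨ (X = (t + 1) * Y ∧ Z = (3 * t + 2) * Y) ∨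
      (Y = (t + 1) * Z ∧ X = (3 * t + 2) * Z) ∨ (Z = (t + 1) * X ∧ Y = (3 * t + 2) * X) := by
  have key1 := mul_eq_zero_of_icosaConic ht h1 h2
  have key2 := mul_eq_zero_of_icosaConic ht h2 h3
  have ht1 : t + 1 ≠ 0 := by positivity
  rcases mul_eq_zero.1 key1 with e1 | e1 <;> rcases mul_eq_zero.1 key2 with e2 | e2
  · exact Or.inr (Or.inr (Or.inr ⟨by linarith, by grind⟩))
  · exact Or.inr (Or.inr (Or.inl ⟨by linarith, by grind⟩))
  · exact Or.inr (Or.inl ⟨by grind, by grind⟩)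
  · have h4 : (t + 1) * (Z - Y) = 0 := by grind
    have h5 : Z = Y := by linarith [(mul_eq_zero_iff_left ht1).1 h4]
    exact Or.inl ⟨by subst h5; linarith, h5⟩

/-- On a coordinate plane the conic splits into the squared vertices, with ratio `t`, and the
squared face centres, with ratio `t + 1`. -/
theorem icosaConic_zero_right {t X Y : ℝ} (ht : t ^ 2 = t + 1) (h : icosaConic t X Y 0 = 0) :
    Y = (t + 1) * X ∨ X = (3 * t + 2) * Y := by
  rw [icosaConic] at h
  have : (Y - (t + 1) * X) * (X - (3 * t + 2) * Y) = 0 := by grind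
  rcases mul_eq_zero.1 this with h | h
  · exact Or.inl (by linarith)
  · exact Or.inr (by linarith)

/-- Up to signs and cyclic permutations the solutions are `(0, 1, t)` (vertices), `(0, 0, 1)` and
`(t, 1, t + 1)` (edge midpoints), `(1, 0, t + 1)` and `(1, 1, 1)` (face centres). The coordinate
symmetries do not join the two kinds of edges or of faces; the fifth turn does. -/
theorem inOrbit_icosa {x : E3} (hx : x ≠ 0)
    (h1 : x 0 * x 1 * icosaConic φ (x 0 ^ 2) (x 1 ^ 2) (x 2 ^ 2) = 0)
    (h2 : x 1 * x 2 * icosaConic φ (x 1 ^ 2) (x 2 ^ 2) (x 0 ^ 2) = 0)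
    (h3 : x 2 * x 0 * icosaConic φ (x 2 ^ 2) (x 0 ^ 2) (x 1 ^ 2) = 0) :
    ∃ i, InOrbit icosahedron (icosaFrame φ i 2) x := by
  have ht := Real.goldenRatio_sq
  have ht0 := Real.goldenRatio_pos
  let Q : E3 → Prop := fun x => ∃ i, InOrbit icosahedron (icosaFrame φ i 2) x
  change Q x
  have hQ : ∀ g ∈ polyhedral icosahedron, ∀ x, Q (rot g x) → Q x :=
    fun g hg x ⟨i, h⟩ => ⟨i, h.of_rot hg⟩
  have hQc : ∀ a b c, Q !₂[c, a, b] → Q !₂[a, b, c] := fun a b c h =>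
    hQ _ cyclicTurn_mem_icosa _ (by rwa [rot_cyclicTurn])
  have hQx : ∀ a b c, Q !₂[a, -b, -c] → Q !₂[a, b, c] := fun a b c h =>
    hQ _ halfTurnX_mem_icosa _ (by rwa [rot_halfTurnX])
  have hQz : ∀ a b c, Q !₂[-a, -b, c] → Q !₂[a, b, c] := fun a b c h =>
    hQ _ halfTurnZ_mem_icosa _ (by rwa [rot_halfTurnZ])
  have hQm : ∀ {g} i (s : ℝ), g ∈ polyhedral icosahedron → 0 < s → ∀ a b c,
      !₂[a, b, c] = s • rot g (icosaFrame φ i 2) → Q !₂[a, b, c] :=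
    fun i s hg hs a b c h => ⟨i, _, hg, s, hs, h⟩
  -- Both signs of the last coordinate; with the half turns this covers all eight sign patterns.
  let T : ℝ → ℝ → ℝ → Prop := fun a b c => Q !₂[a, b, c] ∧ Q !₂[a, b, -c]
  have hTc : ∀ a b c, T c a b → T a b c := fun a b c ⟨h, h'⟩ => by
    refine ⟨hQc _ _ _ h, hQc _ _ _ (hQx _ _ _ (hQz _ _ _ ?_))⟩
    rwa [neg_neg, neg_neg]
  have T001 : ∀ a, a ≠ 0 → T 0 0 |a| := fun a ha => by
    have h : Q !₂[0, 0, |a|] := ⟨1, inOrbit_smul (abs_pos.2 ha) (by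
      ext i; fin_cases i <;> simp [icosaFrame])⟩
    exact ⟨h, hQx _ _ _ (by rwa [neg_zero, neg_neg])⟩
  have T01t : ∀ a, a ≠ 0 → T 0 |a| (φ * |a|) := fun a ha => by
    have h : Q !₂[0, |a|, φ * |a|] := ⟨0, inOrbit_smul (abs_pos.2 ha) (by
      ext i; fin_cases i <;> simp [icosaFrame, mul_comm])⟩
    exact ⟨h, hQx _ _ _ (hQz _ _ _ (by rwa [neg_zero, neg_neg, neg_neg]))⟩
  have T10t : ∀ a, a ≠ 0 → T |a| 0 ((φ + 1) * |a|) := fun a ha => by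
    have h : Q !₂[|a|, 0, (φ + 1) * |a|] := ⟨2, inOrbit_smul (abs_pos.2 ha) (by
      ext i; fin_cases i <;> simp [icosaFrame, mul_comm])⟩
    exact ⟨h, hQx _ _ _ (by rwa [neg_zero, neg_neg])⟩
  have T111 : ∀ a, a ≠ 0 → T |a| |a| |a| := fun a ha => by
    have hR := rot_fifthTurn
    -- The fifth turn takes `(1, 0, φ + 1)` to `φ` times `(1, 1, 1)`.
    have hs : 0 < |a| / φ := div_pos (abs_pos.2 ha) ht0
    have hs' : |a| / φ * φ = |a| := div_mul_cancel₀ _ ht0.ne'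
    refine ⟨hQm 2 _ fifthTurn_mem_icosa hs _ _ _ ?_,
      hQm 2 _ (Subgroup.mul_mem _ fifthTurn_mem_icosa
        (Subgroup.mul_mem _ cyclicTurn_mem_icosa halfTurnZ_mem_icosa)) hs _ _ _ ?_⟩ <;>
      generalize |a| / φ = s at * <;> generalize φ = t at * <;> ext i <;>
      fin_cases i <;> simp [icosaFrame, rot_mul, hR, rot_cyclicTurn, rot_halfTurnZ] <;> grind
  have Tt1t : ∀ a, a ≠ 0 → T (φ * |a|) |a| ((φ + 1) * |a|) := fun a ha => by
    have hR := rot_fifthTurn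
    -- The fifth turn takes `(0, 0, 1)` to `(φ, 1, φ + 1)` divided by `2 * φ`.
    have hs : 0 < 2 * (φ * |a|) := by positivity
    refine ⟨hQm 1 _ fifthTurn_mem_icosa hs _ _ _ ?_,
      hQm 1 _ (Subgroup.mul_mem _ halfTurnZ_mem_icosa
        (Subgroup.mul_mem _ fifthTurn_mem_icosa halfTurnX_mem_icosa)) hs _ _ _ ?_⟩ <;>
      generalize φ = t at * <;> ext i <;>
      fin_cases i <;> simp [icosaFrame, rot_mul, hR, rot_halfTurnX, rot_halfTurnZ] <;> grind
  have hne : ¬(x 0 = 0 ∧ x 1 = 0 ∧ x 2 = 0) := fun ⟨h0, h1, h2⟩ => hx <| by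
    rw [vec_eq_coord x, h0, h1, h2]
    ext i; fin_cases i <;> rfl
  have hT1 : ∀ {a b : ℝ}, a ^ 2 = b ^ 2 → |a| = |b| := (sq_eq_sq_iff_abs_eq_abs _ _).1
  have hT2 : ∀ {a b : ℝ}, a ^ 2 = (φ + 1) * b ^ 2 → |a| = φ * |b| := fun {a b} h => by
    rw [hT1 (h.trans (by rw [mul_pow, ht] : _ = (φ * b) ^ 2)), abs_mul, abs_of_pos ht0]
  have hT3 : ∀ {a b : ℝ}, a ^ 2 = (3 * φ + 2) * b ^ 2 → |a| = (φ + 1) * |b| := fun {a b} h => by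
    have e : (φ + 1) ^ 2 = 3 * φ + 2 := by linarith
    rw [hT1 (h.trans (by rw [mul_pow, e] : _ = ((φ + 1) * b) ^ 2)), abs_mul,
      abs_of_pos (by positivity)]
  have hT0 : ∀ {a b : ℝ}, a ≠ 0 → b ≠ 0 → a * b * icosaConic φ (a ^ 2) (b ^ 2) (0 ^ 2) = 0 →
      T |a| |b| 0 := fun {a b} ha hb h => by
    rw [mul_eq_zero_iff_left (mul_ne_zero ha hb), zero_pow two_ne_zero] at h
    rcases icosaConic_zero_right ht h with h | h
    · rw [hT2 h]
      exact hTc _ _ _ (T01t a ha)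
    · rw [hT3 h]
      exact hTc _ _ _ (hTc _ _ _ (T10t b hb))
  have hT : T |x 0| |x 1| |x 2| := by
    generalize x 0 = a at *
    generalize x 1 = b at *
    generalize x 2 = c at *
    rcases eq_or_ne a 0 with rfl | ha <;> rcases eq_or_ne b 0 with rfl | hb <;>
      rcases eq_or_ne c 0 with rfl | hc
    · exact absurd ⟨rfl, rfl, rfl⟩ hne
    · rw [abs_zero]
      exact T001 c hc
    · rw [abs_zero]
      exact hTc _ _ _ (T001 b hb)
    · rw [abs_zero]
      exact hTc _ _ _ (hTc _ _ _ (hT0 hb hc h2))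
    · rw [abs_zero]
      exact hTc _ _ _ (hTc _ _ _ (T001 a ha))
    · rw [abs_zero]
      exact hTc _ _ _ (hT0 hc ha h3)
    · rw [abs_zero]
      exact hT0 ha hb h1
    · rw [mul_eq_zero_iff_left (mul_ne_zero ‹_› ‹_›)] at h1 h2 h3
      rcases icosaConic_base_points ht ht0 h1 h2 h3 with ⟨e, e'⟩ | ⟨e, e'⟩ | ⟨e, e'⟩ | ⟨e, e'⟩
      · rw [hT1 e, hT1 e']
        exact T111 b hb
      · rw [hT2 e, hT3 e']
        exact Tt1t b hb
      · rw [hT2 e, hT3 e']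
        exact hTc _ _ _ (hTc _ _ _ (Tt1t c hc))
      · rw [hT2 e, hT3 e']
        exact hTc _ _ _ (Tt1t a ha)
  exact of_abs_coord (hQ _ halfTurnX_mem_icosa) (hQ _ halfTurnZ_mem_icosa) x (fun _ => hT.1)
    fun _ => hT.2

theorem sum_icosaVec_pow_five (t : ℝ) (x : E3) (j : Fin 3) :
    ∑ i, ⟪icosaVec t i, x⟫ ^ 5 * icosaVec t i j = 4 * x j *
      ((1 + t ^ 6) * (x j ^ 2) ^ 2 + 10 * t ^ 2 * x j ^ 2 * x (j + 1) ^ 2 +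
        5 * t ^ 4 * (x (j + 1) ^ 2) ^ 2 + 10 * t ^ 4 * x j ^ 2 * x (j + 2) ^ 2 +
        5 * t ^ 2 * (x (j + 2) ^ 2) ^ 2) := by
  simp only [inner_eq_coord]
  fin_cases j <;> simp [icosaVec, Fin.sum_univ_succ] <;> ring

/-- A component of the cross product of `x` with the gradient is divisible by the two coordinates
involved, and the cofactor is a quadratic form in the squares. Indices are cyclic, so one formula
covers the three equations. -/
theorem icosa_critical {x : E3} (h : IsTangentCritical (powerSeed (icosaVec φ) 6) x) (j : Fin 3) :
    x j * x (j + 1) * icosaConic φ (x j ^ 2) (x (j + 1) ^ 2) (x (j + 2) ^ 2) = 0 := by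
  have ht := Real.goldenRatio_sq
  have e := h.coord_mul_eq (by norm_num) j (j + 1)
  have e1 : j + 1 + 1 = j + 2 := by rw [add_assoc]; rfl
  have e2 : j + 1 + 2 = j := by rw [add_assoc]; exact add_zero j
  rw [show 6 - 1 = 5 from rfl, sum_icosaVec_pow_five, sum_icosaVec_pow_five, e1, e2] at e
  rw [icosaConic]
  generalize x j = a at *
  generalize x (j + 1) = b at *
  generalize x (j + 2) = c at *
  generalize φ = t at *
  have h3 : t ^ 4 = 3 * t + 2 := by grind
  have h4 : t ^ 6 = 8 * t + 5 := by grind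
  rw [h3, h4, ht] at e
  -- The equation `e` is `-4 √5` times the claimed one; multiplication by `2 * t - 1`, which is
  -- `√5`, removes the root, and the last term reduces the squares of `t` so created.
  linear_combination -(2 * t - 1) / 20 * e - 2 / 5 * (a * b) * (3 * a ^ 4 + 7 * b ^ 4 -
    20 * a ^ 2 * b ^ 2 + 30 * a ^ 2 * c ^ 2 - 10 * b ^ 2 * c ^ 2 - 10 * c ^ 4) * ht

/-- Reducing powers of `t` to affine expressions turns the sign conditions for the sextic into
linear inequalities, decided by the bounds on the golden ratio. -/
theorem pow_eq_fib {t : ℝ} (ht : t ^ 2 = t + 1) :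
    t ^ 3 = 2 * t + 1 ∧ t ^ 4 = 3 * t + 2 ∧ t ^ 5 = 5 * t + 3 ∧ t ^ 6 = 8 * t + 5 ∧
    t ^ 7 = 13 * t + 8 ∧ t ^ 8 = 21 * t + 13 ∧ t ^ 9 = 34 * t + 21 ∧ t ^ 10 = 55 * t + 34 ∧
    t ^ 11 = 89 * t + 55 ∧ t ^ 12 = 144 * t + 89 ∧ t ^ 13 = 233 * t + 144 ∧
    t ^ 14 = 377 * t + 233 := by
  have h : ∀ n : ℕ, t ^ (n + 2) = t ^ (n + 1) + t ^ n := fun n => by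
    rw [pow_add, ht]
    ring
  have h3 : t ^ 3 = t ^ 2 + t := by rw [h 1, pow_one]
  have h4 : t ^ 4 = t ^ 3 + t ^ 2 := h 2
  have h5 : t ^ 5 = t ^ 4 + t ^ 3 := h 3
  have h6 : t ^ 6 = t ^ 5 + t ^ 4 := h 4
  have h7 : t ^ 7 = t ^ 6 + t ^ 5 := h 5
  have h8 : t ^ 8 = t ^ 7 + t ^ 6 := h 6
  have h9 : t ^ 9 = t ^ 8 + t ^ 7 := h 7
  have h10 : t ^ 10 = t ^ 9 + t ^ 8 := h 8
  have h11 : t ^ 11 = t ^ 10 + t ^ 9 := h 9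
  have h12 : t ^ 12 = t ^ 11 + t ^ 10 := h 10
  have h13 : t ^ 13 = t ^ 12 + t ^ 11 := h 11
  have h14 : t ^ 14 = t ^ 13 + t ^ 12 := h 12
  refine ⟨?_, ?_, ?_, ?_, ?_, ?_, ?_, ?_, ?_, ?_, ?_, ?_⟩ <;> linarith

/-- The exponent is 6 because the sums of squares and of fourth powers are constant on the sphere
for the icosahedron. -/
theorem hasMorseModel_icosa :
    HasMorseModel (polyhedral icosahedron) (polyhedralPoints icosahedron) := by
  obtain ⟨hl, hu⟩ := goldenRatio_bounds
  have ht := Real.goldenRatio_sq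
  have hne : ∀ i, icosaFrame φ i 2 ≠ 0 := fun i => by
    fin_cases i
    · exact vec_ne_zero (Or.inr (Or.inl one_ne_zero))
    · exact vec_ne_zero (Or.inr (Or.inr one_ne_zero))
    · exact vec_ne_zero (Or.inl one_ne_zero)
  obtain ⟨p3, p4, p5, p6, p7, p8, p9, p10, p11, p12, p13, p14⟩ := pow_eq_fib ht
  refine isRegularList_icosa.hasMorseModel (k := 2 * 3) (by norm_num) (u := icosaFrame φ) ?_ ?_ ?_
    ?_ ?_ ?_ ?_ ?_ ?_ ?_
  · refine ⟨hne, rfl, ⟨2 * φ, by linarith, ?_⟩, ⟨φ, by linarith, ?_⟩⟩ <;> ext i <;>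
      generalize φ = t at * <;> fin_cases i <;> simp [icosaVec, icosaFrame] <;> linarith
  · intro i j l hjl
    generalize φ = t at *
    fin_cases i <;> fin_cases j <;> fin_cases l <;>
      first | exact absurd rfl hjl | (simp [icosaFrame, inner_vec_vec]; try linarith)
  · intro i
    generalize φ = t at *
    fin_cases i <;> simp [Matrix.det_fin_three, icosaFrame] <;> nlinarith
  · intro i
    fin_cases i
    · exact ⟨_, fifthTurn_mem_icosa, ne_one_of_rot_ne (x := icosaVec φ 1) (by
        rw [rot_fifthTurn_icosaVec]
        exact icosaVec_injective.ne (by decide)), rot_fifthTurn_icosaVec 0⟩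
    · exact ⟨_, halfTurnZ_mem_icosa, halfTurnZ_ne_one, by simp [icosaFrame, rot_halfTurnZ]⟩
    · have hR := rot_fifthTurn
      refine ⟨_, Subgroup.mul_mem _ fifthTurn_mem_icosa halfTurnZ_mem_icosa,
        ne_one_of_rot_ne (x := icosaVec φ 0) ?_, ?_⟩
      · have e : rot halfTurnZ (icosaVec φ 0) = icosaVec φ 1 := by simp [icosaVec, rot_halfTurnZ]
        rw [rot_mul, e, rot_fifthTurn_icosaVec]
        exact icosaVec_injective.ne (by decide)
      · generalize φ = t at *
        ext j
        fin_cases j <;> simp [icosaFrame, rot_mul, rot_halfTurnZ, hR] <;> linarith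
  · intro i
    generalize φ = t at *
    fin_cases i <;> simp [icosaFrame, icosaVec, Fin.sum_univ_succ, inner_vec_vec]
  · intro i
    generalize φ = t at *
    fin_cases i <;>
      simp [icosaFrame, icosaVec, Fin.sum_univ_succ, inner_vec_vec, norm_sq_vec, sgnX] <;>
      ring_nf <;> linarith
  · intro i
    generalize φ = t at *
    fin_cases i <;>
      simp [icosaFrame, icosaVec, Fin.sum_univ_succ, inner_vec_vec, norm_sq_vec, sgnY] <;>
      ring_nf <;> linarith
  · refine powerSeed_sph_lt (hne 0) (hne 1) ?_
    generalize φ = t at *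
    simp [icosaFrame, icosaVec, Fin.sum_univ_succ, inner_vec_vec, norm_sq_vec]
    ring_nf
    linarith
  · refine powerSeed_sph_lt (hne 1) (hne 2) ?_
    generalize φ = t at *
    simp [icosaFrame, icosaVec, Fin.sum_univ_succ, inner_vec_vec, norm_sq_vec]
    ring_nf
    linarith
  · intro q hq
    obtain ⟨i, hi⟩ := inOrbit_icosa (coe_sphere_ne_zero q) (icosa_critical hq 0)
      (icosa_critical hq 1) (icosa_critical hq 2)
    obtain ⟨h, hh, e⟩ := hi.eq_sph
    exact ⟨i, h, hh, e⟩

end SphereMorse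

end

theorem lemma3p15 (H : Subgroup SphereMorse.SO3) (X : Fin 3 → Set SphereMorse.S2)
    (hH : (∃ n : ℕ, 2 ≤ n ∧ H = SphereMorse.dihedral n ∧ X = SphereMorse.dihedralPoints n) ∨
      (∃ V : Set SphereMorse.S2, SphereMorse.IsRegularPolyhedron V ∧
        H = SphereMorse.polyhedral V ∧ X = SphereMorse.polyhedralPoints V)) :
    (⋃ i, X i) = SphereMorse.fixedSet H ∧
    ∃ f : SphereMorse.S2 → ℝ,
      SphereMorse.IsMorse 2 f ∧
      (∀ h ∈ H, ∀ p : SphereMorse.S2, f (h • p) = f p) ∧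
      SphereMorse.critSet 2 f = (⋃ i, X i) ∧
      (∀ i : Fin 3, ∀ p ∈ X i, SphereMorse.morseIndex 2 f p = (i : ℕ)) ∧
      (∀ i : Fin 3, ∀ p ∈ X i, ∃ ψ : ℝ × ℝ → SphereMorse.S2,
        SphereMorse.IsStereographicAt p ψ ∧
          ∀ᶠ z in 𝓝 (0 : ℝ × ℝ), f (ψ z) = SphereMorse.localModel i z) := by
  rcases hH with ⟨n, hn, rfl, rfl⟩ | ⟨V, ⟨g, W, hW, rfl⟩, rfl, rfl⟩
  · exact (SphereMorse.isMorseSeed_dihedral hn).hasMorseModel.conclusion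
  · rcases hW with rfl | rfl | rfl
    · exact (SphereMorse.hasMorseModel_tetra.move g).conclusion
    · exact (SphereMorse.hasMorseModel_octa.move g).conclusion
    · exact (SphereMorse.hasMorseModel_icosa.move g).conclusion
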